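/- Let $X,Y\subset\mathbb R^n$ be two strata, that is, disjoint (embedded) $C^2$ submanifolds with $X\subset\overline{Y}$ and $X\cup Y$ locally closed, both definable in one o-minimal structure expanding the real field. Let $0\in X$, let $\dim Y=\dim X+1$, and suppose that $Y\cap B(0,\varepsilon)$ is connected for all sufficiently small $\varepsilon>0$. Notation: $\pi$ is the nearest point retraction onto $X$ (defined near $X$), $\mu(w)=w/\|w\|$, $T$ and $N$ denote tangent and normal spaces, and for $y\in Y$ $$\alpha(y)=\max\{\langle\mu(a),\mu(b)\rangle : a\in N_yY\setminus\{0\},\ b\in T_{\pi(y)}X\setminus\{0\}\},\qquad \beta(y)=\max\{\langle\mu(a),\mu(\pi(y)-y)\rangle : a\in N_yY\setminus\{0\}\}$$ (a maximum over the empty set being $0$). The pair $(Y,X)$ satisfies $(b)$ if $\alpha(y)\to0$ and $\beta(y)\to0$ as $y\to x$, $y\in Y$, for every $x\in X$. With $S=X\cup Y$, the normal cone $C_XS$ is the set of points over $X$ of the closure in $\mathbb R^n\times\mathbb R^n$ of $\{(y,\mu(\pi(y)-y)) : y\in S\setminus X\}$, and $(Y,X)$ satisfies $(npf)$ if the projection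 $C_XS\to X$ is an open map. All properties below are understood near $0$, i.e. for $X\cap U$ and $Y\cap U$ with some open neighbourhood $U$ of $0$. Then $(Y,X)$ satisfies $(b)$ and $(npf)$ near $0$ if and only if $Y\cup X$ is, near $0$, a $C^1$ submanifold with boundary of $\mathbb R^n$ of dimension $\dim Y$. In that case its boundary is $X$ near $0$. -/

import Mathlib

open Set Filter Topology

universe u v

noncomputable section

/-- An o-minimal structure expanding the real field: a first-order structure on `ℝ` in which (with
real parameters) addition and multiplication are definable, and every definable subset of the line
is a finite union of intervals. An order-connected subset of `ℝ` is exactly an interval of any kind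
(possibly empty, a point, or unbounded). The order is definable from the field operations. -/
structure IsOMinimalExpansionOfRealField (L : FirstOrder.Language.{u, v}) [L.Structure ℝ] :
    Prop where
  definable_add : (univ : Set ℝ).Definable L {w : Fin 3 → ℝ | w 0 + w 1 = w 2}
  definable_mul : (univ : Set ℝ).Definable L {w : Fin 3 → ℝ | w 0 * w 1 = w 2}
  finite_union_intervals : ∀ s : Set ℝ, (univ : Set ℝ).Definable₁ L s →
    ∃ F : Set (Set ℝ), F.Finite ∧ (∀ I ∈ F, I.OrdConnected) ∧ s = ⋃₀ F

/-- Euclidean `n`-space. -/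
abbrev RSpace (n : ℕ) : Type := EuclideanSpace ℝ (Fin n)

/-- A subset of Euclidean space is definable (with real parameters) in the structure `L` on `ℝ`. -/
def IsDefinableSet (L : FirstOrder.Language.{u, v}) [L.Structure ℝ] {n : ℕ}
    (A : Set (RSpace n)) : Prop :=
  (univ : Set ℝ).Definable L {w : Fin n → ℝ | WithLp.toLp 2 w ∈ A}

/-- The linear model `ℝ^d × {0} ⊆ ℝ^n`. -/
def linearModel (n d : ℕ) : Set (RSpace n) :=
  {w | ∀ i : Fin n, d ≤ (i : ℕ) → w i = 0}

/-- The half-space model `ℝ^(d-1) × [0, ∞) × {0} ⊆ ℝ^n` (for `1 ≤ d ≤ n`); the distinguished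
coordinate is the `d`-th one, of index `d - 1`. -/
def halfModel (n d : ℕ) : Set (RSpace n) :=
  {w | w ∈ linearModel n d ∧ ∀ i : Fin n, (i : ℕ) + 1 = d → 0 ≤ w i}

/-- `Φ` is a `C^r` diffeomorphism between open subsets of `ℝ^n`, defined near `p`, which carries `M`
onto the model set `A`. -/
def IsStraightening {n : ℕ} (r : WithTop ℕ∞) (M A : Set (RSpace n)) (p : RSpace n)
    (Φ : OpenPartialHomeomorph (RSpace n) (RSpace n)) : Prop :=
  p ∈ Φ.source ∧ ContDiffOn ℝ r Φ Φ.source ∧ ContDiffOn ℝ r Φ.symm Φ.target ∧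
    ∀ q ∈ Φ.source, q ∈ M ↔ Φ q ∈ A

/-- `M` is an (embedded, not necessarily closed) `C^r` submanifold of `ℝ^n` of dimension `d`. -/
def IsSubmanifold {n : ℕ} (r : WithTop ℕ∞) (d : ℕ) (M : Set (RSpace n)) : Prop :=
  d ≤ n ∧ ∀ p ∈ M, ∃ Φ, IsStraightening r M (linearModel n d) p Φ

/-- `M` is a `C^r` submanifold with boundary of `ℝ^n` of dimension `d`. (At an interior point the
straightening can be taken with image in the open half-space.) -/
def IsSubmanifoldWithBoundary {n : ℕ} (r : WithTop ℕ∞) (d : ℕ) (M : Set (RSpace n)) : Prop :=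
  d ≤ n ∧ ∀ p ∈ M, ∃ Φ, IsStraightening r M (halfModel n d) p Φ

/-- The boundary of a `d`-dimensional `C^r` submanifold with boundary: the points that some
straightening maps into the boundary hyperplane of the half-space. -/
def submanifoldBoundary {n : ℕ} (r : WithTop ℕ∞) (d : ℕ) (M : Set (RSpace n)) : Set (RSpace n) :=
  {p | p ∈ M ∧ ∃ Φ, IsStraightening r M (halfModel n d) p Φ ∧
    ∃ i : Fin n, (i : ℕ) + 1 = d ∧ Φ p i = 0}

/-- The tangent space `T_p M`: velocities at `p` of curves in `M`. -/
def tangentVectors {n : ℕ} (M : Set (RSpace n)) (p : RSpace n) : Set (RSpace n) :=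
  {w | ∃ γ : ℝ → RSpace n, γ 0 = p ∧ (∀ᶠ t in 𝓝 0, γ t ∈ M) ∧ HasDerivAt γ w 0}

/-- The normal space `N_p M`, the orthogonal complement of `T_p M`. -/
def normalVectors {n : ℕ} (M : Set (RSpace n)) (p : RSpace n) : Set (RSpace n) :=
  {w | ∀ z ∈ tangentVectors M p, inner ℝ z w = 0}

/-- `μ(w) = w / |w|`. -/
def unitVector {n : ℕ} (w : RSpace n) : RSpace n := ‖w‖⁻¹ • w

/-- The retraction `π` onto `X`: a point of `X` nearest to `y`. Near every point of a `C^2`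
submanifold `X` such a point exists and is unique; elsewhere the value is irrelevant. -/
def nearestPoint {n : ℕ} (X : Set (RSpace n)) (y : RSpace n) : RSpace n :=
  Classical.epsilon fun x => x ∈ X ∧ dist y x = Metric.infDist y X

/-- `α_{Y,X}(y)`, the distance of `T_{π(y)} X` to `T_y Y`: the maximum of `⟨μ(a), μ(b)⟩` over nonzero
`a ∈ N_y Y` and `b ∈ T_{π(y)} X` (zero if there are no such vectors). -/
def whitneyAlpha {n : ℕ} (X Y : Set (RSpace n)) (y : RSpace n) : ℝ :=
  sSup {s | ∃ a ∈ normalVectors Y y, ∃ b ∈ tangentVectors X (nearestPoint X y),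
    a ≠ 0 ∧ b ≠ 0 ∧ s = inner ℝ (unitVector a) (unitVector b)}

/-- `β_{Y,X}(y)`, the angle of the secant `π(y) - y` to `T_y Y`: the maximum of
`⟨μ(a), μ(π(y) - y)⟩` over nonzero `a ∈ N_y Y` (zero if there are no such vectors). -/
def whitneyBeta {n : ℕ} (X Y : Set (RSpace n)) (y : RSpace n) : ℝ :=
  sSup {s | ∃ a ∈ normalVectors Y y,
    a ≠ 0 ∧ s = inner ℝ (unitVector a) (unitVector (nearestPoint X y - y))}

/-- The pair `(Y, X)` satisfies Whitney's condition (b) at every point of `X`. -/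
def WhitneyB {n : ℕ} (X Y : Set (RSpace n)) : Prop :=
  ∀ x ∈ X, Tendsto (whitneyAlpha X Y) (𝓝[Y] x) (𝓝 0) ∧
    Tendsto (whitneyBeta X Y) (𝓝[Y] x) (𝓝 0)

/-- The normal cone `C_X S`: the restriction to `X` of the closure of the set of pairs
`(y, μ(π(y) - y))`, `y ∈ S \ X`. -/
def normalCone {n : ℕ} (X S : Set (RSpace n)) : Set (RSpace n × RSpace n) :=
  {q | q.1 ∈ X ∧ q ∈ closure ((fun y => (y, unitVector (nearestPoint X y - y))) '' (S \ X))}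

/-- `S` is normally pseudo-flat along `X`: the projection `C_X S → X` is open. -/
def NormallyPseudoFlat {n : ℕ} (X S : Set (RSpace n)) : Prop :=
  IsOpenMap (fun q : normalCone X S => (⟨(q : RSpace n × RSpace n).1, q.2.1⟩ : X))

end

/-!
Near `0` the stratum `X` is the graph of a `C^1` section `g` of a linear projection `P`.

Assume (b) and (npf). By (b), the map `y ↦ (P y, ‖y - g (P y)‖)` is a local diffeomorphism from `Y`
to a half-space. It is proper over a ball times an interval, which is simply connected, so, `Y`
being connected, it has an inverse `s (u, t)` there. By o-minimality the direction of `s (u, t) - g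
u` has a limit as `t → 0` for each fixed `u`; by Baire the limit is joint in `(u, t)` at a dense
set of `u`, and openness of the projection of the normal cone makes it joint at every `u`. Hence
`s`, extended oddly to `t < 0` by `2 g u - s (u, -t)`, is a `C^1` parametrization of a manifold
which `Y ∪ X` fills on one side of `X`.

Conversely, if `Y ∪ X` is a manifold with boundary, then `Y` lies on one side of `X` in it, and a
linear height over `X` yields a parametrization of `Y` that is `C^1` up to `X`. Its derivative at
`X` gives the limits of the tangent spaces, of the secants and of the normal directions.
-/

open Metric (ball closedBall)
open Asymptotics

section LocalDiffeo

variable {E F : Type*} [NormedAddCommGroup E] [NormedSpace ℝ E] [NormedAddCommGroup F]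
  [NormedSpace ℝ F] [FiniteDimensional ℝ E] [FiniteDimensional ℝ F]

lemma exists_continuousLinearEquiv_coe_eq (hEF : Module.finrank ℝ E = Module.finrank ℝ F)
    {A : E →L[ℝ] F} (hA : Function.Injective A) : ∃ B : E ≃L[ℝ] F, (B : E →L[ℝ] F) = A :=
  ⟨(LinearEquiv.ofInjectiveOfFinrankEq (A : E →ₗ[ℝ] F) hA hEF).toContinuousLinearEquiv, rfl⟩

lemma exists_openPartialHomeomorph_of_injective_fderiv
    (hEF : Module.finrank ℝ E = Module.finrank ℝ F) {f : E → F} {p : E} (hf : ContDiffAt ℝ 1 f p)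
    (hinj : Function.Injective (fderiv ℝ f p)) :
    ∃ e : OpenPartialHomeomorph E F, p ∈ e.source ∧ ⇑e = f ∧ ContDiffOn ℝ 1 e e.source ∧
      ContDiffOn ℝ 1 e.symm e.target := by
  have : CompleteSpace E := FiniteDimensional.complete ℝ E
  obtain ⟨B, hB⟩ := exists_continuousLinearEquiv_coe_eq hEF hinj
  have hd : HasFDerivAt f (B : E →L[ℝ] F) p := by
    rw [hB]
    exact (hf.differentiableAt one_ne_zero).hasFDerivAt
  let e := hf.toOpenPartialHomeomorph f hd one_ne_zero
  have hp : p ∈ e.source := hf.mem_toOpenPartialHomeomorph_source hd one_ne_zero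
  have he : ⇑e = f := hf.toOpenPartialHomeomorph_coe hd one_ne_zero
  have h1 : (1 : WithTop ℕ∞) ≠ ((⊤ : ℕ∞) : WithTop ℕ∞) := by simp
  refine ⟨e.restrContDiff ℝ 1 h1, ⟨hp, ?_, ?_⟩, he, e.contDiffOn_restrContDiff_source ℝ h1,
    e.contDiffOn_restrContDiff_target ℝ h1⟩
  · rwa [he]
  · rw [he]
    exact hf.to_localInverse hd one_ne_zero

end LocalDiffeo

section Straightening

variable {n k d : ℕ} {r : WithTop ℕ∞} {M M' N A : Set (RSpace n)} {p : RSpace n}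
  {Φ : OpenPartialHomeomorph (RSpace n) (RSpace n)}

/-- The coordinates of index at least `d`, whose vanishing defines `linearModel n d`. -/
noncomputable def lastCoords (n d : ℕ) : RSpace n →L[ℝ] ({i : Fin n // d ≤ (i : ℕ)} → ℝ) :=
  ContinuousLinearMap.pi fun i => EuclideanSpace.proj i.1

lemma mem_linearModel_iff {w : RSpace n} : w ∈ linearModel n d ↔ lastCoords n d w = 0 := by
  simp [linearModel, lastCoords, funext_iff]

lemma card_subtype_le_val (n d : ℕ) : Fintype.card {i : Fin n // d ≤ (i : ℕ)} = n - d := by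
  have hlt : Fintype.card {i : Fin n // (i : ℕ) < d} = min n d := by
    rw [Fintype.card_subtype, Fin.card_filter_val_lt]
  have hcompl := Fintype.card_subtype_compl fun i : Fin n => (i : ℕ) < d
  simp only [not_lt] at hcompl
  rw [hcompl, hlt, Fintype.card_fin]
  omega

lemma lastCoords_surjective (n d : ℕ) : Function.Surjective (lastCoords n d) := fun c =>
  ⟨WithLp.toLp 2 fun i => if h : d ≤ (i : ℕ) then c ⟨i, h⟩ else 0, by
    ext i
    simp [lastCoords, i.2]⟩

/-- The linear model as a linear subspace. -/
noncomputable def linearSubspace (n d : ℕ) : Submodule ℝ (RSpace n) :=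
  (lastCoords n d).ker

lemma mem_linearSubspace {w : RSpace n} : w ∈ linearSubspace n d ↔ w ∈ linearModel n d :=
  mem_linearModel_iff.symm

lemma finrank_linearSubspace (hd : d ≤ n) : Module.finrank ℝ (linearSubspace n d) = d := by
  have hrank := (lastCoords n d).toLinearMap.finrank_range_add_finrank_ker
  rw [LinearMap.range_eq_top.2 (lastCoords_surjective n d), finrank_top, Module.finrank_pi,
    card_subtype_le_val, finrank_euclideanSpace_fin] at hrank
  change _ + Module.finrank ℝ (linearSubspace n d) = n at hrank
  omega

lemma tangentVectors_subset_of_eventually (h : ∀ᶠ q in 𝓝 p, q ∈ M → q ∈ N) :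
    tangentVectors M p ⊆ tangentVectors N p := by
  rintro v ⟨γ, rfl, hγ, hγd⟩
  refine ⟨γ, rfl, ?_, hγd⟩
  filter_upwards [hγ, hγd.continuousAt.eventually h] with t hM hN using hN hM

namespace IsStraightening

lemma of_le (h : IsStraightening r M A p Φ) {s : WithTop ℕ∞} (hs : s ≤ r) :
    IsStraightening s M A p Φ :=
  ⟨h.1, h.2.1.of_le hs, h.2.2.1.of_le hs, h.2.2.2⟩

lemma restrOpen (h : IsStraightening r M A p Φ) {O : Set (RSpace n)} (hO : IsOpen O) (hp : p ∈ O)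
    (hM : ∀ q ∈ O, q ∈ M' ↔ q ∈ M) : IsStraightening r M' A p (Φ.restrOpen O hO) :=
  ⟨⟨h.1, hp⟩, h.2.1.mono inter_subset_left, h.2.2.1.mono inter_subset_left,
    fun q hq => (hM q hq.2).trans (h.2.2.2 q hq.1)⟩

lemma eventually_mem_source {γ : ℝ → RSpace n} (h : IsStraightening r M A (γ 0) Φ)
    (hγ : ContinuousAt γ 0) : ∀ᶠ t in 𝓝 (0 : ℝ), γ t ∈ Φ.source :=
  hγ.eventually (Φ.open_source.mem_nhds h.1)

lemma exists_hasFDerivAt_equiv (h : IsStraightening 1 M A p Φ) :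
    ∃ B : RSpace n ≃L[ℝ] RSpace n, HasFDerivAt Φ (B : RSpace n →L[ℝ] RSpace n) p ∧
      HasFDerivAt Φ.symm (B.symm : RSpace n →L[ℝ] RSpace n) (Φ p) := by
  obtain ⟨hp, hΦ, hΦ', -⟩ := h
  have hd : HasFDerivAt Φ (fderiv ℝ Φ p) p :=
    ((hΦ.contDiffAt (Φ.open_source.mem_nhds hp)).differentiableAt one_ne_zero).hasFDerivAt
  have hd' : HasFDerivAt Φ.symm (fderiv ℝ Φ.symm (Φ p)) (Φ p) :=
    ((hΦ'.contDiffAt (Φ.open_target.mem_nhds (Φ.map_source hp))).differentiableAt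
      one_ne_zero).hasFDerivAt
  have hid : (fderiv ℝ Φ.symm (Φ p)).comp (fderiv ℝ Φ p) = .id ℝ (RSpace n) :=
    (hd'.comp p hd).unique ((hasFDerivAt_id p).congr_of_eventuallyEq (Φ.eventually_left_inverse hp))
  have hinj : Function.Injective (fderiv ℝ Φ p) :=
    Function.LeftInverse.injective fun v => DFunLike.congr_fun hid v
  obtain ⟨B, hB⟩ := exists_continuousLinearEquiv_coe_eq rfl hinj
  refine ⟨B, hB ▸ hd, Φ.hasFDerivAt_symm (Φ.map_source hp) ?_⟩
  rwa [Φ.left_inv hp, hB]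

lemma hasDerivAt_comp (h : IsStraightening 1 M A p Φ) {γ : ℝ → RSpace n} (hp : γ 0 = p)
    {v : RSpace n} (hγ : HasDerivAt γ v 0) (i : Fin n) :
    HasDerivAt (fun t => Φ (γ t) i) (fderiv ℝ Φ p v i) 0 := by
  subst hp
  obtain ⟨B, hB, -⟩ := h.exists_hasFDerivAt_equiv
  rw [hB.fderiv]
  exact (EuclideanSpace.proj (𝕜 := ℝ) i).hasFDerivAt.comp_hasDerivAt 0 (hB.comp_hasDerivAt 0 hγ)

lemma mem_tangentVectors_iff (h : IsStraightening 1 M (linearModel n d) p Φ) (hp : p ∈ M)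
    (v : RSpace n) : v ∈ tangentVectors M p ↔ fderiv ℝ Φ p v ∈ linearModel n d := by
  constructor
  · rintro ⟨γ, rfl, hγ, hd⟩ i hi
    refine (h.hasDerivAt_comp rfl hd i).unique
      ((hasDerivAt_const 0 (0 : ℝ)).congr_of_eventuallyEq ?_)
    filter_upwards [hγ, h.eventually_mem_source hd.continuousAt] with t ht hts
    exact (h.2.2.2 _ hts).1 ht i hi
  · intro hv
    obtain ⟨B, hB, hB'⟩ := h.exists_hasFDerivAt_equiv
    rw [hB.fderiv] at hv
    have hl : HasDerivAt (fun t : ℝ => Φ p + t • B v) (B v) 0 := by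
      simpa using ((hasDerivAt_id (0 : ℝ)).smul_const (B v)).const_add (Φ p)
    have h0 : Φ p + (0 : ℝ) • B v = Φ p := by simp
    refine ⟨fun t => Φ.symm (Φ p + t • B v), by simp [Φ.left_inv h.1], ?_, ?_⟩
    · have hlim : Tendsto (fun t : ℝ => Φ p + t • B v) (𝓝 0) (𝓝 (Φ p)) := by
        simpa only [ContinuousAt, h0] using hl.continuousAt
      filter_upwards [hlim.eventually (Φ.open_target.mem_nhds (Φ.map_source h.1))] with t ht
      rw [h.2.2.2 _ (Φ.map_target ht), Φ.right_inv ht, ← mem_linearSubspace]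
      exact add_mem (mem_linearSubspace.2 ((h.2.2.2 p h.1).1 hp))
        (Submodule.smul_mem _ t (mem_linearSubspace.2 hv))
    · rw [← h0] at hB'
      have hd := hB'.comp_hasDerivAt 0 hl
      rwa [ContinuousLinearEquiv.coe_coe, B.symm_apply_apply] at hd

lemma exists_submodule_coe_eq_tangentVectors (h : IsStraightening 1 M (linearModel n d) p Φ)
    (hp : p ∈ M) (hd : d ≤ n) :
    ∃ S : Submodule ℝ (RSpace n), (S : Set (RSpace n)) = tangentVectors M p ∧
      Module.finrank ℝ S = d := by
  obtain ⟨B, hB, -⟩ := h.exists_hasFDerivAt_equiv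
  refine ⟨(linearSubspace n d).comap (B : RSpace n →ₗ[ℝ] RSpace n), ?_, ?_⟩
  · ext v
    rw [h.mem_tangentVectors_iff hp, hB.fderiv]
    exact mem_linearSubspace
  · exact (B.toLinearEquiv.ofSubmodule' (linearSubspace n d)).finrank_eq.trans
      (finrank_linearSubspace hd)

lemma fderiv_mem_linearModel_of_boundary (h : IsStraightening 1 M (halfModel n (k + 1)) p Φ)
    {i : Fin n} (hi : (i : ℕ) = k) (hp : Φ p i = 0) {v : RSpace n} (hv : v ∈ tangentVectors M p) :
    fderiv ℝ Φ p v ∈ linearModel n k := by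
  obtain ⟨γ, rfl, hγ, hd⟩ := hv
  have hmodel : ∀ᶠ t in 𝓝 (0 : ℝ), Φ (γ t) ∈ halfModel n (k + 1) := by
    filter_upwards [hγ, h.eventually_mem_source hd.continuousAt] with t ht hts
    exact (h.2.2.2 _ hts).1 ht
  intro j hj
  have hdj := h.hasDerivAt_comp rfl hd j
  rcases hj.eq_or_lt with hj | hj
  · -- the boundary coordinate is minimal at `p`
    obtain rfl : j = i := Fin.ext (by omega)
    refine IsLocalMin.hasDerivAt_eq_zero (a := 0) ?_ hdj
    filter_upwards [hmodel] with t ht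
    rw [hp]
    exact ht.2 j (by omega)
  · refine hdj.unique ((hasDerivAt_const 0 (0 : ℝ)).congr_of_eventuallyEq ?_)
    filter_upwards [hmodel] with t ht using ht.1 j (by omega)

lemma exists_prod_chart (h : IsStraightening 1 M (linearModel n d) p Φ) (hp : p ∈ M) (hd : d ≤ n)
    {G : Type*} [NormedAddCommGroup G] [NormedSpace ℝ G] [FiniteDimensional ℝ G]
    (hG : Module.finrank ℝ G = d) {f : RSpace n → G} (hf : ContDiffAt ℝ 1 f p)
    (hinj : ∀ v ∈ tangentVectors M p, fderiv ℝ f p v = 0 → v = 0) :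
    ∃ e : OpenPartialHomeomorph (RSpace n) (G × ({i : Fin n // d ≤ (i : ℕ)} → ℝ)), p ∈ e.source ∧
      ContDiffOn ℝ 1 e.symm e.target ∧ (∀ q, (e q).1 = f q) ∧
      ∀ q ∈ e.source, q ∈ M ↔ (e q).2 = 0 := by
  have hΦ : ContDiffAt ℝ 1 Φ p := h.2.1.contDiffAt (Φ.open_source.mem_nhds h.1)
  let F : RSpace n → G × ({i : Fin n // d ≤ (i : ℕ)} → ℝ) := fun q => (f q, lastCoords n d (Φ q))
  have hF : ContDiffAt ℝ 1 F p := hf.prodMk ((lastCoords n d).contDiff.contDiffAt.comp p hΦ)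
  have hdF : HasFDerivAt F ((fderiv ℝ f p).prod ((lastCoords n d).comp (fderiv ℝ Φ p))) p :=
    (hf.differentiableAt one_ne_zero).hasFDerivAt.prodMk
      ((lastCoords n d).hasFDerivAt.comp p (hΦ.differentiableAt one_ne_zero).hasFDerivAt)
  have hinjF : Function.Injective (fderiv ℝ F p) := by
    rw [hdF.fderiv, injective_iff_map_eq_zero]
    intro v hv
    exact hinj v ((h.mem_tangentVectors_iff hp v).2 (mem_linearModel_iff.2 (congrArg Prod.snd hv)))
      (congrArg Prod.fst hv)
  obtain ⟨e, hpe, he, -, he'⟩ := exists_openPartialHomeomorph_of_injective_fderiv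
    (by simp [hG, card_subtype_le_val, hd]) hF hinjF
  refine ⟨e.restrOpen Φ.source Φ.open_source, ⟨hpe, h.1⟩, he'.mono inter_subset_left,
    fun q => congrArg Prod.fst (congrFun he q), fun q hq => ?_⟩
  rw [h.2.2.2 q hq.2, mem_linearModel_iff]
  exact (congrArg (fun y => y.2 = 0) (congrFun he q)).to_iff.symm

lemma exists_local_param (h : IsStraightening 1 M (linearModel n d) p Φ) (hp : p ∈ M) (hd : d ≤ n)
    {G : Type*} [NormedAddCommGroup G] [NormedSpace ℝ G] [FiniteDimensional ℝ G]
    (hG : Module.finrank ℝ G = d) {f : RSpace n → G} (hf : ContDiffAt ℝ 1 f p)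
    (hinj : ∀ v ∈ tangentVectors M p, fderiv ℝ f p v = 0 → v = 0) :
    ∃ (O : Set (RSpace n)) (O' : Set G) (g : G → RSpace n), IsOpen O ∧ p ∈ O ∧ IsOpen O' ∧
      ContDiffOn ℝ 1 g O' ∧ MapsTo f (M ∩ O) O' ∧ MapsTo g O' (M ∩ O) ∧
      InvOn g f (M ∩ O) O' := by
  obtain ⟨e, hpe, he', hef, heM⟩ := h.exists_prod_chart hp hd hG hf hinj
  have he : ∀ q ∈ M ∩ e.source, e q = (f q, 0) := fun q hq =>
    Prod.ext (hef q) ((heM q hq.2).1 hq.1)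
  have hι : Continuous fun b : G => (b, (0 : {i : Fin n // d ≤ (i : ℕ)} → ℝ)) := by fun_prop
  refine ⟨e.source, (fun b => (b, 0)) ⁻¹' e.target, fun b => e.symm (b, 0), e.open_source, hpe,
    e.open_target.preimage hι, he'.comp (by fun_prop) fun b hb => hb, fun q hq => ?_,
    fun b hb => ⟨?_, e.map_target hb⟩, fun q hq => ?_, fun b hb => ?_⟩
  · rw [mem_preimage, ← he q hq]
    exact e.map_source hq.2
  · rw [heM _ (e.map_target hb), e.right_inv hb]
  · change e.symm (f q, 0) = q
    rw [← he q hq, e.left_inv hq.2]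
  · rw [← hef, e.right_inv hb]

end IsStraightening

namespace IsSubmanifold

lemma inter_isOpen (h : IsSubmanifold r d M) {U : Set (RSpace n)} (hU : IsOpen U) :
    IsSubmanifold r d (M ∩ U) :=
  ⟨h.1, fun p hp => (h.2 p hp.1).imp' (fun Φ => Φ.restrOpen U hU) fun _ hΦ =>
    hΦ.restrOpen hU hp.2 fun _ hq => and_iff_left hq⟩

lemma of_le {r' : WithTop ℕ∞} (h : IsSubmanifold r d M) (hr : r' ≤ r) : IsSubmanifold r' d M :=
  ⟨h.1, fun p hp => (h.2 p hp).imp fun _ hΦ => hΦ.of_le hr⟩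

end IsSubmanifold

/-- At a boundary point, all tangent vectors to `N` would be tangent to the boundary of `M`. -/
lemma IsStraightening.apply_ne_zero_of_isSubmanifold
    (h : IsStraightening 1 M (halfModel n (k + 1)) p Φ) (hN : IsSubmanifold 1 (k + 1) N)
    (hp : p ∈ N) (hNM : ∀ᶠ q in 𝓝 p, q ∈ N → q ∈ M) {i : Fin n} (hi : (i : ℕ) = k) :
    Φ p i ≠ 0 := by
  intro h0
  obtain ⟨Ψ, hΨ⟩ := hN.2 p hp
  obtain ⟨S, hS, hSdim⟩ := hΨ.exists_submodule_coe_eq_tangentVectors hp hN.1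
  obtain ⟨B, hB, -⟩ := h.exists_hasFDerivAt_equiv
  have hmap : S.map (B : RSpace n →ₗ[ℝ] RSpace n) ≤ linearSubspace n k := by
    rintro _ ⟨v, hv, rfl⟩
    rw [hS] at hv
    have hBv := h.fderiv_mem_linearModel_of_boundary hi h0
      (tangentVectors_subset_of_eventually hNM hv)
    rw [hB.fderiv] at hBv
    exact mem_linearSubspace.2 hBv
  have hle := Submodule.finrank_mono hmap
  rw [finrank_linearSubspace (by have := hN.1; omega)] at hle
  have hrank : Module.finrank ℝ (S.map (B : RSpace n →ₗ[ℝ] RSpace n)) = k + 1 :=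
    (LinearEquiv.finrank_map_eq B.toLinearEquiv S).trans hSdim
  omega

end Straightening

section Tube

variable {n k : ℕ} {X Y : Set (RSpace n)} {P : RSpace n →L[ℝ] RSpace k} {g : RSpace k → RSpace n}
  {δ : ℝ} {u : RSpace k}

/-- The points `y` over the ball of radius `δ` at distance less than `δ` from the point of the graph
of `g` with the same image under `P`. -/
def tubeSet (P : RSpace n →L[ℝ] RSpace k) (g : RSpace k → RSpace n) (δ : ℝ) : Set (RSpace n) :=
  {y | ‖P y‖ < δ ∧ ‖y - g (P y)‖ < δ}

/-- Inside its `δ`-tube, `X` is the image of the `C^1` section `g` of the linear map `P`. -/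
structure IsTube (X : Set (RSpace n)) (P : RSpace n →L[ℝ] RSpace k) (g : RSpace k → RSpace n)
    (δ : ℝ) : Prop where
  pos : 0 < δ
  zero : g 0 = 0
  smooth : ContDiffOn ℝ 1 g (ball 0 δ)
  proj : ∀ u ∈ ball (0 : RSpace k) δ, P (g u) = u
  mem_iff : ∀ y ∈ tubeSet P g δ, y ∈ X ↔ y = g (P y)

lemma proj_mem_ball_of_mem_tubeSet {y : RSpace n} (hy : y ∈ tubeSet P g δ) :
    P y ∈ ball (0 : RSpace k) δ := mem_ball_zero_iff.2 hy.1

lemma tubeSet_mono {δ' : ℝ} (h : δ' ≤ δ) : tubeSet P g δ' ⊆ tubeSet P g δ :=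
  fun _ hy => ⟨hy.1.trans_le h, hy.2.trans_le h⟩

namespace IsTube

lemma mono (h : IsTube X P g δ) {δ' : ℝ} (h0 : 0 < δ') (hδ : δ' ≤ δ) : IsTube X P g δ' :=
  ⟨h0, h.zero, h.smooth.mono (Metric.ball_subset_ball hδ),
    fun u hu => h.proj u (Metric.ball_subset_ball hδ hu),
    fun y hy => h.mem_iff y (tubeSet_mono hδ hy)⟩

lemma congr (h : IsTube X P g δ) {X' : Set (RSpace n)}
    (hX : ∀ y ∈ tubeSet P g δ, y ∈ X' ↔ y ∈ X) : IsTube X' P g δ :=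
  ⟨h.pos, h.zero, h.smooth, h.proj, fun y hy => (hX y hy).trans (h.mem_iff y hy)⟩

lemma zero_mem_ball (h : IsTube X P g δ) : (0 : RSpace k) ∈ ball (0 : RSpace k) δ :=
  Metric.mem_ball_self h.pos

lemma contDiffAt (h : IsTube X P g δ) (hu : u ∈ ball (0 : RSpace k) δ) : ContDiffAt ℝ 1 g u :=
  h.smooth.contDiffAt (Metric.isOpen_ball.mem_nhds hu)

lemma hasStrictFDerivAt (h : IsTube X P g δ) (hu : u ∈ ball (0 : RSpace k) δ) :
    HasStrictFDerivAt g (fderiv ℝ g u) u := (h.contDiffAt hu).hasStrictFDerivAt one_ne_zero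

lemma continuousAt_fderiv (h : IsTube X P g δ) (hu : u ∈ ball (0 : RSpace k) δ) :
    ContinuousAt (fderiv ℝ g) u := (h.contDiffAt hu).continuousAt_fderiv one_ne_zero

lemma continuousOn_sub (h : IsTube X P g δ) :
    ContinuousOn (fun y => y - g (P y)) (P ⁻¹' ball 0 δ) :=
  continuousOn_id.sub (h.smooth.continuousOn.comp P.continuous.continuousOn fun _ hy => hy)

lemma proj_fderiv (h : IsTube X P g δ) (hu : u ∈ ball (0 : RSpace k) δ) (v : RSpace k) :
    P (fderiv ℝ g u v) = v := by
  have hcomp := P.hasFDerivAt.comp u (h.hasStrictFDerivAt hu).hasFDerivAt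
  have hid : HasFDerivAt (P ∘ g) (.id ℝ (RSpace k)) u := by
    refine (hasFDerivAt_id u).congr_of_eventuallyEq ?_
    filter_upwards [Metric.isOpen_ball.mem_nhds hu] with w hw using h.proj w hw
  exact DFunLike.congr_fun (hcomp.unique hid) v

lemma isOpen_tubeSet (h : IsTube X P g δ) : IsOpen (tubeSet P g δ) := by
  convert h.continuousOn_sub.isOpen_inter_preimage (Metric.isOpen_ball.preimage P.continuous)
    (Metric.isOpen_ball (x := (0 : RSpace n)) (ε := δ)) using 1
  ext y
  simp [tubeSet]

lemma section_mem_tubeSet (h : IsTube X P g δ) (hu : u ∈ ball (0 : RSpace k) δ) :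
    g u ∈ tubeSet P g δ := by
  refine ⟨?_, ?_⟩ <;> rw [h.proj u hu]
  · exact mem_ball_zero_iff.1 hu
  · rw [sub_self, norm_zero]
    exact h.pos

lemma section_mem (h : IsTube X P g δ) (hu : u ∈ ball (0 : RSpace k) δ) : g u ∈ X := by
  rw [h.mem_iff _ (h.section_mem_tubeSet hu), h.proj u hu]

lemma tubeSet_mem_nhds (h : IsTube X P g δ) (hu : u ∈ ball (0 : RSpace k) δ) :
    tubeSet P g δ ∈ 𝓝 (g u) := h.isOpen_tubeSet.mem_nhds (h.section_mem_tubeSet hu)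

lemma exists_tubeSet_subset (h : IsTube X P g δ) {N : Set (RSpace n)} (hN : N ∈ 𝓝 0) :
    ∃ δ', 0 < δ' ∧ δ' ≤ δ ∧ tubeSet P g δ' ⊆ N := by
  obtain ⟨ε, hε, hεN⟩ := Metric.mem_nhds_iff.1 hN
  obtain ⟨η, hη, hηg⟩ :=
    Metric.continuousAt_iff.1 (h.contDiffAt h.zero_mem_ball).continuousAt (ε / 2) (half_pos hε)
  refine ⟨min δ (min η (ε / 2)), by have := h.pos; positivity, min_le_left _ _, fun y hy => hεN ?_⟩
  have hPy : ‖P y‖ < η := hy.1.trans_le ((min_le_right _ _).trans (min_le_left _ _))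
  have hfibre : ‖y - g (P y)‖ < ε / 2 :=
    hy.2.trans_le ((min_le_right _ _).trans (min_le_right _ _))
  have hgraph := hηg (x := P y) (by rwa [dist_zero_right])
  rw [h.zero, dist_zero_right] at hgraph
  rw [mem_ball_zero_iff]
  calc ‖y‖ = ‖(y - g (P y)) + g (P y)‖ := by rw [sub_add_cancel]
    _ ≤ ‖y - g (P y)‖ + ‖g (P y)‖ := norm_add_le _ _
    _ < ε := by linarith

lemma tendsto_proj (h : IsTube X P g δ) (hu : u ∈ ball (0 : RSpace k) δ) :
    Tendsto P (𝓝 (g u)) (𝓝 u) := by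
  simpa only [h.proj u hu] using P.continuous.tendsto (g u)

lemma tangentVectors_eq (h : IsTube X P g δ) (hu : u ∈ ball (0 : RSpace k) δ) :
    tangentVectors X (g u) = range (fderiv ℝ g u) := by
  have hg := (h.hasStrictFDerivAt hu).hasFDerivAt
  apply Subset.antisymm
  · rintro w ⟨γ, hγ0, hγ, hd⟩
    refine ⟨P w, ?_⟩
    have hγc : Tendsto γ (𝓝 0) (𝓝 (g u)) := hγ0 ▸ hd.continuousAt.tendsto
    have hPγ : HasDerivAt (fun t => P (γ t)) (P w) 0 := P.hasFDerivAt.comp_hasDerivAt 0 hd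
    have hgPγ : HasDerivAt (fun t => g (P (γ t))) (fderiv ℝ g u (P w)) 0 :=
      HasFDerivAt.comp_hasDerivAt 0 (by rwa [hγ0, h.proj u hu]) hPγ
    refine hgPγ.unique (hd.congr_of_eventuallyEq ?_)
    filter_upwards [hγ, hγc.eventually (h.tubeSet_mem_nhds hu)] with t htX ht
    exact ((h.mem_iff _ ht).1 htX).symm
  · rintro w ⟨v, rfl⟩
    have hl : HasDerivAt (fun t : ℝ => u + t • v) v 0 := by
      simpa using ((hasDerivAt_id (0 : ℝ)).smul_const v).const_add u
    have h0 : u + (0 : ℝ) • v = u := by simp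
    refine ⟨fun t => g (u + t • v), by simp, ?_, ?_⟩
    · have hlim : Tendsto (fun t : ℝ => u + t • v) (𝓝 0) (𝓝 u) := by
        simpa only [ContinuousAt, h0] using hl.continuousAt
      filter_upwards [hlim.eventually (Metric.isOpen_ball.mem_nhds hu)] with t ht
      exact h.section_mem ht
    · exact HasFDerivAt.comp_hasDerivAt 0 (by rwa [h0]) hl

end IsTube

lemma exists_isTube (hX : IsSubmanifold 1 k X) (h0 : (0 : RSpace n) ∈ X) :
    ∃ (P : RSpace n →L[ℝ] RSpace k) (g : RSpace k → RSpace n) (δ : ℝ), IsTube X P g δ := by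
  obtain ⟨Φ, hΦ⟩ := hX.2 0 h0
  obtain ⟨T, hT, hTk⟩ := hΦ.exists_submodule_coe_eq_tangentVectors h0 hX.1
  let e : T ≃L[ℝ] RSpace k := .ofFinrankEq (by rw [hTk, finrank_euclideanSpace_fin])
  let P : RSpace n →L[ℝ] RSpace k := (e : T →L[ℝ] RSpace k) ∘L T.orthogonalProjectionOnto
  have hinj : ∀ v ∈ tangentVectors X 0, fderiv ℝ P 0 v = 0 → v = 0 := by
    intro v hv hPv
    rw [← hT] at hv
    have hv0 : T.orthogonalProjectionOnto v = 0 := e.map_eq_zero_iff.1 (by rwa [P.fderiv] at hPv)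
    rw [← T.starProjection_eq_self_iff.2 hv, T.starProjection_apply, hv0, T.coe_zero]
  obtain ⟨O, O', g, hO, h0O, hO', hg, hPO, hgO, hinv⟩ :=
    hΦ.exists_local_param h0 hX.1 finrank_euclideanSpace_fin P.contDiff.contDiffAt hinj
  have h00 : (0 : RSpace n) ∈ X ∩ O := ⟨h0, h0O⟩
  obtain ⟨δ₁, hδ₁, hδO⟩ := Metric.isOpen_iff.1 hO' 0 (by simpa using hPO h00)
  have htube : IsTube (X ∩ O) P g δ₁ := by
    refine ⟨hδ₁, by simpa using hinv.1 h00, hg.mono hδO, fun u hu => hinv.2 (hδO hu),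
      fun y hy => ⟨fun hyX => (hinv.1 hyX).symm, fun hyg => ?_⟩⟩
    rw [hyg]
    exact hgO (hδO (proj_mem_ball_of_mem_tubeSet hy))
  obtain ⟨δ, hδ, hδ', hδs⟩ := htube.exists_tubeSet_subset (hO.mem_nhds h0O)
  exact ⟨P, g, δ, (htube.mono hδ hδ').congr fun y hy => (and_iff_left (hδs hy)).symm⟩

lemma nearestPoint_spec_of_isCompact {p y : RSpace n} {R : ℝ}
    (hX : IsCompact (X ∩ closedBall p R)) (hp : p ∈ X) (hy : dist y p < R / 2) :
    nearestPoint X y ∈ X ∧ dist y (nearestPoint X y) = Metric.infDist y X := by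
  have hpR : p ∈ X ∩ closedBall p R :=
    ⟨hp, Metric.mem_closedBall_self (by linarith [dist_nonneg (x := y) (y := p)])⟩
  obtain ⟨x₀, hx₀, hx₀d⟩ := hX.exists_infDist_eq_dist ⟨p, hpR⟩ y
  apply Classical.epsilon_spec (p := fun x => x ∈ X ∧ dist y x = Metric.infDist y X)
  refine ⟨x₀, hx₀.1, le_antisymm ?_ (Metric.infDist_le_dist_of_mem hx₀.1)⟩
  rw [Metric.le_infDist ⟨p, hp⟩]
  intro x hx
  rw [← hx₀d]
  by_cases hxR : x ∈ closedBall p R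
  · exact Metric.infDist_le_dist_of_mem ⟨hx, hxR⟩
  · rw [Metric.mem_closedBall, not_le] at hxR
    have hyp := Metric.infDist_le_dist_of_mem (x := y) hpR
    have htri := dist_triangle_left x p y
    linarith

lemma sub_mem_normalVectors {x y : RSpace n} (hd : dist y x = Metric.infDist y X) :
    y - x ∈ normalVectors X x := by
  rintro z ⟨γ, rfl, hγ, hγd⟩
  have hmin : IsLocalMin (fun t => ‖y - γ t‖ ^ 2) 0 := by
    filter_upwards [hγ] with t ht
    have hle := Metric.infDist_le_dist_of_mem (x := y) ht
    rw [← hd, dist_eq_norm, dist_eq_norm] at hle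
    gcongr
  have hcrit := hmin.hasDerivAt_eq_zero (hγd.const_sub y).norm_sq
  rw [inner_neg_right, real_inner_comm] at hcrit
  linarith

namespace IsTube

lemma isCompact_inter_closedBall (h : IsTube X P g δ) {p : RSpace n} {R : ℝ}
    (hR : closedBall p R ⊆ tubeSet P g δ) : IsCompact (X ∩ closedBall p R) := by
  have hsub : ContinuousOn (fun y => y - g (P y)) (closedBall p R) :=
    h.continuousOn_sub.mono fun y hy => proj_mem_ball_of_mem_tubeSet (hR hy)
  have heq : X ∩ closedBall p R = closedBall p R ∩ (fun y => y - g (P y)) ⁻¹' {0} := by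
    ext y
    rw [inter_comm, mem_inter_iff, mem_inter_iff]
    exact and_congr_right fun hy => (h.mem_iff y (hR hy)).trans sub_eq_zero.symm
  rw [heq]
  exact (isCompact_closedBall p R).of_isClosed_subset
    (hsub.preimage_isClosed_of_isClosed Metric.isClosed_closedBall isClosed_singleton)
    inter_subset_left

lemma eventually_nearestPoint (h : IsTube X P g δ) (hu : u ∈ ball (0 : RSpace k) δ) :
    ∀ᶠ y in 𝓝 (g u), nearestPoint X y ∈ X ∧ dist y (nearestPoint X y) = Metric.infDist y X := by
  obtain ⟨R, hR, hRt⟩ := Metric.nhds_basis_closedBall.mem_iff.1 (h.tubeSet_mem_nhds hu)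
  filter_upwards [Metric.ball_mem_nhds (g u) (half_pos hR)] with y hy
  exact nearestPoint_spec_of_isCompact (h.isCompact_inter_closedBall hRt) (h.section_mem hu) hy

lemma tendsto_nearestPoint (h : IsTube X P g δ) (hu : u ∈ ball (0 : RSpace k) δ) :
    Tendsto (nearestPoint X) (𝓝 (g u)) (𝓝 (g u)) := by
  rw [tendsto_iff_dist_tendsto_zero]
  have hlim : Tendsto (fun y => 2 * dist y (g u)) (𝓝 (g u)) (𝓝 0) := by
    simpa using (tendsto_iff_dist_tendsto_zero.1 (tendsto_id (x := 𝓝 (g u)))).const_mul 2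
  refine squeeze_zero' (Eventually.of_forall fun _ => dist_nonneg) ?_ hlim
  filter_upwards [h.eventually_nearestPoint hu] with y hy
  have hle := Metric.infDist_le_dist_of_mem (x := y) (h.section_mem hu)
  have htri := dist_triangle_left (nearestPoint X y) (g u) y
  linarith [hy.2]

lemma tendsto_proj_nearestPoint (h : IsTube X P g δ) (hu : u ∈ ball (0 : RSpace k) δ) :
    Tendsto (fun y => P (nearestPoint X y)) (𝓝 (g u)) (𝓝 u) :=
  (h.tendsto_proj hu).comp (h.tendsto_nearestPoint hu)

lemma eventually_nearestPoint_eq (h : IsTube X P g δ) (hu : u ∈ ball (0 : RSpace k) δ) :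
    ∀ᶠ y in 𝓝 (g u), nearestPoint X y = g (P (nearestPoint X y)) := by
  filter_upwards [h.eventually_nearestPoint hu,
    (h.tendsto_nearestPoint hu).eventually (h.tubeSet_mem_nhds hu)] with y hy hyt
  exact (h.mem_iff _ hyt).1 hy.1

lemma eventually_norm_sub_nearestPoint_le (h : IsTube X P g δ) (hu : u ∈ ball (0 : RSpace k) δ) :
    ∀ᶠ y in 𝓝 (g u), ‖y - nearestPoint X y‖ ≤ ‖y - g (P y)‖ := by
  filter_upwards [h.eventually_nearestPoint hu,
    (h.tendsto_proj hu).eventually (Metric.isOpen_ball.mem_nhds hu)] with y hy hPy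
  rw [← dist_eq_norm, ← dist_eq_norm, hy.2]
  exact Metric.infDist_le_dist_of_mem (h.section_mem hPy)

lemma isBigO_sub_nearestPoint (h : IsTube X P g δ) (hu : u ∈ ball (0 : RSpace k) δ) :
    (fun y => y - nearestPoint X y) =O[𝓝 (g u)] fun y => y - g (P y) :=
  .of_bound' (h.eventually_norm_sub_nearestPoint_le hu)

lemma isBigO_proj_sub (h : IsTube X P g δ) (hu : u ∈ ball (0 : RSpace k) δ) :
    (fun y => P y - P (nearestPoint X y)) =O[𝓝 (g u)] fun y => y - g (P y) := by
  have hsecant : (fun y => g (P y) - nearestPoint X y) =O[𝓝 (g u)] fun y => y - g (P y) :=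
    ((h.isBigO_sub_nearestPoint hu).sub (isBigO_refl _ _)).congr_left fun y => by abel
  refine ((P.isBigO_comp _ _).trans hsecant).congr' ?_ .rfl
  filter_upwards [(h.tendsto_proj hu).eventually (Metric.isOpen_ball.mem_nhds hu)] with y hy
  rw [map_sub, h.proj _ hy]

lemma isLittleO_secant (h : IsTube X P g δ) (hu : u ∈ ball (0 : RSpace k) δ) :
    (fun y => g (P y) - nearestPoint X y - fderiv ℝ g u (P y - P (nearestPoint X y)))
      =o[𝓝 (g u)] fun y => y - g (P y) := by
  have hlim : Tendsto (fun y => (P y, P (nearestPoint X y))) (𝓝 (g u)) (𝓝 (u, u)) :=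
    (h.tendsto_proj hu).prodMk_nhds (h.tendsto_proj_nearestPoint hu)
  have ho := ((h.hasStrictFDerivAt hu).isLittleO.comp_tendsto hlim).trans_isBigO
    (h.isBigO_proj_sub hu)
  refine ho.congr' ?_ .rfl
  filter_upwards [h.eventually_nearestPoint_eq hu] with y hy
  simp only [Function.comp_apply, ← hy]

end IsTube

end Tube

section UnitVector

variable {n : ℕ} {w : RSpace n}

lemma norm_unitVector (hw : w ≠ 0) : ‖unitVector w‖ = 1 := norm_smul_inv_norm hw

lemma norm_unitVector_le (w : RSpace n) : ‖unitVector w‖ ≤ 1 := by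
  rcases eq_or_ne w 0 with rfl | hw
  · simp [unitVector]
  · exact (norm_unitVector hw).le

lemma norm_smul_unitVector (w : RSpace n) : ‖w‖ • unitVector w = w := by
  rcases eq_or_ne w 0 with rfl | hw
  · simp
  · rw [unitVector, smul_inv_smul₀ (norm_ne_zero_iff.2 hw)]

lemma unitVector_smul {c : ℝ} (hc : 0 < c) (w : RSpace n) : unitVector (c • w) = unitVector w := by
  rw [unitVector, unitVector, norm_smul, Real.norm_of_nonneg hc.le, smul_smul, mul_inv,
    mul_right_comm, inv_mul_cancel₀ hc.ne', one_mul]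

lemma unitVector_neg (w : RSpace n) : unitVector (-w) = -unitVector w := by
  simp [unitVector]

lemma continuousAt_unitVector (hw : w ≠ 0) : ContinuousAt unitVector w :=
  (continuousAt_id.norm.inv₀ (norm_ne_zero_iff.2 hw)).smul continuousAt_id

lemma inner_unitVector_le_one (a b : RSpace n) : inner ℝ (unitVector a) (unitVector b) ≤ 1 :=
  (real_inner_le_norm _ _).trans
    (mul_le_one₀ (norm_unitVector_le a) (norm_nonneg _) (norm_unitVector_le b))

lemma inner_eq_norm_mul_inner_unitVector (a b : RSpace n) :
    inner ℝ a b = ‖a‖ * ‖b‖ * inner ℝ (unitVector a) (unitVector b) := by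
  conv_lhs => rw [← norm_smul_unitVector a, ← norm_smul_unitVector b]
  rw [inner_smul_left, inner_smul_right, conj_trivial, mul_assoc]

end UnitVector

section NormalProj

variable {n : ℕ} {M X Y : Set (RSpace n)} {p y v b : RSpace n} {c : ℝ}

/-- The orthogonal projection to the normal space of `M` at `p`. -/
noncomputable def normalProj (M : Set (RSpace n)) (p : RSpace n) : RSpace n →L[ℝ] RSpace n :=
  (Submodule.span ℝ (tangentVectors M p))ᗮ.starProjection

lemma mem_orthogonal_span_tangentVectors {a : RSpace n} :
    a ∈ (Submodule.span ℝ (tangentVectors M p))ᗮ ↔ a ∈ normalVectors M p := by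
  rw [Submodule.mem_orthogonal]
  refine ⟨fun ha z hz => ha z (Submodule.subset_span hz), fun ha z hz => ?_⟩
  induction hz using Submodule.span_induction with
  | mem z hz => exact ha z hz
  | zero => exact inner_zero_left a
  | add z w _ _ hz hw => rw [inner_add_left, hz, hw, add_zero]
  | smul t z _ hz => rw [inner_smul_left, hz, mul_zero]

lemma normalProj_mem (M : Set (RSpace n)) (p v : RSpace n) : normalProj M p v ∈ normalVectors M p :=
  mem_orthogonal_span_tangentVectors.1 (Submodule.starProjection_apply_mem _ _)

lemma normalProj_eq_zero_iff :
    normalProj M p v = 0 ↔ v ∈ Submodule.span ℝ (tangentVectors M p) := by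
  rw [normalProj, Submodule.starProjection_apply_eq_zero_iff, Submodule.orthogonal_orthogonal]

lemma normalProj_eq_zero (hv : v ∈ tangentVectors M p) : normalProj M p v = 0 :=
  normalProj_eq_zero_iff.2 (Submodule.subset_span hv)

lemma norm_normalProj_le (M : Set (RSpace n)) (p v : RSpace n) : ‖normalProj M p v‖ ≤ ‖v‖ :=
  Submodule.norm_starProjection_apply_le _ _

lemma inner_normalProj_self (M : Set (RSpace n)) (p v : RSpace n) :
    inner ℝ (normalProj M p v) v = ‖normalProj M p v‖ ^ 2 :=
  (Submodule.span ℝ (tangentVectors M p))ᗮ.re_inner_starProjection_eq_normSq v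

lemma inner_normalProj_of_mem {a : RSpace n} (ha : a ∈ normalVectors M p) (v : RSpace n) :
    inner ℝ a (normalProj M p v) = inner ℝ a v := by
  rw [normalProj, ← Submodule.inner_starProjection_left_eq_right,
    Submodule.starProjection_eq_self_iff.2 (mem_orthogonal_span_tangentVectors.2 ha)]

lemma norm_normalProj_eq (M : Set (RSpace n)) (p v : RSpace n) :
    ‖normalProj M p v‖ = inner ℝ (unitVector (normalProj M p v)) (unitVector v) * ‖v‖ := by
  rcases eq_or_ne (normalProj M p v) 0 with h0 | h0
  · simp [h0, unitVector]
  · refine mul_left_cancel₀ (norm_ne_zero_iff.2 h0) ?_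
    rw [← sq, ← inner_normalProj_self, inner_eq_norm_mul_inner_unitVector]
    ring

lemma inner_unitVector_le_norm_normalProj {a : RSpace n} (ha : a ∈ normalVectors M p)
    (v : RSpace n) : inner ℝ (unitVector a) v ≤ ‖normalProj M p v‖ := by
  rw [unitVector, inner_smul_left, ← inner_normalProj_of_mem ha, ← inner_smul_left]
  calc _ ≤ ‖unitVector a‖ * ‖normalProj M p v‖ := real_inner_le_norm _ _
    _ ≤ 1 * ‖normalProj M p v‖ := by gcongr; exact norm_unitVector_le a
    _ = _ := one_mul _

lemma neg_mem_normalVectors {a : RSpace n} (ha : a ∈ normalVectors M p) :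
    -a ∈ normalVectors M p := fun z hz => by rw [inner_neg_right, ha z hz, neg_zero]

end NormalProj

section Whitney

variable {n : ℕ} {X Y : Set (RSpace n)} {y b : RSpace n} {c : ℝ}

lemma le_whitneyAlpha {a : RSpace n} (ha : a ∈ normalVectors Y y)
    (hb : b ∈ tangentVectors X (nearestPoint X y)) (ha0 : a ≠ 0) (hb0 : b ≠ 0) :
    inner ℝ (unitVector a) (unitVector b) ≤ whitneyAlpha X Y y := by
  refine le_csSup ⟨1, ?_⟩ ⟨a, ha, b, hb, ha0, hb0, rfl⟩
  rintro _ ⟨a, -, b, -, -, -, rfl⟩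
  exact inner_unitVector_le_one a b

lemma le_whitneyBeta {a : RSpace n} (ha : a ∈ normalVectors Y y) (ha0 : a ≠ 0) :
    inner ℝ (unitVector a) (unitVector (nearestPoint X y - y)) ≤ whitneyBeta X Y y := by
  refine le_csSup ⟨1, ?_⟩ ⟨a, ha, ha0, rfl⟩
  rintro _ ⟨a, -, -, rfl⟩
  exact inner_unitVector_le_one a _

lemma whitneyAlpha_nonneg (X Y : Set (RSpace n)) (y : RSpace n) : 0 ≤ whitneyAlpha X Y y := by
  by_cases hex : ∃ a ∈ normalVectors Y y, ∃ b ∈ tangentVectors X (nearestPoint X y),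
      a ≠ 0 ∧ b ≠ 0
  · obtain ⟨a, ha, b, hb, ha0, hb0⟩ := hex
    have hpos := le_whitneyAlpha ha hb ha0 hb0
    have hneg := le_whitneyAlpha (neg_mem_normalVectors ha) hb (neg_ne_zero.2 ha0) hb0
    rw [unitVector_neg, inner_neg_left] at hneg
    linarith
  · refine Real.sSup_nonneg ?_
    rintro _ ⟨a, ha, b, hb, ha0, hb0, -⟩
    exact absurd ⟨a, ha, b, hb, ha0, hb0⟩ hex

lemma whitneyBeta_nonneg (X Y : Set (RSpace n)) (y : RSpace n) : 0 ≤ whitneyBeta X Y y := by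
  by_cases hex : ∃ a ∈ normalVectors Y y, a ≠ 0
  · obtain ⟨a, ha, ha0⟩ := hex
    have hpos := le_whitneyBeta (X := X) ha ha0
    have hneg := le_whitneyBeta (X := X) (neg_mem_normalVectors ha) (neg_ne_zero.2 ha0)
    rw [unitVector_neg, inner_neg_left] at hneg
    linarith
  · refine Real.sSup_nonneg ?_
    rintro _ ⟨a, ha, ha0, -⟩
    exact absurd ⟨a, ha, ha0⟩ hex

lemma norm_normalProj_le_whitneyAlpha (hb : b ∈ tangentVectors X (nearestPoint X y)) :
    ‖normalProj Y y b‖ ≤ whitneyAlpha X Y y * ‖b‖ := by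
  rcases eq_or_ne (normalProj Y y b) 0 with h0 | h0
  · rw [h0, norm_zero]
    exact mul_nonneg (whitneyAlpha_nonneg X Y y) (norm_nonneg b)
  · have hb0 : b ≠ 0 := fun hb0 => h0 (by rw [hb0, map_zero])
    rw [norm_normalProj_eq]
    gcongr
    exact le_whitneyAlpha (normalProj_mem Y y b) hb h0 hb0

lemma norm_normalProj_le_whitneyBeta (X Y : Set (RSpace n)) (y : RSpace n) :
    ‖normalProj Y y (nearestPoint X y - y)‖ ≤ whitneyBeta X Y y * ‖nearestPoint X y - y‖ := by
  rcases eq_or_ne (normalProj Y y (nearestPoint X y - y)) 0 with h0 | h0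
  · rw [h0, norm_zero]
    exact mul_nonneg (whitneyBeta_nonneg X Y y) (norm_nonneg _)
  · rw [norm_normalProj_eq]
    gcongr
    exact le_whitneyBeta (normalProj_mem Y y _) h0

lemma norm_normalProj_unitVector_le {M : Set (RSpace n)} {p v : RSpace n} (hc : 0 ≤ c)
    (h : ‖normalProj M p v‖ ≤ c * ‖v‖) : ‖normalProj M p (unitVector v)‖ ≤ c := by
  rw [unitVector, map_smul, norm_smul, norm_inv, norm_norm]
  exact inv_mul_le_of_le_mul₀ (norm_nonneg v) hc (by rwa [mul_comm])

lemma whitneyAlpha_le (hc : 0 ≤ c)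
    (h : ∀ b ∈ tangentVectors X (nearestPoint X y), ‖normalProj Y y b‖ ≤ c * ‖b‖) :
    whitneyAlpha X Y y ≤ c := by
  refine Real.sSup_le ?_ hc
  rintro _ ⟨a, ha, b, hb, -, -, rfl⟩
  exact (inner_unitVector_le_norm_normalProj ha _).trans
    (norm_normalProj_unitVector_le hc (h b hb))

lemma whitneyBeta_le (hc : 0 ≤ c)
    (h : ‖normalProj Y y (nearestPoint X y - y)‖ ≤ c * ‖nearestPoint X y - y‖) :
    whitneyBeta X Y y ≤ c := by
  refine Real.sSup_le ?_ hc
  rintro _ ⟨a, ha, -, rfl⟩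
  exact (inner_unitVector_le_norm_normalProj ha _).trans (norm_normalProj_unitVector_le hc h)

end Whitney

section NearestPoint

lemma isLittleO_of_norm_le_mul {α E F : Type*} [SeminormedAddCommGroup E]
    [SeminormedAddCommGroup F] {l : Filter α} {f : α → E} {w : α → F} {φ : α → ℝ}
    (hφ : Tendsto φ l (𝓝 0)) (h : ∀ᶠ y in l, ‖f y‖ ≤ φ y * ‖w y‖) : f =o[l] w := by
  refine .of_bound fun c hc => ?_
  filter_upwards [h, hφ.eventually_lt_const hc] with y hy hφc
  exact hy.trans (by gcongr)

variable {n k : ℕ} {X S : Set (RSpace n)} {P : RSpace n →L[ℝ] RSpace k} {g : RSpace k → RSpace n}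
  {δ : ℝ} {u : RSpace k}

namespace IsTube

lemma fderiv_mem_tangentVectors (h : IsTube X P g δ) (hu : u ∈ ball (0 : RSpace k) δ)
    (v : RSpace k) : fderiv ℝ g u v ∈ tangentVectors X (g u) := by
  rw [h.tangentVectors_eq hu]
  exact mem_range_self v

lemma span_tangentVectors (h : IsTube X P g δ) (hu : u ∈ ball (0 : RSpace k) δ) :
    Submodule.span ℝ (tangentVectors X (g u)) = LinearMap.range (fderiv ℝ g u).toLinearMap := by
  rw [h.tangentVectors_eq hu, ← Submodule.span_eq (LinearMap.range _)]
  rfl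

lemma fderiv_proj_of_mem_span (h : IsTube X P g δ) (hu : u ∈ ball (0 : RSpace k) δ)
    {t : RSpace n} (ht : t ∈ Submodule.span ℝ (tangentVectors X (g u))) :
    fderiv ℝ g u (P t) = t := by
  rw [h.span_tangentVectors hu] at ht
  obtain ⟨v, rfl⟩ := ht
  exact congrArg (fderiv ℝ g u) (h.proj_fderiv hu v)

lemma eq_zero_of_normalProj (h : IsTube X P g δ) (hu : u ∈ ball (0 : RSpace k) δ) {w : RSpace n}
    (hw : P w = 0) (h0 : normalProj X (g u) w = 0) : w = 0 := by
  rw [← h.fderiv_proj_of_mem_span hu (normalProj_eq_zero_iff.1 h0), hw, map_zero]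

lemma unitVector_normalProj_injective (h : IsTube X P g δ) (hu : u ∈ ball (0 : RSpace k) δ)
    {w w' : RSpace n} (hw : P w = 0) (hw' : P w' = 0) (hw1 : ‖w‖ = 1) (hw'1 : ‖w'‖ = 1)
    (heq : unitVector (normalProj X (g u) w) = unitVector (normalProj X (g u) w')) : w = w' := by
  have hne : ∀ z : RSpace n, P z = 0 → ‖z‖ = 1 → normalProj X (g u) z ≠ 0 := fun z hz hz1 h0 =>
    norm_ne_zero_iff.1 (hz1 ▸ one_ne_zero) (h.eq_zero_of_normalProj hu hz h0)
  have hray : SameRay ℝ (normalProj X (g u) w) (normalProj X (g u) w') :=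
    sameRay_iff_inv_norm_smul_eq.2 (.inr (.inr heq))
  obtain ⟨r, r', hr, hr', hrr⟩ := hray.exists_pos (hne w hw hw1) (hne w' hw' hw'1)
  have hsmul : r • w = r' • w' := by
    refine sub_eq_zero.1 (h.eq_zero_of_normalProj hu (by simp [hw, hw']) ?_)
    rw [map_sub, map_smul, map_smul, hrr, sub_self]
  exact SameRay.eq_of_norm_eq (.inr (.inr ⟨r, r', hr, hr', hsmul⟩)) (hw1.trans hw'1.symm)

lemma eventually_norm_sub_normalProj_le (h : IsTube X P g δ) (hu : u ∈ ball (0 : RSpace k) δ) :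
    ∀ᶠ y in 𝓝 (g u), ‖(y - nearestPoint X y) - normalProj X (g u) (y - nearestPoint X y)‖ ≤
      ‖fderiv ℝ g u - fderiv ℝ g (P (nearestPoint X y))‖ * ‖P‖ * ‖y - nearestPoint X y‖ := by
  filter_upwards [h.eventually_nearestPoint hu, h.eventually_nearestPoint_eq hu,
    (h.tendsto_proj_nearestPoint hu).eventually (Metric.isOpen_ball.mem_nhds hu)]
    with y hnear hgraph hball
  set d := y - nearestPoint X y
  set t := d - normalProj X (g u) d with htdef
  have hQt : normalProj X (g u) t = 0 := by
    rw [map_sub, sub_eq_zero]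
    exact (Submodule.starProjection_eq_self_iff.2 (Submodule.starProjection_apply_mem _ _)).symm
  have ht : t ∈ Submodule.span ℝ (tangentVectors X (g u)) := normalProj_eq_zero_iff.1 hQt
  have htd : inner ℝ t d = ‖t‖ ^ 2 := by
    have hperp : inner ℝ t (normalProj X (g u) d) = 0 :=
      (mem_orthogonal_span_tangentVectors.2 (normalProj_mem X (g u) d)) t ht
    rw [← add_zero (‖t‖ ^ 2), ← hperp, ← real_inner_self_eq_norm_sq, ← inner_add_right, htdef,
      sub_add_cancel]
  have hd : inner ℝ (fderiv ℝ g (P (nearestPoint X y)) (P t)) d = 0 := by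
    refine sub_mem_normalVectors hnear.2 _ ?_
    have := h.fderiv_mem_tangentVectors hball (P t)
    rwa [← hgraph] at this
  have hsq : ‖t‖ * ‖t‖ ≤
      ‖fderiv ℝ g u - fderiv ℝ g (P (nearestPoint X y))‖ * ‖P‖ * ‖d‖ * ‖t‖ := by
    calc ‖t‖ * ‖t‖
        = inner ℝ ((fderiv ℝ g u - fderiv ℝ g (P (nearestPoint X y))) (P t)) d := by
          rw [← sq, ← htd, sub_apply, h.fderiv_proj_of_mem_span hu ht,
            inner_sub_left t, hd, sub_zero]
      _ ≤ ‖fderiv ℝ g u - fderiv ℝ g (P (nearestPoint X y))‖ * (‖P‖ * ‖t‖) * ‖d‖ :=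
          (real_inner_le_norm _ _).trans
            (by gcongr; exact ContinuousLinearMap.le_opNorm_of_le _ (P.le_opNorm t))
      _ = _ := by ring
  rcases (norm_nonneg t).eq_or_lt with ht0 | ht0
  · rw [← ht0]; positivity
  · exact le_of_mul_le_mul_right hsq ht0

lemma isLittleO_sub_normalProj (h : IsTube X P g δ) (hu : u ∈ ball (0 : RSpace k) δ) :
    (fun y => (y - nearestPoint X y) - normalProj X (g u) (y - nearestPoint X y))
      =o[𝓝 (g u)] fun y => y - g (P y) := by
  refine (isLittleO_of_norm_le_mul ?_ (h.eventually_norm_sub_normalProj_le hu)).trans_isBigO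
    (h.isBigO_sub_nearestPoint hu)
  have hlim := ((h.continuousAt_fderiv hu).tendsto.comp (h.tendsto_proj_nearestPoint hu)).const_sub
    (fderiv ℝ g u)
  simpa using hlim.norm.mul_const ‖P‖

lemma isLittleO_nearestPoint (h : IsTube X P g δ) (hu : u ∈ ball (0 : RSpace k) δ) :
    (fun y => (y - nearestPoint X y) - normalProj X (g u) (y - g (P y))) =o[𝓝 (g u)]
      fun y => y - g (P y) := by
  have hsecant := ((normalProj X (g u)).isBigO_comp _ (𝓝 (g u))).trans_isLittleO
    (h.isLittleO_secant hu)
  refine ((h.isLittleO_sub_normalProj hu).add hsecant).congr_left fun y => ?_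
  rw [map_sub (normalProj X (g u)) (g (P y) - nearestPoint X y),
    normalProj_eq_zero (h.fderiv_mem_tangentVectors hu _)]
  simp only [map_sub]
  abel

lemma tendsto_nearestPoint_direction (h : IsTube X P g δ) (hu : u ∈ ball (0 : RSpace k) δ)
    {l : Filter (RSpace n)} (hl : l ≤ 𝓝 (g u)) (hne : ∀ᶠ y in l, y - g (P y) ≠ 0) {θ : RSpace n}
    (hθ : normalProj X (g u) θ ≠ 0) (ht : Tendsto (fun y => unitVector (y - g (P y))) l (𝓝 θ)) :
    Tendsto (fun y => unitVector (nearestPoint X y - y)) l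
      (𝓝 (-unitVector (normalProj X (g u) θ))) := by
  have herror : Tendsto (fun y => ‖y - g (P y)‖⁻¹ •
      ((y - nearestPoint X y) - normalProj X (g u) (y - g (P y)))) l (𝓝 0) := by
    rw [tendsto_zero_iff_norm_tendsto_zero]
    refine ((h.isLittleO_nearestPoint hu).mono hl).norm_norm.tendsto_div_nhds_zero.congr fun y => ?_
    rw [norm_smul, norm_inv, norm_norm, div_eq_inv_mul]
  have hscaled : Tendsto (fun y => ‖y - g (P y)‖⁻¹ • (y - nearestPoint X y)) l
      (𝓝 (normalProj X (g u) θ)) := by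
    have hadd := herror.add (((normalProj X (g u)).continuous.tendsto θ).comp ht)
    rw [zero_add] at hadd
    refine hadd.congr fun y => ?_
    rw [Function.comp_apply, unitVector, map_smul, ← smul_add, sub_add_cancel]
  refine ((continuousAt_unitVector hθ).tendsto.comp hscaled).neg.congr' ?_
  filter_upwards [hne] with y hy
  rw [Function.comp_apply, unitVector_smul (by positivity), ← unitVector_neg, neg_sub]

end IsTube

lemma eq_of_mem_normalCone {x q q₀ : RSpace n} (hq : (x, q) ∈ normalCone X S)
    (ht : Tendsto (fun y => unitVector (nearestPoint X y - y)) (𝓝[S \ X] x) (𝓝 q₀)) : q = q₀ := by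
  obtain ⟨l, hl, hlx⟩ := mem_closure_iff_ultrafilter.1 hq.2
  have hfst : Tendsto Prod.fst (l : Filter (RSpace n × RSpace n)) (𝓝[S \ X] x) := by
    refine tendsto_nhdsWithin_iff.2 ⟨(continuous_fst.tendsto (x, q)).mono_left hlx, ?_⟩
    filter_upwards [hl] with z hz
    obtain ⟨y, hy, rfl⟩ := hz
    exact hy
  refine tendsto_nhds_unique ((continuous_snd.tendsto (x, q)).mono_left hlx)
    ((ht.comp hfst).congr' ?_)
  filter_upwards [hl] with z hz
  obtain ⟨y, -, rfl⟩ := hz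
  rfl

lemma mem_normalCone_of_tendsto {x q : RSpace n} (hx : x ∈ X) {l : Filter (RSpace n)} [l.NeBot]
    (hl : l ≤ 𝓝[S \ X] x)
    (ht : Tendsto (fun y => unitVector (nearestPoint X y - y)) l (𝓝 q)) :
    (x, q) ∈ normalCone X S := by
  have hpair : Tendsto (fun y => (y, unitVector (nearestPoint X y - y))) l (𝓝 (x, q)) :=
    (tendsto_id.mono_left (hl.trans nhdsWithin_le_nhds)).prodMk_nhds ht
  refine ⟨hx, mem_closure_of_tendsto hpair ?_⟩
  filter_upwards [hl self_mem_nhdsWithin] with y hy using mem_image_of_mem _ hy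

end NearestPoint

section LinearAlgebra

variable {E H : Type*} [NormedAddCommGroup E] [InnerProductSpace ℝ E] [FiniteDimensional ℝ E]
  [NormedAddCommGroup H] [NormedSpace ℝ H] {S : Submodule ℝ E}
  {L : H →L[ℝ] E} {D : E →L[ℝ] H}

lemma norm_le_two_mul_of_starProjection_eq
    (hQ : ‖D‖ * ‖Sᗮ.starProjection ∘L L‖ ≤ 1 / 2) {v : E} {z : H}
    (hz : ‖z - D v‖ ≤ ‖D‖ * ‖Sᗮ.starProjection ∘L L‖ * ‖z‖) : ‖z‖ ≤ 2 * ‖D v‖ := by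
  have hhalf : ‖D‖ * ‖Sᗮ.starProjection ∘L L‖ * ‖z‖ ≤ 1 / 2 * ‖z‖ := by gcongr
  have htri := norm_le_norm_add_norm_sub' z (D v)
  linarith

variable [FiniteDimensional ℝ H]

lemma exists_starProjection_eq (hS : Module.finrank ℝ S = Module.finrank ℝ H)
    (hDL : ∀ z, D (L z) = z) (hQ : ‖D‖ * ‖Sᗮ.starProjection ∘L L‖ ≤ 1 / 2) {v : E} (hv : v ∈ S) :
    ∃ z, S.starProjection (L z) = v ∧ ‖z - D v‖ ≤ ‖D‖ * ‖Sᗮ.starProjection ∘L L‖ * ‖z‖ := by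
  have hclose : ∀ z, ‖z - D (S.starProjection (L z))‖ ≤
      ‖D‖ * ‖Sᗮ.starProjection ∘L L‖ * ‖z‖ := fun z => by
    have hz : z - D (S.starProjection (L z)) = D ((Sᗮ.starProjection ∘L L) z) := by
      rw [ContinuousLinearMap.comp_apply, Submodule.starProjection_orthogonal_val, map_sub, hDL]
    rw [hz, mul_assoc]
    exact D.le_opNorm_of_le (ContinuousLinearMap.le_opNorm _ z)
  let T : H →ₗ[ℝ] S := (S.orthogonalProjectionOnto ∘L L : H →L[ℝ] S)
  have hinj : Function.Injective T := by
    rw [injective_iff_map_eq_zero]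
    intro z hz
    have hz0 : S.starProjection (L z) = 0 := congrArg Subtype.val hz
    have hle := hclose z
    rw [hz0, map_zero, sub_zero] at hle
    have : ‖D‖ * ‖Sᗮ.starProjection ∘L L‖ * ‖z‖ ≤ 1 / 2 * ‖z‖ := by gcongr
    exact norm_le_zero_iff.1 (by linarith)
  obtain ⟨z, hz⟩ :=
    (LinearMap.injective_iff_surjective_of_finrank_eq_finrank hS.symm).1 hinj ⟨v, hv⟩
  have hzv : S.starProjection (L z) = v := congrArg Subtype.val hz
  exact ⟨z, hzv, hzv ▸ hclose z⟩

lemma eq_zero_of_almost_inverse (hS : Module.finrank ℝ S = Module.finrank ℝ H)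
    (hDL : ∀ z, D (L z) = z) (hQ : ‖D‖ * ‖Sᗮ.starProjection ∘L L‖ ≤ 1 / 2) {v : E} (hv : v ∈ S)
    (h0 : D v = 0) : v = 0 := by
  obtain ⟨z, hzv, hz⟩ := exists_starProjection_eq hS hDL hQ hv
  have hz0 := norm_le_two_mul_of_starProjection_eq hQ hz
  rw [h0, norm_zero, mul_zero] at hz0
  rw [← hzv, norm_le_zero_iff.1 hz0, map_zero, map_zero]

lemma norm_section_sub_le (hS : Module.finrank ℝ S = Module.finrank ℝ H)
    (hDL : ∀ z, D (L z) = z) (hQ : ‖D‖ * ‖Sᗮ.starProjection ∘L L‖ ≤ 1 / 2) {R : H →L[ℝ] E}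
    (hR : ∀ z, R z ∈ S) (hDR : ∀ z, D (R z) = z) :
    ‖R - L‖ ≤ 2 * ‖Sᗮ.starProjection ∘L L‖ * (1 + ‖L‖ * ‖D‖) := by
  set q := ‖Sᗮ.starProjection ∘L L‖
  refine ContinuousLinearMap.opNorm_le_bound _ (by positivity) fun w => ?_
  obtain ⟨z, hzv, hz⟩ := exists_starProjection_eq hS hDL hQ (hR w)
  have hz2 := norm_le_two_mul_of_starProjection_eq hQ hz
  rw [hDR] at hz hz2
  have hdiff : (R - L) w = L (z - w) - (Sᗮ.starProjection ∘L L) z := by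
    rw [sub_apply, ← hzv, ContinuousLinearMap.comp_apply,
      Submodule.starProjection_orthogonal_val, map_sub]
    abel
  calc ‖(R - L) w‖ ≤ ‖L (z - w)‖ + ‖(Sᗮ.starProjection ∘L L) z‖ := hdiff ▸ norm_sub_le _ _
    _ ≤ ‖L‖ * (‖D‖ * q * ‖z‖) + q * ‖z‖ :=
        add_le_add (L.le_opNorm_of_le hz) (ContinuousLinearMap.le_opNorm _ z)
    _ = ‖z‖ * (q * (1 + ‖L‖ * ‖D‖)) := by ring
    _ ≤ (2 * ‖w‖) * (q * (1 + ‖L‖ * ‖D‖)) := by gcongr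
    _ = _ := by ring

end LinearAlgebra

section Collar

variable {n k : ℕ} {X Y : Set (RSpace n)} {P : RSpace n →L[ℝ] RSpace k} {g : RSpace k → RSpace n}
  {δ : ℝ} {u : RSpace k} {y : RSpace n}

/-- The coordinates of `y` relative to the graph of `g`: the projection of `y`, and the distance to
the point of the graph above it. -/
noncomputable def collarMap (P : RSpace n →L[ℝ] RSpace k) (g : RSpace k → RSpace n)
    (y : RSpace n) : RSpace k × ℝ := (P y, ‖y - g (P y)‖)

/-- The direction from the graph of `g` to `y` in the fibre of `P`. -/
noncomputable def collarDir (P : RSpace n →L[ℝ] RSpace k) (g : RSpace k → RSpace n)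
    (y : RSpace n) : RSpace n := unitVector (y - g (P y))

/-- The linear map `(v, t) ↦ Dg v + t θ`. -/
noncomputable def frameMap (g : RSpace k → RSpace n) (u : RSpace k) (θ : RSpace n) :
    RSpace k × ℝ →L[ℝ] RSpace n :=
  (fderiv ℝ g u).coprod (ContinuousLinearMap.toSpanSingleton ℝ θ)

lemma frameMap_apply (g : RSpace k → RSpace n) (u : RSpace k) (θ : RSpace n) (z : RSpace k × ℝ) :
    frameMap g u θ z = fderiv ℝ g u z.1 + z.2 • θ := rfl

lemma norm_comp_frameMap_le (A : RSpace n →L[ℝ] RSpace n) (g : RSpace k → RSpace n) (u : RSpace k)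
    (θ : RSpace n) : ‖A ∘L frameMap g u θ‖ ≤ ‖A ∘L fderiv ℝ g u‖ + ‖A θ‖ := by
  refine ContinuousLinearMap.opNorm_le_bound _ (by positivity) fun z => ?_
  rw [ContinuousLinearMap.comp_apply, frameMap_apply, map_add, map_smul, add_mul]
  refine (norm_add_le _ _).trans (add_le_add ?_ ?_)
  · exact (A ∘L fderiv ℝ g u).le_opNorm_of_le (norm_fst_le z)
  · rw [norm_smul, mul_comm]
    gcongr
    exact norm_snd_le z

lemma norm_collarDir_le (P : RSpace n →L[ℝ] RSpace k) (g : RSpace k → RSpace n) (y : RSpace n) :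
    ‖collarDir P g y‖ ≤ 1 := norm_unitVector_le _

lemma norm_frameMap_collarDir_le (P : RSpace n →L[ℝ] RSpace k) (g : RSpace k → RSpace n)
    (u : RSpace k) (y : RSpace n) : ‖frameMap g u (collarDir P g y)‖ ≤ ‖fderiv ℝ g u‖ + 1 := by
  have hle := norm_comp_frameMap_le (.id ℝ (RSpace n)) g u (collarDir P g y)
  rw [ContinuousLinearMap.id_comp, ContinuousLinearMap.id_comp] at hle
  exact hle.trans (by gcongr; exact norm_collarDir_le P g y)

namespace IsTube

lemma sub_ne_zero (h : IsTube X P g δ) (hy : y ∈ tubeSet P g δ) (hyX : y ∉ X) :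
    y - g (P y) ≠ 0 := fun h0 => hyX ((h.mem_iff y hy).2 (_root_.sub_eq_zero.1 h0))

lemma proj_collarDir (h : IsTube X P g δ) (hy : y ∈ tubeSet P g δ) : P (collarDir P g y) = 0 := by
  rw [collarDir, unitVector, map_smul, map_sub, h.proj _ (proj_mem_ball_of_mem_tubeSet hy),
    sub_self, smul_zero]

lemma contDiffAt_sub (h : IsTube X P g δ) (hy : y ∈ tubeSet P g δ) :
    ContDiffAt ℝ 1 (fun y => y - g (P y)) y :=
  contDiffAt_id.sub
    ((h.contDiffAt (proj_mem_ball_of_mem_tubeSet hy)).comp y P.contDiff.contDiffAt)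

lemma contDiffAt_collarMap (h : IsTube X P g δ) (hy : y ∈ tubeSet P g δ) (hyX : y ∉ X) :
    ContDiffAt ℝ 1 (collarMap P g) y :=
  P.contDiff.contDiffAt.prodMk ((h.contDiffAt_sub hy).norm ℝ (h.sub_ne_zero hy hyX))

lemma continuousOn_collarMap (h : IsTube X P g δ) :
    ContinuousOn (collarMap P g) (P ⁻¹' ball 0 δ) :=
  P.continuous.continuousOn.prodMk h.continuousOn_sub.norm

lemma fderiv_collarMap (h : IsTube X P g δ) (hy : y ∈ tubeSet P g δ) (hyX : y ∉ X)
    (v : RSpace n) : fderiv ℝ (collarMap P g) y v =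
      (P v, inner ℝ (collarDir P g y) (v - fderiv ℝ g (P y) (P v))) := by
  have hsub : HasFDerivAt (fun y => y - g (P y)) (.id ℝ (RSpace n) - fderiv ℝ g (P y) ∘L P) y :=
    (hasFDerivAt_id y).sub ((h.hasStrictFDerivAt
      (proj_mem_ball_of_mem_tubeSet hy)).hasFDerivAt.comp y P.hasFDerivAt)
  have hsq : ‖y - g (P y)‖ ^ 2 ≠ 0 := pow_ne_zero 2 (norm_ne_zero_iff.2 (h.sub_ne_zero hy hyX))
  have hnorm := hsub.norm_sq.sqrt hsq
  simp only [Real.sqrt_sq (norm_nonneg _)] at hnorm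
  have hcollar : HasFDerivAt (collarMap P g) _ y := P.hasFDerivAt.prodMk hnorm
  rw [hcollar.fderiv, collarDir, unitVector, inner_smul_left]
  refine Prod.ext rfl ?_
  simp only [inner_sub_right, inner_sub_left]
  simp
  ring

lemma fderiv_collarMap_frameMap (h : IsTube X P g δ) (hy : y ∈ tubeSet P g δ) (hyX : y ∉ X)
    (z : RSpace k × ℝ) :
    fderiv ℝ (collarMap P g) y (frameMap g (P y) (collarDir P g y) z) = z := by
  have hP : P (frameMap g (P y) (collarDir P g y) z) = z.1 := by
    rw [frameMap_apply, map_add, map_smul, h.proj_fderiv (proj_mem_ball_of_mem_tubeSet hy),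
      h.proj_collarDir hy, smul_zero, add_zero]
  have hunit : ‖collarDir P g y‖ = 1 := norm_unitVector (h.sub_ne_zero hy hyX)
  rw [h.fderiv_collarMap hy hyX, hP, frameMap_apply, add_sub_cancel_left, inner_smul_right,
    real_inner_self_eq_norm_sq, hunit, one_pow, mul_one]

lemma norm_fderiv_collarMap_le (h : IsTube X P g δ) (hy : y ∈ tubeSet P g δ) (hyX : y ∉ X) :
    ‖fderiv ℝ (collarMap P g) y‖ ≤ ‖P‖ + (1 + ‖fderiv ℝ g (P y)‖ * ‖P‖) := by
  refine ContinuousLinearMap.opNorm_le_bound _ (by positivity) fun v => ?_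
  rw [h.fderiv_collarMap hy hyX, add_mul]
  refine (max_le_add_of_nonneg (norm_nonneg _) (norm_nonneg _)).trans
    (add_le_add (P.le_opNorm v) ?_)
  calc ‖inner ℝ (collarDir P g y) (v - fderiv ℝ g (P y) (P v))‖
      ≤ 1 * ‖v - fderiv ℝ g (P y) (P v)‖ :=
        (norm_inner_le_norm _ _).trans (by gcongr; exact norm_collarDir_le P g y)
    _ ≤ ‖v‖ + ‖fderiv ℝ g (P y)‖ * (‖P‖ * ‖v‖) := by
        rw [one_mul]
        exact (norm_sub_le _ _).trans
          (by gcongr; exact ContinuousLinearMap.le_opNorm_of_le _ (P.le_opNorm v))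
    _ = _ := by ring

end IsTube

end Collar

section WhitneyFrame

variable {n k : ℕ} {X Y : Set (RSpace n)} {P : RSpace n →L[ℝ] RSpace k} {g : RSpace k → RSpace n}
  {δ : ℝ} {u : RSpace k}

lemma normalProj_eq {M : Set (RSpace n)} {p : RSpace n} {S : Submodule ℝ (RSpace n)}
    (hS : (S : Set (RSpace n)) = tangentVectors M p) : normalProj M p = Sᗮ.starProjection := by
  simp only [normalProj, ← hS, Submodule.span_eq]

lemma norm_normalProj_comp_le (M : Set (RSpace n)) (p : RSpace n) (A : RSpace k →L[ℝ] RSpace n) :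
    ‖normalProj M p ∘L A‖ ≤ ‖A‖ :=
  ContinuousLinearMap.opNorm_le_bound _ (norm_nonneg _) fun v =>
    (norm_normalProj_le M p (A v)).trans (A.le_opNorm v)

namespace IsTube

lemma tendsto_normalProj_comp_fderiv (h : IsTube X P g δ) (hu : u ∈ ball (0 : RSpace k) δ)
    (hα : Tendsto (whitneyAlpha X Y) (𝓝[Y] (g u)) (𝓝 0)) :
    Tendsto (fun y => ‖normalProj Y y ∘L fderiv ℝ g u‖) (𝓝[Y] (g u)) (𝓝 0) := by
  have hπ : Tendsto (fun y => fderiv ℝ g (P (nearestPoint X y))) (𝓝[Y] (g u))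
      (𝓝 (fderiv ℝ g u)) :=
    ((h.continuousAt_fderiv hu).tendsto.comp (h.tendsto_proj_nearestPoint hu)).mono_left
      nhdsWithin_le_nhds
  have hbound : Tendsto (fun y => ‖fderiv ℝ g u - fderiv ℝ g (P (nearestPoint X y))‖ +
      whitneyAlpha X Y y * ‖fderiv ℝ g (P (nearestPoint X y))‖) (𝓝[Y] (g u)) (𝓝 0) := by
    simpa using (hπ.const_sub (fderiv ℝ g u)).norm.add (hα.mul hπ.norm)
  refine squeeze_zero' (.of_forall fun _ => norm_nonneg _) ?_ hbound
  filter_upwards [nhdsWithin_le_nhds (h.eventually_nearestPoint_eq hu), nhdsWithin_le_nhds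
    ((h.tendsto_proj_nearestPoint hu).eventually (Metric.isOpen_ball.mem_nhds hu))] with y hy hball
  have hα0 := whitneyAlpha_nonneg X Y y
  refine ContinuousLinearMap.opNorm_le_bound _ (by positivity) fun v => ?_
  have htangent := h.fderiv_mem_tangentVectors hball v
  rw [← hy] at htangent
  set A := fderiv ℝ g (P (nearestPoint X y))
  calc ‖normalProj Y y (fderiv ℝ g u v)‖
      = ‖normalProj Y y ((fderiv ℝ g u - A) v) + normalProj Y y (A v)‖ := by
        rw [← map_add, sub_apply, sub_add_cancel]
    _ ≤ ‖fderiv ℝ g u - A‖ * ‖v‖ + whitneyAlpha X Y y * (‖A‖ * ‖v‖) := by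
        refine (norm_add_le _ _).trans (add_le_add ?_ ?_)
        · exact (norm_normalProj_le _ _ _).trans (ContinuousLinearMap.le_opNorm _ v)
        · exact (norm_normalProj_le_whitneyAlpha htangent).trans (by gcongr; exact A.le_opNorm v)
    _ = _ := by ring

lemma isLittleO_normalProj_sub (h : IsTube X P g δ) (hu : u ∈ ball (0 : RSpace k) δ)
    (hα : Tendsto (whitneyAlpha X Y) (𝓝[Y] (g u)) (𝓝 0))
    (hβ : Tendsto (whitneyBeta X Y) (𝓝[Y] (g u)) (𝓝 0)) :
    (fun y => normalProj Y y (y - g (P y))) =o[𝓝[Y] (g u)] fun y => y - g (P y) := by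
  have hsecant : (fun y => normalProj Y y (nearestPoint X y - y)) =o[𝓝[Y] (g u)]
      fun y => y - g (P y) :=
    (isLittleO_of_norm_le_mul hβ (.of_forall (norm_normalProj_le_whitneyBeta X Y))).trans_isBigO
      (((h.isBigO_sub_nearestPoint hu).neg_left.congr_left fun y => neg_sub _ _).mono
        nhdsWithin_le_nhds)
  have herror : (fun y => normalProj Y y (g (P y) - nearestPoint X y -
      fderiv ℝ g u (P y - P (nearestPoint X y)))) =o[𝓝[Y] (g u)] fun y => y - g (P y) :=
    (IsBigO.of_bound' (.of_forall fun y => norm_normalProj_le Y y _)).trans_isLittleO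
      ((h.isLittleO_secant hu).mono nhdsWithin_le_nhds)
  have hlinear : (fun y => normalProj Y y (fderiv ℝ g u (P y - P (nearestPoint X y))))
      =o[𝓝[Y] (g u)] fun y => y - g (P y) :=
    (isLittleO_of_norm_le_mul (h.tendsto_normalProj_comp_fderiv hu hα) (.of_forall fun y =>
      (normalProj Y y ∘L fderiv ℝ g u).le_opNorm _)).trans_isBigO
      ((h.isBigO_proj_sub hu).mono nhdsWithin_le_nhds)
  refine ((hsecant.add herror).add hlinear).neg_left.congr_left fun y => ?_
  rw [← map_add, ← map_add, ← map_neg]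
  congr 1
  abel

lemma tendsto_normalProj_collarDir (h : IsTube X P g δ) (hu : u ∈ ball (0 : RSpace k) δ)
    (hα : Tendsto (whitneyAlpha X Y) (𝓝[Y] (g u)) (𝓝 0))
    (hβ : Tendsto (whitneyBeta X Y) (𝓝[Y] (g u)) (𝓝 0)) :
    Tendsto (fun y => normalProj Y y (collarDir P g y)) (𝓝[Y] (g u)) (𝓝 0) := by
  refine (h.isLittleO_normalProj_sub hu hα hβ).norm_right.tendsto_inv_smul_nhds_zero.congr
    fun y => ?_
  rw [collarDir, unitVector, map_smul]

lemma tendsto_normalProj_comp_frameMap (h : IsTube X P g δ) (hu : u ∈ ball (0 : RSpace k) δ)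
    (hα : Tendsto (whitneyAlpha X Y) (𝓝[Y] (g u)) (𝓝 0))
    (hβ : Tendsto (whitneyBeta X Y) (𝓝[Y] (g u)) (𝓝 0)) :
    Tendsto (fun y => ‖normalProj Y y ∘L frameMap g (P y) (collarDir P g y)‖) (𝓝[Y] (g u))
      (𝓝 0) := by
  have hDg : Tendsto (fun y => fderiv ℝ g (P y)) (𝓝[Y] (g u)) (𝓝 (fderiv ℝ g u)) :=
    ((h.continuousAt_fderiv hu).tendsto.comp (h.tendsto_proj hu)).mono_left nhdsWithin_le_nhds
  have hbound : Tendsto (fun y => ‖fderiv ℝ g (P y) - fderiv ℝ g u‖ +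
      ‖normalProj Y y ∘L fderiv ℝ g u‖ + ‖normalProj Y y (collarDir P g y)‖) (𝓝[Y] (g u))
      (𝓝 0) := by
    have hsum := ((hDg.sub_const (fderiv ℝ g u)).norm.add
      (h.tendsto_normalProj_comp_fderiv hu hα)).add (h.tendsto_normalProj_collarDir hu hα hβ).norm
    rwa [sub_self, norm_zero, norm_zero, add_zero, add_zero] at hsum
  refine squeeze_zero (fun _ => norm_nonneg _) (fun y => (norm_comp_frameMap_le ..).trans ?_) hbound
  refine add_le_add_left ?_ _
  calc ‖normalProj Y y ∘L fderiv ℝ g (P y)‖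
      = ‖normalProj Y y ∘L (fderiv ℝ g (P y) - fderiv ℝ g u) + normalProj Y y ∘L fderiv ℝ g u‖ := by
        rw [← ContinuousLinearMap.comp_add, sub_add_cancel]
    _ ≤ _ := (norm_add_le _ _).trans (add_le_add_left (norm_normalProj_comp_le ..) _)

lemma eventually_frame (h : IsTube X P g δ) (hY : IsSubmanifold 1 (k + 1) Y) (hXY : Disjoint X Y)
    (hu : u ∈ ball (0 : RSpace k) δ) (hα : Tendsto (whitneyAlpha X Y) (𝓝[Y] (g u)) (𝓝 0))
    (hβ : Tendsto (whitneyBeta X Y) (𝓝[Y] (g u)) (𝓝 0)) {η : ℝ} (hη : 0 < η) :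
    ∀ᶠ y in 𝓝[Y] (g u),
      (∀ v ∈ tangentVectors Y y, fderiv ℝ (collarMap P g) y v = 0 → v = 0) ∧
      ∀ R : RSpace k × ℝ →L[ℝ] RSpace n, (∀ z, R z ∈ tangentVectors Y y) →
        (∀ z, fderiv ℝ (collarMap P g) y (R z) = z) →
        ‖R - frameMap g (P y) (collarDir P g y)‖ ≤ η := by
  have hDg : Tendsto (fun y => ‖fderiv ℝ g (P y)‖) (𝓝[Y] (g u)) (𝓝 ‖fderiv ℝ g u‖) :=
    ((h.continuousAt_fderiv hu).tendsto.comp (h.tendsto_proj hu)).norm.mono_left nhdsWithin_le_nhds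
  have hq := h.tendsto_normalProj_comp_frameMap hu hα hβ
  have hbD : Tendsto (fun y => ‖P‖ + (1 + ‖fderiv ℝ g (P y)‖ * ‖P‖)) (𝓝[Y] (g u)) _ :=
    ((hDg.mul_const ‖P‖).const_add 1).const_add ‖P‖
  have hsmall := hbD.mul hq
  have hclose := (hq.const_mul 2).mul (((hDg.add_const 1).mul hbD).const_add 1)
  rw [mul_zero] at hsmall
  rw [mul_zero, zero_mul] at hclose
  filter_upwards [hsmall.eventually_le_const one_half_pos, hclose.eventually_le_const hη,
    self_mem_nhdsWithin, nhdsWithin_le_nhds (h.tubeSet_mem_nhds hu)] with y hsmall hclose hyY hyt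
  have hyX : y ∉ X := hXY.notMem_of_mem_right hyY
  obtain ⟨Φ, hΦ⟩ := hY.2 y hyY
  obtain ⟨S, hS, hSd⟩ := hΦ.exists_submodule_coe_eq_tangentVectors hyY hY.1
  have hdim : Module.finrank ℝ S = Module.finrank ℝ (RSpace k × ℝ) := by rw [hSd]; simp
  have hDL := h.fderiv_collarMap_frameMap hyt hyX
  have hD := h.norm_fderiv_collarMap_le hyt hyX
  have hL := norm_frameMap_collarDir_le P g (P y) y
  rw [normalProj_eq hS] at hsmall hclose
  have hQ := (mul_le_mul_of_nonneg_right hD (norm_nonneg _)).trans hsmall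
  rw [← hS]
  refine ⟨fun v hv h0 => eq_zero_of_almost_inverse hdim hDL hQ hv h0, fun R hR hDR =>
    (norm_section_sub_le hdim hDL hQ hR hDR).trans (le_trans ?_ hclose)⟩
  gcongr

end IsTube

end WhitneyFrame

section Covering

variable {E B : Type*} [TopologicalSpace E] [TopologicalSpace B]

lemma isLocalHomeomorph_restrict {f : E → B} {M : Set E} {N : Set B} (hf : ContinuousOn f M)
    (hMN : MapsTo f M N)
    (hinv : ∀ y ∈ M, ∃ O O' s, IsOpen O ∧ y ∈ O ∧ IsOpen O' ∧ ContinuousOn s O' ∧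
      MapsTo f (M ∩ O) O' ∧ MapsTo s O' (M ∩ O) ∧ InvOn s f (M ∩ O) O') :
    IsLocalHomeomorph (hMN.restrict f M N) := by
  classical
  refine IsLocalHomeomorph.mk _ fun y => ?_
  obtain ⟨O, O', s, hO, hyO, hO', hs, hfO, hsO, hsf⟩ := hinv y y.2
  let t : N → M := fun b => if hb : (b : B) ∈ O' then ⟨s b, (hsO hb).1⟩ else y
  have ht : ∀ b : N, (b : B) ∈ O' → (t b : E) = s b := fun b hb => by simp only [t, dif_pos hb]
  have htc : ContinuousOn t (Subtype.val ⁻¹' O') :=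
    Topology.IsInducing.subtypeVal.continuousOn_iff.2 <|
      (hs.comp continuous_subtype_val.continuousOn fun b hb => hb).congr ht
  let e : OpenPartialHomeomorph M N :=
    { toFun := hMN.restrict f M N
      invFun := t
      source := Subtype.val ⁻¹' O
      target := Subtype.val ⁻¹' O'
      map_source' := fun m hm => hfO ⟨m.2, hm⟩
      map_target' := fun b hb => by rw [mem_preimage, ht b hb]; exact (hsO hb).2
      left_inv' := fun m hm => Subtype.ext ((ht _ (hfO ⟨m.2, hm⟩)).trans (hsf.1 ⟨m.2, hm⟩))
      right_inv' := fun b hb => Subtype.ext ((congrArg f (ht b hb)).trans (hsf.2 hb))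
      open_source := hO.preimage continuous_subtype_val
      open_target := hO'.preimage continuous_subtype_val
      continuousOn_toFun := (hf.mapsToRestrict hMN).continuousOn
      continuousOn_invFun := htc }
  exact ⟨e, hyO, fun _ _ => rfl⟩

lemma isCoveringMap_of_isCompact_preimage [T2Space E] [T2Space B] [LocallyCompactSpace B]
    {f : E → B} (hf : IsLocalHomeomorph f) (hK : ∀ K, IsCompact K → IsCompact (f ⁻¹' K)) :
    IsCoveringMap f := by
  have hproper : IsProperMap f := isProperMap_iff_isCompact_preimage.2 ⟨hf.continuous, hK⟩
  rw [isCoveringMap_iff_isCoveringMapOn_univ]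
  refine hproper.isClosedMap.isCoveringMapOn_of_isLocalHomeomorphOn (fun b _ => ?_)
    (by simpa [← isLocalHomeomorph_iff_isLocalHomeomorphOn_univ])
  refine (hK _ isCompact_singleton).finite ?_
  refine IsDiscrete.of_openPartialHomeomorph f subset_rfl fun e _ => ?_
  obtain ⟨φ, hφ, rfl⟩ := hf e
  exact ⟨φ, hφ, rfl⟩

lemma isClopen_range_section [T2Space E] {f : E → B} (hf : IsLocalHomeomorph f) {s : C(B, E)}
    (hs : Function.LeftInverse f s) : IsClopen (range s) := by
  have hrange : range s = {e | s (f e) = e} := by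
    ext e
    exact ⟨fun ⟨b, hb⟩ => hb ▸ congrArg s (hs b), fun he => ⟨f e, he⟩⟩
  refine ⟨hrange ▸ isClosed_eq (s.continuous.comp hf.continuous) continuous_id, ?_⟩
  refine (hf.isOpenEmbedding_of_comp ?_ s.continuous).isOpen_range
  rw [hs.comp_eq_id]
  exact .id

/-- Through each point of `E` passes a section of the covering, with clopen image; two sections
through one fibre inside a connected set have to agree. -/
lemma bijective_of_isCoveringMap [T2Space E] [Nonempty E] [SimplyConnectedSpace B]
    [LocallyPathConnectedSpace B] {f : E → B} (hf : IsCoveringMap f) {Z : Set E}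
    (hZ : IsPreconnected Z) {b : B} (hb : f ⁻¹' {b} ⊆ Z) : Function.Bijective f := by
  have hlift : ∀ e, ∃ s : C(B, E), s (f e) = e ∧ f ∘ s = id := fun e =>
    (hf.existsUnique_continuousMap_lifts (.id B) (f e) e rfl).exists
  have hagree : ∀ s t : C(B, E), f ∘ s = id → f ∘ t = id → s = t := fun s t hs ht => by
    have hfs : ∀ a, f (s a) = a := congrFun hs
    have hft : ∀ a, f (t a) = a := congrFun ht
    have hsub := hZ.subset_isClopen (isClopen_range_section hf.isLocalHomeomorph hfs)
      ⟨s b, hb (hfs b), mem_range_self b⟩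
    obtain ⟨a, ha⟩ := hsub (hb (hft b))
    obtain rfl : a = b := by rw [← hfs a, ha, hft b]
    exact ContinuousMap.coe_injective
      (hf.eq_of_comp_eq s.continuous t.continuous (hs.trans ht.symm) a ha)
  refine ⟨fun e₁ e₂ he => ?_, fun a => ?_⟩
  · obtain ⟨s, hse, hs⟩ := hlift e₁
    obtain ⟨t, hte, ht⟩ := hlift e₂
    rw [← hse, ← hte, he, hagree s t hs ht]
  · obtain ⟨s, -, hs⟩ := hlift (Classical.arbitrary E)
    exact ⟨s a, congrFun hs a⟩

end Covering

section CollarParam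

variable {n k : ℕ} {X Y : Set (RSpace n)} {P : RSpace n →L[ℝ] RSpace k}
  {g : RSpace k → RSpace n} {δ : ℝ} {s : RSpace k × ℝ → RSpace n} {b : RSpace k × ℝ}
  {y : RSpace n}

/-- The range `ball 0 δ × (0, δ)` of the collar coordinates on the complement of `X`. -/
def collarBase (k : ℕ) (δ : ℝ) : Set (RSpace k × ℝ) := ball 0 δ ×ˢ Ioo 0 δ

lemma isOpen_collarBase (k : ℕ) (δ : ℝ) : IsOpen (collarBase k δ) :=
  Metric.isOpen_ball.prod isOpen_Ioo

lemma mem_tubeSet_of_collarMap (hy : collarMap P g y ∈ collarBase k δ) :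
    y ∈ tubeSet P g δ := ⟨mem_ball_zero_iff.1 hy.1, hy.2.2⟩

namespace IsTube

lemma collarMap_mem (h : IsTube X P g δ) (hy : y ∈ tubeSet P g δ) (hyX : y ∉ X) :
    collarMap P g y ∈ collarBase k δ :=
  ⟨mem_ball_zero_iff.2 hy.1, norm_pos_iff.2 (h.sub_ne_zero hy hyX), hy.2⟩

lemma notMem_of_collarMap_mem (h : IsTube X P g δ) (hy : collarMap P g y ∈ collarBase k δ) :
    y ∉ X := fun hyX => by
  have hyt := mem_tubeSet_of_collarMap hy
  have hpos : 0 < ‖y - g (P y)‖ := hy.2.1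
  rw [← (h.mem_iff y hyt).1 hyX, sub_self, norm_zero] at hpos
  exact lt_irrefl _ hpos

lemma isBounded_tubeSet_inter (h : IsTube X P g δ) {K : Set (RSpace k)} (hK : IsCompact K)
    (hKδ : K ⊆ ball 0 δ) : Bornology.IsBounded (tubeSet P g δ ∩ P ⁻¹' K) := by
  obtain ⟨R, hR⟩ := (hK.image_of_continuousOn
    (h.smooth.continuousOn.mono hKδ)).isBounded.exists_norm_le
  refine isBounded_iff_forall_norm_le.2 ⟨δ + R, fun y hy => ?_⟩
  calc ‖y‖ = ‖(y - g (P y)) + g (P y)‖ := by rw [sub_add_cancel]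
    _ ≤ ‖y - g (P y)‖ + ‖g (P y)‖ := norm_add_le _ _
    _ ≤ δ + R := add_le_add hy.1.2.le (hR _ (mem_image_of_mem g hy.2))

lemma isCompact_collarMap_preimage (h : IsTube X P g δ) {C : Set (RSpace n)} (hC : IsClosed C)
    (hCS : ∀ y ∈ tubeSet P g δ, y ∈ C ↔ y ∈ X ∪ Y) {K : Set (RSpace k × ℝ)} (hK : IsCompact K)
    (hKB : K ⊆ collarBase k δ) : IsCompact (Y ∩ collarMap P g ⁻¹' K) := by
  have hKfst : IsCompact (Prod.fst '' K) := hK.image continuous_fst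
  have hKδ : Prod.fst '' K ⊆ ball 0 δ := image_subset_iff.2 fun b hb => (hKB hb).1
  have hclosed : IsClosed ((P ⁻¹' (Prod.fst '' K)) ∩ collarMap P g ⁻¹' K) :=
    (h.continuousOn_collarMap.mono (preimage_mono hKδ)).preimage_isClosed_of_isClosed
      (hKfst.isClosed.preimage P.continuous) hK.isClosed
  have hset : Y ∩ collarMap P g ⁻¹' K = (P ⁻¹' (Prod.fst '' K)) ∩ collarMap P g ⁻¹' K ∩ C := by
    ext y
    constructor
    · exact fun ⟨hyY, hyK⟩ => ⟨⟨⟨_, hyK, rfl⟩, hyK⟩,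
        (hCS y (mem_tubeSet_of_collarMap (hKB hyK))).2 (Or.inr hyY)⟩
    · exact fun ⟨⟨_, hyK⟩, hyC⟩ => ⟨((hCS y (mem_tubeSet_of_collarMap (hKB hyK))).1
        hyC).resolve_left (h.notMem_of_collarMap_mem (hKB hyK)), hyK⟩
  refine Metric.isCompact_of_isClosed_isBounded (hset ▸ hclosed.inter hC)
    ((h.isBounded_tubeSet_inter hKfst hKδ).subset fun y hy => ?_)
  exact ⟨mem_tubeSet_of_collarMap (hKB hy.2), _, hy.2, rfl⟩

lemma exists_local_inverse_collarMap (h : IsTube X P g δ) (hY : IsSubmanifold 1 (k + 1) Y)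
    (hXY : Disjoint X Y) (hyY : y ∈ Y) (hyt : y ∈ tubeSet P g δ)
    (hinj : ∀ v ∈ tangentVectors Y y, fderiv ℝ (collarMap P g) y v = 0 → v = 0) :
    ∃ O O' s, IsOpen O ∧ y ∈ O ∧ IsOpen O' ∧ ContDiffOn ℝ 1 s O' ∧
      MapsTo (collarMap P g) (Y ∩ tubeSet P g δ ∩ O) O' ∧
      MapsTo s O' (Y ∩ tubeSet P g δ ∩ O) ∧
      InvOn s (collarMap P g) (Y ∩ tubeSet P g δ ∩ O) O' := by
  obtain ⟨Φ, hΦ⟩ := hY.2 y hyY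
  obtain ⟨O, O', s, hO, hyO, hO', hs, hfO, hsO, hinv⟩ := hΦ.exists_local_param hyY hY.1
    (G := RSpace k × ℝ) (by simp) (h.contDiffAt_collarMap hyt (hXY.notMem_of_mem_right hyY)) hinj
  have hsub : Y ∩ tubeSet P g δ ∩ O ⊆ Y ∩ O := fun m hm => ⟨hm.1.1, hm.2⟩
  refine ⟨O, O' ∩ s ⁻¹' tubeSet P g δ, s, hO, hyO,
    hs.continuousOn.isOpen_inter_preimage hO' h.isOpen_tubeSet, hs.mono inter_subset_left,
    fun m hm => ⟨hfO (hsub hm), ?_⟩, fun b hb => ⟨⟨(hsO hb.1).1, hb.2⟩, (hsO hb.1).2⟩,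
    hinv.mono hsub inter_subset_left⟩
  rw [mem_preimage, hinv.1 (hsub hm)]
  exact hm.1.2

lemma mapsTo_collarMap (h : IsTube X P g δ) (hXY : Disjoint X Y) :
    MapsTo (collarMap P g) (Y ∩ tubeSet P g δ) (collarBase k δ) :=
  fun _ hy => h.collarMap_mem hy.2 (hXY.notMem_of_mem_right hy.1)

lemma isCoveringMap_collarMap (h : IsTube X P g δ) (hY : IsSubmanifold 1 (k + 1) Y)
    (hXY : Disjoint X Y) {C : Set (RSpace n)} (hC : IsClosed C)
    (hCS : ∀ y ∈ tubeSet P g δ, y ∈ C ↔ y ∈ X ∪ Y)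
    (hinj : ∀ y ∈ Y ∩ tubeSet P g δ, ∀ v ∈ tangentVectors Y y,
      fderiv ℝ (collarMap P g) y v = 0 → v = 0) :
    IsCoveringMap ((h.mapsTo_collarMap hXY).restrict (collarMap P g) (Y ∩ tubeSet P g δ) _) := by
  have hcont : ContinuousOn (collarMap P g) (Y ∩ tubeSet P g δ) :=
    h.continuousOn_collarMap.mono fun y hy => proj_mem_ball_of_mem_tubeSet hy.2
  have := (isOpen_collarBase k δ).locallyCompactSpace
  refine isCoveringMap_of_isCompact_preimage (isLocalHomeomorph_restrict hcont _ fun y hy => ?_)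
    fun K hK => ?_
  · obtain ⟨O, O', s, hO, hyO, hO', hs, hrest⟩ :=
      h.exists_local_inverse_collarMap hY hXY hy.1 hy.2 (hinj y hy)
    exact ⟨O, O', s, hO, hyO, hO', hs.continuousOn, hrest⟩
  · rw [Topology.IsEmbedding.subtypeVal.isCompact_iff]
    convert h.isCompact_collarMap_preimage hC hCS (hK.image continuous_subtype_val)
      (Subtype.coe_image_subset _ K) using 1
    ext y
    constructor
    · rintro ⟨y, hy, rfl⟩
      exact ⟨y.2.1, _, hy, rfl⟩
    · rintro ⟨hy, b, hb, hyb⟩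
      have hyt : y ∈ tubeSet P g δ := mem_tubeSet_of_collarMap (hyb ▸ b.2)
      refine ⟨⟨y, hy, hyt⟩, ?_, rfl⟩
      have hbeq : (h.mapsTo_collarMap hXY).restrict _ _ _ ⟨y, hy, hyt⟩ = b := Subtype.ext hyb.symm
      exact mem_preimage.2 (hbeq ▸ hb)

/-- Collar coordinates are a covering of a convex set, and the part of `Y` above `(0, r)` lies in
the connected set `Y ∩ ball 0 ε`. -/
theorem bijOn_collarMap (h : IsTube X P g δ) (hY : IsSubmanifold 1 (k + 1) Y)
    (hXY : Disjoint X Y) {C : Set (RSpace n)} (hC : IsClosed C)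
    (hCS : ∀ y ∈ tubeSet P g δ, y ∈ C ↔ y ∈ X ∪ Y)
    (hinj : ∀ y ∈ Y ∩ tubeSet P g δ, ∀ v ∈ tangentVectors Y y,
      fderiv ℝ (collarMap P g) y v = 0 → v = 0)
    {ε : ℝ} (hε : 0 < ε) (hεt : ball 0 ε ⊆ tubeSet P g δ) (hconn : IsConnected (Y ∩ ball 0 ε)) :
    BijOn (collarMap P g) (Y ∩ tubeSet P g δ) (collarBase k δ) := by
  have hcov := h.isCoveringMap_collarMap hY hXY hC hCS hinj
  obtain ⟨r, hr0, hr⟩ := exists_between (lt_min hε h.pos)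
  have hrB : ((0, r) : RSpace k × ℝ) ∈ collarBase k δ :=
    ⟨h.zero_mem_ball, hr0, hr.trans_le (min_le_right _ _)⟩
  have hsub : Y ∩ ball 0 ε ⊆ Y ∩ tubeSet P g δ := inter_subset_inter_right _ hεt
  have : Nonempty ↥(Y ∩ tubeSet P g δ) := (hconn.nonempty.mono hsub).to_subtype
  have : ContractibleSpace (collarBase k δ) :=
    ((convex_ball (0 : RSpace k) δ).prod (convex_Ioo 0 δ)).contractibleSpace ⟨_, hrB⟩
  have := (isOpen_collarBase k δ).locallyPathConnectedSpace
  have hZ : IsPreconnected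
      ((Subtype.val : ↥(Y ∩ tubeSet P g δ) → RSpace n) ⁻¹' (Y ∩ ball 0 ε)) := by
    rw [← Topology.IsInducing.subtypeVal.isPreconnected_image, Subtype.image_preimage_coe,
      inter_eq_right.2 hsub]
    exact hconn.isPreconnected
  have hbij := bijective_of_isCoveringMap hcov hZ (b := ⟨(0, r), hrB⟩) fun y hy => by
    have hyr : collarMap P g y = (0, r) := congrArg Subtype.val hy
    have hproj : P y = 0 := congrArg Prod.fst hyr
    have hnorm : ‖(y : RSpace n) - g (P y)‖ = r := congrArg Prod.snd hyr
    rw [hproj, h.zero, sub_zero] at hnorm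
    exact ⟨y.2.1, mem_ball_zero_iff.2 (hnorm ▸ hr.trans_le (min_le_left _ _))⟩
  exact ⟨h.mapsTo_collarMap hXY, (h.mapsTo_collarMap hXY).restrict_inj.1 hbij.1,
    (h.mapsTo_collarMap hXY).restrict_surjective_iff.1 hbij.2⟩

end IsTube

/-- `s` is a `C^1` inverse of the collar coordinates on the part of `Y` in the tube, so that this
part is the image of an open half of a collar of `X`. -/
structure IsCollarParam (P : RSpace n →L[ℝ] RSpace k) (g : RSpace k → RSpace n) (δ : ℝ)
    (Y : Set (RSpace n)) (s : RSpace k × ℝ → RSpace n) : Prop where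
  contDiffOn : ContDiffOn ℝ 1 s (collarBase k δ)
  mapsTo : MapsTo s (collarBase k δ) (Y ∩ tubeSet P g δ)
  invOn : InvOn s (collarMap P g) (Y ∩ tubeSet P g δ) (collarBase k δ)

lemma IsTube.exists_isCollarParam (h : IsTube X P g δ) (hY : IsSubmanifold 1 (k + 1) Y)
    (hXY : Disjoint X Y)
    (hinj : ∀ y ∈ Y ∩ tubeSet P g δ, ∀ v ∈ tangentVectors Y y,
      fderiv ℝ (collarMap P g) y v = 0 → v = 0)
    (hbij : BijOn (collarMap P g) (Y ∩ tubeSet P g δ) (collarBase k δ)) :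
    ∃ s, IsCollarParam P g δ Y s := by
  set s := Function.invFunOn (collarMap P g) (Y ∩ tubeSet P g δ)
  have hs : MapsTo s (collarBase k δ) (Y ∩ tubeSet P g δ) := hbij.surjOn.mapsTo_invFunOn
  have hinv : InvOn s (collarMap P g) (Y ∩ tubeSet P g δ) (collarBase k δ) := hbij.invOn_invFunOn
  refine ⟨s, fun b hb => ContDiffAt.contDiffWithinAt ?_, hs, hinv⟩
  obtain ⟨O, O', t, -, hyO, hO', ht, hfO, htO, hinvO⟩ :=
    h.exists_local_inverse_collarMap hY hXY (hs hb).1 (hs hb).2 (hinj _ (hs hb))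
  have hbO' : O' ∈ 𝓝 b := hO'.mem_nhds (hinv.2 hb ▸ hfO ⟨hs hb, hyO⟩)
  refine (ht.contDiffAt hbO').congr_of_eventuallyEq ?_
  filter_upwards [hbO', (isOpen_collarBase k δ).mem_nhds hb] with c hc hcB
  exact hbij.injOn (hs hcB) (htO hc).1 ((hinv.2 hcB).trans (hinvO.2 hc).symm)

namespace IsCollarParam

lemma collarMap_mem (hs : IsCollarParam P g δ Y s) (hb : b ∈ collarBase k δ) :
    collarMap P g (s b) ∈ collarBase k δ := (hs.invOn.2 hb).symm ▸ hb

lemma proj (hs : IsCollarParam P g δ Y s) (hb : b ∈ collarBase k δ) : P (s b) = b.1 :=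
  congrArg Prod.fst (hs.invOn.2 hb)

lemma norm_sub (hs : IsCollarParam P g δ Y s) (hb : b ∈ collarBase k δ) :
    ‖s b - g b.1‖ = b.2 := by
  rw [← hs.proj hb]
  exact congrArg Prod.snd (hs.invOn.2 hb)

lemma collarDir_eq (hs : IsCollarParam P g δ Y s) (hb : b ∈ collarBase k δ) :
    collarDir P g (s b) = b.2⁻¹ • (s b - g b.1) := by
  rw [collarDir, unitVector, hs.proj hb, hs.norm_sub hb]

lemma hasFDerivAt (hs : IsCollarParam P g δ Y s) (hb : b ∈ collarBase k δ) :
    HasFDerivAt s (fderiv ℝ s b) b :=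
  ((hs.contDiffOn.contDiffAt ((isOpen_collarBase k δ).mem_nhds hb)).differentiableAt
    one_ne_zero).hasFDerivAt

lemma fderiv_mem_tangentVectors (hs : IsCollarParam P g δ Y s) (hb : b ∈ collarBase k δ)
    (z : RSpace k × ℝ) : fderiv ℝ s b z ∈ tangentVectors Y (s b) := by
  have hline : HasDerivAt (fun t : ℝ => b + t • z) z 0 := by
    simpa using ((hasDerivAt_id (0 : ℝ)).smul_const z).const_add b
  have hzero : b + (0 : ℝ) • z = b := by rw [zero_smul, add_zero]
  refine ⟨fun t => s (b + t • z), congrArg s hzero, ?_,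
    HasFDerivAt.comp_hasDerivAt (l := s) 0 (by simpa only [hzero] using hs.hasFDerivAt hb) hline⟩
  filter_upwards [hline.continuousAt.eventually
    ((isOpen_collarBase k δ).mem_nhds (by simpa only [hzero] using hb))]
    with t ht using (hs.mapsTo ht).1

lemma fderiv_collarMap_fderiv (h : IsTube X P g δ) (hs : IsCollarParam P g δ Y s)
    (hb : b ∈ collarBase k δ) (z : RSpace k × ℝ) :
    fderiv ℝ (collarMap P g) (s b) (fderiv ℝ s b z) = z := by
  have hcomp := ((h.contDiffAt_collarMap (hs.mapsTo hb).2 (h.notMem_of_collarMap_mem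
    (hs.collarMap_mem hb))).differentiableAt one_ne_zero).hasFDerivAt.comp b (hs.hasFDerivAt hb)
  have hid : HasFDerivAt (collarMap P g ∘ s) (.id ℝ (RSpace k × ℝ)) b :=
    (hasFDerivAt_id b).congr_of_eventuallyEq
      (hs.invOn.2.eqOn.eventuallyEq_of_mem ((isOpen_collarBase k δ).mem_nhds hb))
  exact congrArg (fun L => L z) (hcomp.unique hid)

end IsCollarParam

end CollarParam

section OMinimal

variable {L : FirstOrder.Language.{u, v}} [L.Structure ℝ] {α ι : Type*} {f f' : (α → ℝ) → ℝ}

lemma eventually_mem_or_notMem_of_ordConnected {I : Set ℝ} (hI : I.OrdConnected) :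
    (∀ᶠ r in 𝓝[>] (0 : ℝ), r ∈ I) ∨ ∀ᶠ r in 𝓝[>] (0 : ℝ), r ∉ I := by
  refine or_iff_not_imp_right.2 fun hnot => ?_
  have hfreq : ∃ᶠ r in 𝓝[>] (0 : ℝ), r ∈ I := hnot
  obtain ⟨r₀, hr₀, hr₀pos⟩ := (hfreq.and_eventually self_mem_nhdsWithin).exists
  filter_upwards [Ioo_mem_nhdsGT (show (0 : ℝ) < r₀ from hr₀pos)] with r hr
  obtain ⟨r₁, hr₁, hr₁r⟩ := (hfreq.and_eventually (Ioo_mem_nhdsGT hr.1)).exists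
  exact hI.out hr₁ hr₀ ⟨hr₁r.2.le, hr.2.le⟩

lemma definableFun_of_graph {op : ℝ → ℝ → ℝ}
    (hop : (univ : Set ℝ).Definable L {w : Fin 3 → ℝ | op (w 0) (w 1) = w 2})
    (hf : (univ : Set ℝ).DefinableFun L f) (hf' : (univ : Set ℝ).DefinableFun L f') :
    (univ : Set ℝ).DefinableFun L fun v => op (f v) (f' v) := by
  have hop' : (univ : Set ℝ).DefinableFun L fun v : Fin 2 → ℝ => op (v 0) (v 1) :=
    hop.preimage_comp (![some 0, some 1, none] : Fin 3 → Option (Fin 2))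
  have hpair : (univ : Set ℝ).DefinableMap L fun v : α → ℝ => (![f v, f' v] : Fin 2 → ℝ) := by
    simp [DefinableMap, *]
  exact DefinableFun.comp hpair hop'

namespace IsOMinimalExpansionOfRealField

lemma eventually_mem_or_notMem (hL : IsOMinimalExpansionOfRealField L) {S : Set ℝ}
    (hS : (univ : Set ℝ).Definable₁ L S) :
    (∀ᶠ r in 𝓝[>] (0 : ℝ), r ∈ S) ∨ ∀ᶠ r in 𝓝[>] (0 : ℝ), r ∉ S := by
  obtain ⟨F, hF, hFI, rfl⟩ := hL.finite_union_intervals S hS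
  by_cases! h : ∃ I ∈ F, ∀ᶠ r in 𝓝[>] (0 : ℝ), r ∈ I
  · obtain ⟨I, hIF, hI⟩ := h
    exact Or.inl (hI.mono fun r hr => ⟨I, hIF, hr⟩)
  · have hnot : ∀ I ∈ F, ∀ᶠ r in 𝓝[>] (0 : ℝ), r ∉ I := fun I hIF =>
      (eventually_mem_or_notMem_of_ordConnected (hFI I hIF)).resolve_left
        (not_eventually.2 (h I hIF))
    right
    filter_upwards [hF.eventually_all.2 hnot] with r hr
    rintro ⟨I, hIF, hrI⟩
    exact hr I hIF hrI

lemma definableFun_add (hL : IsOMinimalExpansionOfRealField L)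
    (hf : (univ : Set ℝ).DefinableFun L f) (hf' : (univ : Set ℝ).DefinableFun L f') :
    (univ : Set ℝ).DefinableFun L fun v => f v + f' v :=
  definableFun_of_graph hL.definable_add hf hf'

lemma definableFun_mul (hL : IsOMinimalExpansionOfRealField L)
    (hf : (univ : Set ℝ).DefinableFun L f) (hf' : (univ : Set ℝ).DefinableFun L f') :
    (univ : Set ℝ).DefinableFun L fun v => f v * f' v :=
  definableFun_of_graph hL.definable_mul hf hf'

lemma definableFun_sub_const (hL : IsOMinimalExpansionOfRealField L)
    (hf : (univ : Set ℝ).DefinableFun L f) (c : ℝ) :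
    (univ : Set ℝ).DefinableFun L fun v => f v - c := by
  simpa only [sub_eq_add_neg] using
    hL.definableFun_add hf (L.definableFun_const α (mem_univ (-c)))

lemma definableFun_sum (hL : IsOMinimalExpansionOfRealField L) (t : Finset ι)
    {F : ι → (α → ℝ) → ℝ} (hF : ∀ i, (univ : Set ℝ).DefinableFun L (F i)) :
    (univ : Set ℝ).DefinableFun L fun v => ∑ i ∈ t, F i v := by
  classical
  induction t using Finset.induction_on with
  | empty => simpa using L.definableFun_const α (mem_univ (0 : ℝ))
  | insert a t ha ih =>
    simp only [Finset.sum_insert ha]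
    exact hL.definableFun_add (hF a) ih

lemma definableFun_clm (hL : IsOMinimalExpansionOfRealField L) {n : ℕ} (ℓ : RSpace n →L[ℝ] ℝ)
    {y : Fin n → (α → ℝ) → ℝ} (hy : ∀ i, (univ : Set ℝ).DefinableFun L (y i)) :
    (univ : Set ℝ).DefinableFun L fun v => ℓ (WithLp.toLp 2 fun i => y i v) := by
  have hℓ : ∀ w : Fin n → ℝ,
      ℓ (WithLp.toLp 2 w) = ∑ i, w i * ℓ (EuclideanSpace.single i 1) := fun w => by
    conv_lhs => rw [← (EuclideanSpace.basisFun (Fin n) ℝ).sum_repr (WithLp.toLp 2 w), map_sum]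
    simp
  rw [funext fun v => hℓ fun i => y i v]
  exact hL.definableFun_sum _ fun i =>
    hL.definableFun_mul (hy i) (L.definableFun_const α (mem_univ _))

/-- The order is definable, as `a ≤ b` means that `b - a` is a square. -/
lemma definable_le [Finite α] (hL : IsOMinimalExpansionOfRealField L)
    (hf : (univ : Set ℝ).DefinableFun L f) (hf' : (univ : Set ℝ).DefinableFun L f') :
    (univ : Set ℝ).Definable L {v | f v ≤ f' v} := by
  have hinl : ∀ {f : (α → ℝ) → ℝ}, (univ : Set ℝ).DefinableFun L f →
      (univ : Set ℝ).DefinableFun L fun v : α ⊕ Unit → ℝ => f (v ∘ Sum.inl) := fun hf =>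
    DefinableFun.comp (fun _ => DefinableFun.proj L) hf
  have hsq : (univ : Set ℝ).DefinableFun L fun v : α ⊕ Unit → ℝ => v (.inr ()) * v (.inr ()) :=
    hL.definableFun_mul (DefinableFun.proj L) (DefinableFun.proj L)
  convert ((hL.definableFun_add (hinl hf) hsq).ofPred_eq (hinl hf')).exists_of_finite using 1
  ext v
  refine ⟨fun hv => ⟨fun _ => √(f' v - f v), ?_⟩, ?_⟩
  · change f v + √(f' v - f v) * √(f' v - f v) = f' v
    rw [Real.mul_self_sqrt (sub_nonneg.2 hv), add_sub_cancel]
  · rintro ⟨t, ht⟩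
    exact (le_add_of_nonneg_right (mul_self_nonneg (t ()))).trans_eq ht

lemma definable_norm_sub_eq [Finite α] (hL : IsOMinimalExpansionOfRealField L) {n : ℕ}
    {y : Fin n → (α → ℝ) → ℝ} (hy : ∀ i, (univ : Set ℝ).DefinableFun L (y i))
    (hf : (univ : Set ℝ).DefinableFun L f) (x : RSpace n) :
    (univ : Set ℝ).Definable L {v | ‖WithLp.toLp 2 (fun i => y i v) - x‖ = f v} := by
  have hyx := fun i => hL.definableFun_sub_const (hy i) (x i)
  convert ((hL.definableFun_sum Finset.univ fun i =>
    hL.definableFun_mul (hyx i) (hyx i)).ofPred_eq (hL.definableFun_mul hf hf)).inter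
      (hL.definable_le (L.definableFun_const _ (mem_univ 0)) hf) using 1
  ext v
  have hsum : ∑ i, (y i v - x i) * (y i v - x i) = ‖WithLp.toLp 2 (fun i => y i v) - x‖ ^ 2 := by
    rw [EuclideanSpace.real_norm_sq_eq]
    simp only [PiLp.sub_apply, sq]
  change _ ↔ ∑ i, (y i v - x i) * (y i v - x i) = f v * f v ∧ 0 ≤ f v
  rw [hsum, ← sq]
  exact ⟨fun h => h ▸ ⟨rfl, norm_nonneg _⟩, fun h => (sq_eq_sq₀ (norm_nonneg _) h.2).1 h.1⟩

lemma definable₁_exists_slice_le (hL : IsOMinimalExpansionOfRealField L) {n k : ℕ}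
    {Y : Set (RSpace n)} (hY : IsDefinableSet L Y) (P : RSpace n →L[ℝ] RSpace k) (x : RSpace n)
    (u : RSpace k) (ℓ : RSpace n →L[ℝ] ℝ) (c : ℝ) :
    (univ : Set ℝ).Definable₁ L
      {r | ∃ y, (y ∈ Y ∧ P y = u ∧ ‖y - x‖ = r) ∧ ℓ (y - x) ≤ c * r} := by
  have hr : (univ : Set ℝ).DefinableFun L fun v : Fin 1 ⊕ Fin n → ℝ => v (.inl 0) :=
    DefinableFun.proj L
  have hy : ∀ j, (univ : Set ℝ).DefinableFun L fun v : Fin 1 ⊕ Fin n → ℝ => v (.inr j) :=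
    fun _ => DefinableFun.proj L
  have hyx := fun j => hL.definableFun_sub_const (hy j) (x j)
  have hmem : (univ : Set ℝ).Definable L
      {v : Fin 1 ⊕ Fin n → ℝ | WithLp.toLp 2 (fun j => v (.inr j)) ∈ Y} := hY.preimage_comp Sum.inr
  have hproj : (univ : Set ℝ).Definable L {v : Fin 1 ⊕ Fin n → ℝ |
      ∀ j, P (WithLp.toLp 2 fun j => v (.inr j)) j = u j} := by
    simp only [ofPred_forall]
    exact definable_iInter_of_finite fun j =>
      (hL.definableFun_clm ((EuclideanSpace.proj j : RSpace k →L[ℝ] ℝ) ∘L P) hy).ofPred_eq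
        (L.definableFun_const _ (mem_univ (u j)))
  have hdist : (univ : Set ℝ).Definable L {v : Fin 1 ⊕ Fin n → ℝ |
      ‖WithLp.toLp 2 (fun j => v (.inr j)) - x‖ = v (.inl 0)} :=
    hL.definable_norm_sub_eq hy hr x
  have hle : (univ : Set ℝ).Definable L {v : Fin 1 ⊕ Fin n → ℝ |
      ℓ (WithLp.toLp 2 fun j => v (.inr j) - x j) ≤ c * v (.inl 0)} :=
    hL.definable_le (hL.definableFun_clm ℓ hyx)
      (hL.definableFun_mul (L.definableFun_const _ (mem_univ c)) hr)
  have hslice := (hmem.inter (hproj.inter (hdist.inter hle))).exists_of_finite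
  rw [Definable₁]
  convert hslice using 1
  ext v
  constructor
  · rintro ⟨y, ⟨hyY, hyP, hyr⟩, hyl⟩
    exact ⟨y.ofLp, hyY, fun j => congrArg (· j) hyP, hyr, hyl⟩
  · rintro ⟨w, hwY, hwP, hwr, hwl⟩
    exact ⟨WithLp.toLp 2 w, ⟨hwY, PiLp.ext hwP, hwr⟩, hwl⟩

end IsOMinimalExpansionOfRealField

lemma exists_tendsto_of_eventually_le_or_lt {β : Type*} {l : Filter β} {q : β → ℝ} {C : ℝ}
    (hC : ∀ᶠ b in l, |q b| ≤ C)
    (h : ∀ c, (∀ᶠ b in l, q b ≤ c) ∨ ∀ᶠ b in l, c < q b) : ∃ c, Tendsto q l (𝓝 c) := by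
  refine tendsto_of_no_upcrossings dense_univ (fun a _ b _ hab => ?_)
    ⟨C, eventually_map.2 (hC.mono fun r hr => (abs_le.1 hr).2)⟩
    ⟨-C, eventually_map.2 (hC.mono fun r hr => (abs_le.1 hr).1)⟩
  rintro ⟨hlow, hhigh⟩
  rcases h a with hle | hlt
  · exact hhigh (hle.mono fun r hr => (hr.trans hab.le).not_gt)
  · exact hlow (hlt.mono fun r hr => hr.not_gt)

/-- By o-minimality each coordinate of the direction is eventually on one side of any given
constant. -/
theorem IsOMinimalExpansionOfRealField.exists_tendsto_slice
    (hL : IsOMinimalExpansionOfRealField L) {n k : ℕ}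
    {Y : Set (RSpace n)} (hY : IsDefinableSet L Y) (P : RSpace n →L[ℝ] RSpace k) (x : RSpace n)
    (u : RSpace k) {s : ℝ → RSpace n} {δ : ℝ} (hδ : 0 < δ)
    (hs : ∀ r, 0 < r → r < δ → ∀ y, (y ∈ Y ∧ P y = u ∧ ‖y - x‖ = r) ↔ y = s r) :
    ∃ θ, Tendsto (fun r => r⁻¹ • (s r - x)) (𝓝[>] 0) (𝓝 θ) := by
  have hIoo : ∀ᶠ r in 𝓝[>] (0 : ℝ), r ∈ Ioo 0 δ := Ioo_mem_nhdsGT hδ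
  have hcoord : ∀ i : Fin n, ∃ c, Tendsto (fun r => r⁻¹ * (s r - x) i) (𝓝[>] 0) (𝓝 c) := by
    refine fun i => exists_tendsto_of_eventually_le_or_lt (C := 1) ?_ fun c => ?_
    · filter_upwards [hIoo] with r hr
      have hnorm : ‖s r - x‖ = r := ((hs r hr.1 hr.2 (s r)).2 rfl).2.2
      rw [abs_mul, abs_of_pos (inv_pos.2 hr.1), inv_mul_le_iff₀ hr.1, mul_one]
      exact (PiLp.norm_apply_le (s r - x) i).trans_eq hnorm
    · have hmem : ∀ r ∈ Ioo 0 δ, (∃ y, (y ∈ Y ∧ P y = u ∧ ‖y - x‖ = r) ∧ (y - x) i ≤ c * r) ↔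
          r⁻¹ * (s r - x) i ≤ c := fun r hr => by
        simp only [hs r hr.1 hr.2, exists_eq_left, inv_mul_le_iff₀ hr.1, mul_comm c]
      refine (hL.eventually_mem_or_notMem (hL.definable₁_exists_slice_le hY P x u
        (EuclideanSpace.proj i) c)).imp (fun h => ?_) fun h => ?_
      · filter_upwards [h, hIoo] with r hrS hr using (hmem r hr).1 hrS
      · filter_upwards [h, hIoo] with r hrS hr using not_le.1 ((hmem r hr).not.1 hrS)
  choose c hc using hcoord
  exact ⟨WithLp.toLp 2 c,
    ((PiLp.continuous_toLp 2 fun _ : Fin n => ℝ).tendsto c).comp (tendsto_pi_nhds.2 hc)⟩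

end OMinimal

section BaireLimit

lemma exists_dist_le_of_tendsto {Z : Type*} [PseudoMetricSpace Z] {ε : ℝ} {q : ℝ → Z} {z : Z}
    (δ : ℝ) (hε : 0 < ε) (hlim : Tendsto q (𝓝[>] 0) (𝓝 z)) :
    ∃ m : ℕ, ∀ r ∈ Ioo 0 (δ / (m + 1)), ∀ t ∈ Ioo 0 (δ / (m + 1)),
      dist (q r) (q t) ≤ ε := by
  obtain ⟨a, ha, hball⟩ := (nhdsGT_basis (0 : ℝ)).mem_iff.1
    (hlim (Metric.ball_mem_nhds z (half_pos hε)))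
  obtain ⟨m, hm⟩ := exists_nat_gt (δ / a)
  have hma : δ / (m + 1) ≤ a := by
    rw [div_le_iff₀ (by positivity), ← div_le_iff₀' ha]
    linarith
  have hclose : ∀ r ∈ Ioo 0 (δ / (m + 1)), dist (q r) z < ε / 2 := fun r hr =>
    hball ⟨hr.1, hr.2.trans_le hma⟩
  exact ⟨m, fun r hr t ht => by
    linarith [hclose r hr, hclose t ht, dist_triangle_right (q r) (q t) z]⟩

variable {T Z : Type*} [TopologicalSpace T] {h : T × ℝ → Z} {δ ρ ε : ℝ}

lemma continuous_slice_of_continuousOn [TopologicalSpace Z]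
    (hc : ContinuousOn h (univ ×ˢ Ioo 0 δ)) {r : ℝ} (hr : r ∈ Ioo 0 δ) :
    Continuous fun u => h (u, r) :=
  continuousOn_univ.1 (hc.comp (by fun_prop) fun u _ => ⟨mem_univ u, hr⟩)

lemma isClosed_setOf_dist_slice_le [PseudoMetricSpace Z]
    (hc : ContinuousOn h (univ ×ˢ Ioo 0 δ)) (hρ : ρ ≤ δ) (ε : ℝ) :
    IsClosed {u | ∀ r ∈ Ioo 0 ρ, ∀ t ∈ Ioo 0 ρ, dist (h (u, r)) (h (u, t)) ≤ ε} := by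
  simp only [ofPred_forall]
  exact isClosed_iInter fun r => isClosed_iInter fun hr => isClosed_iInter fun t =>
    isClosed_iInter fun ht => isClosed_le
      ((continuous_slice_of_continuousOn hc ⟨hr.1, hr.2.trans_le hρ⟩).dist
        (continuous_slice_of_continuousOn hc ⟨ht.1, ht.2.trans_le hρ⟩)) continuous_const

lemma exists_mem_nhds_prod_dist_lt [PseudoMetricSpace Z]
    (hc : ContinuousOn h (univ ×ˢ Ioo 0 δ)) (hρ0 : 0 < ρ) (hρ : ρ ≤ δ) (hε : 0 < ε) {u : T}
    (hu : ∀ᶠ a in 𝓝 u, ∀ r ∈ Ioo 0 ρ, ∀ t ∈ Ioo 0 ρ, dist (h (a, r)) (h (a, t)) ≤ ε / 6) :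
    ∃ A ∈ 𝓝 u ×ˢ 𝓝[>] (0 : ℝ), ∀ b ∈ A, ∀ c ∈ A, dist (h b) (h c) < ε := by
  have hr₀ : ρ / 2 ∈ Ioo 0 ρ := ⟨half_pos hρ0, half_lt_self hρ0⟩
  have hcont : ∀ᶠ a in 𝓝 u, dist (h (a, ρ / 2)) (h (u, ρ / 2)) < ε / 6 :=
    Metric.continuousAt_iff'.1 (continuous_slice_of_continuousOn hc
      ⟨hr₀.1, hr₀.2.trans_le hρ⟩).continuousAt _ (by positivity)
  refine ⟨_, prod_mem_prod (hu.and hcont) (Ioo_mem_nhdsGT hρ0), ?_⟩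
  have hclose : ∀ b ∈ {a | (∀ r ∈ Ioo 0 ρ, ∀ t ∈ Ioo 0 ρ, dist (h (a, r)) (h (a, t)) ≤ ε / 6) ∧
      dist (h (a, ρ / 2)) (h (u, ρ / 2)) < ε / 6} ×ˢ Ioo 0 ρ,
      dist (h b) (h (u, ρ / 2)) < ε / 2 := fun b hb => by
    linarith [hb.1.1 b.2 hb.2 _ hr₀, hb.1.2,
      dist_triangle (h b) (h (b.1, ρ / 2)) (h (u, ρ / 2))]
  exact fun b hb c hc => by
    linarith [hclose b hb, hclose c hc, dist_triangle_right (h b) (h c) (h (u, ρ / 2))]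

theorem exists_tendsto_prod_of_tendsto [BaireSpace T] [Nonempty T] [MetricSpace Z]
    [CompleteSpace Z] (hδ : 0 < δ) (hc : ContinuousOn h (univ ×ˢ Ioo 0 δ))
    (hlim : ∀ u, ∃ z, Tendsto (fun r => h (u, r)) (𝓝[>] 0) (𝓝 z)) :
    ∃ u z, Tendsto h (𝓝 u ×ˢ 𝓝[>] 0) (𝓝 z) := by
  let A : ℕ → ℕ → Set T := fun j m =>
    {u | ∀ r ∈ Ioo 0 (δ / (m + 1)), ∀ t ∈ Ioo 0 (δ / (m + 1)),
      dist (h (u, r)) (h (u, t)) ≤ (1 / (j + 1)) / 6}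
  have hρδ : ∀ m : ℕ, δ / (m + 1) ≤ δ := fun m => div_le_self hδ.le (by simp)
  have hcover : ∀ j, ⋃ m, A j m = univ := fun j => eq_univ_of_forall fun u => by
    obtain ⟨z, hz⟩ := hlim u
    exact mem_iUnion.2 (exists_dist_le_of_tendsto δ (by positivity) hz)
  have hdense : Dense (⋂ j : ℕ, ⋃ m, interior (A j m)) :=
    dense_iInter_of_isOpen_nat (fun j => isOpen_iUnion fun m => isOpen_interior) fun j =>
      dense_iUnion_interior_of_closed (fun m => isClosed_setOf_dist_slice_le hc (hρδ m) _)
        (hcover j)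
  obtain ⟨u, hu⟩ := hdense.nonempty
  have hcauchy : Cauchy (map h (𝓝 u ×ˢ 𝓝[>] 0)) := by
    refine Metric.cauchy_iff.2 ⟨inferInstance, fun ε hε => ?_⟩
    obtain ⟨j, hj⟩ := exists_nat_one_div_lt hε
    obtain ⟨m, hm⟩ := mem_iUnion.1 (mem_iInter.1 hu j)
    obtain ⟨B, hB, hBdist⟩ := exists_mem_nhds_prod_dist_lt hc (by positivity) (hρδ m)
      (by positivity) (mem_interior_iff_mem_nhds.1 hm)
    exact ⟨h '' B, image_mem_map hB, forall_mem_image.2 fun b hb => forall_mem_image.2 fun c hc =>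
      (hBdist b hb c hc).trans hj⟩
  obtain ⟨z, hz⟩ := CompleteSpace.complete hcauchy
  exact ⟨u, z, hz⟩

end BaireLimit

section NormallyPseudoFlat

variable {n k : ℕ} {X Y : Set (RSpace n)} {P : RSpace n →L[ℝ] RSpace k}
  {g : RSpace k → RSpace n} {δ : ℝ} {u : RSpace k}

lemma NormallyPseudoFlat.eventually_exists_mem_normalCone {S : Set (RSpace n)}
    (hnpf : NormallyPseudoFlat X S) {p : RSpace n × RSpace n} (hp : p ∈ normalCone X S)
    {N : Set (RSpace n)} (hN : IsOpen N) (hpN : p.2 ∈ N) :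
    ∀ᶠ x in 𝓝[X] p.1, ∃ q ∈ N, (x, q) ∈ normalCone X S := by
  obtain ⟨W, hW, hWX⟩ := isOpen_induced_iff.1 (hnpf {q | (q : RSpace n × RSpace n).2 ∈ N}
    (hN.preimage (continuous_snd.comp continuous_subtype_val)))
  have hpW : (⟨p.1, hp.1⟩ : X) ∈ Subtype.val ⁻¹' W := by
    rw [hWX]
    exact ⟨⟨p, hp⟩, hpN, rfl⟩
  filter_upwards [self_mem_nhdsWithin, nhdsWithin_le_nhds (hW.mem_nhds hpW)] with x hxX hxW
  have hx : (⟨x, hxX⟩ : X) ∈ Subtype.val ⁻¹' W := hxW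
  rw [hWX] at hx
  obtain ⟨q, hqN, hqx⟩ := hx
  obtain rfl : (q : RSpace n × RSpace n).1 = x := congrArg Subtype.val hqx
  exact ⟨_, hqN, q.2⟩

namespace IsTube

lemma eventually_mem_tubeSet_diff (h : IsTube X P g δ) (hXY : Disjoint X Y)
    (hu : u ∈ ball (0 : RSpace k) δ) : ∀ᶠ y in 𝓝[Y] (g u), y ∈ tubeSet P g δ ∧ y ∉ X := by
  filter_upwards [self_mem_nhdsWithin, nhdsWithin_le_nhds (h.tubeSet_mem_nhds hu)] with y hy hyt
    using ⟨hyt, fun hyX => hXY.le_bot ⟨hyX, hy⟩⟩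

lemma tendsto_collarMap (h : IsTube X P g δ) (hXY : Disjoint X Y)
    (hu : u ∈ ball (0 : RSpace k) δ) :
    Tendsto (collarMap P g) (𝓝[Y] (g u)) (𝓝 u ×ˢ 𝓝[>] 0) := by
  have hcont : ContinuousAt (fun y => ‖y - g (P y)‖) (g u) :=
    (h.contDiffAt_sub (h.section_mem_tubeSet hu)).continuousAt.norm
  have hnorm : Tendsto (fun y => ‖y - g (P y)‖) (𝓝 (g u)) (𝓝 0) := by
    simpa only [h.proj u hu, sub_self, norm_zero] using hcont.tendsto
  refine ((h.tendsto_proj hu).mono_left nhdsWithin_le_nhds).prodMk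
    (tendsto_nhdsWithin_iff.2 ⟨hnorm.mono_left nhdsWithin_le_nhds, ?_⟩)
  filter_upwards [h.eventually_mem_tubeSet_diff hXY hu] with y hy
  exact norm_pos_iff.2 (h.sub_ne_zero hy.1 hy.2)

lemma exists_tendsto_collarDir (h : IsTube X P g δ) (hXY : Disjoint X Y)
    {s : RSpace k × ℝ → RSpace n} (hs : IsCollarParam P g δ Y s)
    (hlim : ∀ u ∈ ball (0 : RSpace k) δ,
      ∃ θ, Tendsto (fun r => r⁻¹ • (s (u, r) - g u)) (𝓝[>] 0) (𝓝 θ))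
    {O : Set (RSpace k)} (hO : IsOpen O) (hOδ : O ⊆ ball 0 δ) (hne : O.Nonempty) :
    ∃ u ∈ O, ∃ θ, Tendsto (collarDir P g) (𝓝[Y] (g u)) (𝓝 θ) := by
  have := hO.baireSpace
  have := hne.to_subtype
  have hcont : ContinuousOn (fun b : O × ℝ => b.2⁻¹ • (s (b.1, b.2) - g b.1))
      (univ ×ˢ Ioo 0 δ) :=
    (continuous_snd.continuousOn.inv₀ fun b hb => hb.2.1.ne').smul <|
      (hs.contDiffOn.continuousOn.comp (by fun_prop) fun b hb => ⟨hOδ b.1.2, hb.2⟩).sub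
        (h.smooth.continuousOn.comp (by fun_prop) fun b _ => hOδ b.1.2)
  obtain ⟨u, θ, hθ⟩ := exists_tendsto_prod_of_tendsto h.pos hcont fun u => hlim u (hOδ u.2)
  have hjoint : Tendsto (fun b : RSpace k × ℝ => b.2⁻¹ • (s (b.1, b.2) - g b.1))
      (𝓝 (u : RSpace k) ×ˢ 𝓝[>] 0) (𝓝 θ) := by
    rw [← hO.isOpenEmbedding_subtypeVal.map_nhds_eq u, ← map_id (f := 𝓝[>] (0 : ℝ)),
      prod_map_map_eq, tendsto_map'_iff]
    exact hθ
  refine ⟨u, u.2, θ, (hjoint.comp (h.tendsto_collarMap hXY (hOδ u.2))).congr' ?_⟩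
  filter_upwards [self_mem_nhdsWithin, nhdsWithin_le_nhds (h.tubeSet_mem_nhds (hOδ u.2))]
    with y hy hyt
  have hsy : s (collarMap P g y) = y := hs.invOn.1 ⟨hy, hyt⟩
  change (collarMap P g y).2⁻¹ • (s (collarMap P g y) - g (P y)) = _
  rw [hsy]
  rfl

lemma proj_eq_zero_of_tendsto_collarDir (h : IsTube X P g δ) (hu : u ∈ ball (0 : RSpace k) δ)
    {l : Filter (RSpace n)} [l.NeBot] (hl : l ≤ 𝓝 (g u)) {θ : RSpace n}
    (hθ : Tendsto (collarDir P g) l (𝓝 θ)) : P θ = 0 := by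
  refine tendsto_nhds_unique ((P.continuous.tendsto θ).comp hθ) (tendsto_const_nhds.congr' ?_)
  filter_upwards [hl (h.tubeSet_mem_nhds hu)] with y hy using (h.proj_collarDir hy).symm

lemma norm_eq_one_of_tendsto_collarDir (h : IsTube X P g δ) (hXY : Disjoint X Y)
    (hu : u ∈ ball (0 : RSpace k) δ) {l : Filter (RSpace n)} [l.NeBot] (hl : l ≤ 𝓝[Y] (g u))
    {θ : RSpace n} (hθ : Tendsto (collarDir P g) l (𝓝 θ)) : ‖θ‖ = 1 := by
  refine tendsto_nhds_unique hθ.norm (tendsto_const_nhds.congr' ?_)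
  filter_upwards [hl (h.eventually_mem_tubeSet_diff hXY hu)] with y hy
    using (norm_unitVector (h.sub_ne_zero hy.1 hy.2)).symm

lemma tendsto_direction_of_collarDir (h : IsTube X P g δ) (hXY : Disjoint X Y)
    (hu : u ∈ ball (0 : RSpace k) δ) {l : Filter (RSpace n)} [l.NeBot] (hl : l ≤ 𝓝[Y] (g u))
    {θ : RSpace n} (hθ : Tendsto (collarDir P g) l (𝓝 θ)) :
    Tendsto (fun y => unitVector (nearestPoint X y - y)) l
      (𝓝 (-unitVector (normalProj X (g u) θ))) := by
  have hproj := h.proj_eq_zero_of_tendsto_collarDir hu (hl.trans nhdsWithin_le_nhds) hθ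
  have hnorm := h.norm_eq_one_of_tendsto_collarDir hXY hu hl hθ
  refine h.tendsto_nearestPoint_direction hu (hl.trans nhdsWithin_le_nhds) ?_ (fun hzero => ?_) hθ
  · filter_upwards [hl (h.eventually_mem_tubeSet_diff hXY hu)] with y hy
      using h.sub_ne_zero hy.1 hy.2
  · simp [h.eq_zero_of_normalProj hu hproj hzero] at hnorm

lemma mem_normalCone_of_mapClusterPt (h : IsTube X P g δ) (hXY : Disjoint X Y)
    (hu : u ∈ ball (0 : RSpace k) δ) {θ : RSpace n}
    (hθ : MapClusterPt θ (𝓝[Y] (g u)) (collarDir P g)) :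
    P θ = 0 ∧ ‖θ‖ = 1 ∧ (g u, -unitVector (normalProj X (g u) θ)) ∈ normalCone X (Y ∪ X) := by
  obtain ⟨l, hl, hlθ⟩ := mapClusterPt_iff_ultrafilter.1 hθ
  refine ⟨h.proj_eq_zero_of_tendsto_collarDir hu (hl.trans nhdsWithin_le_nhds) hlθ,
    h.norm_eq_one_of_tendsto_collarDir hXY hu hl hlθ,
    mem_normalCone_of_tendsto (h.section_mem hu) (l := l) ?_
      (h.tendsto_direction_of_collarDir hXY hu hl hlθ)⟩
  rwa [union_sdiff_right, hXY.symm.sdiff_eq_left]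

/-- Two limiting directions over `u` give distinct points of the normal cone, so that openness of
the cone yields two distinct cone points over nearby `u'` too, where there is only one. -/
theorem tendsto_collarDir_of_normallyPseudoFlat (h : IsTube X P g δ) (hXY : Disjoint X Y)
    (hcl : X ⊆ closure Y) (hnpf : NormallyPseudoFlat X (Y ∪ X))
    (hd : ∀ O : Set (RSpace k), IsOpen O → O ⊆ ball 0 δ → O.Nonempty →
      ∃ u ∈ O, ∃ θ, Tendsto (collarDir P g) (𝓝[Y] (g u)) (𝓝 θ))
    (hu : u ∈ ball (0 : RSpace k) δ) :
    ∃ θ, Tendsto (collarDir P g) (𝓝[Y] (g u)) (𝓝 θ) := by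
  have hnebot : ∀ u ∈ ball (0 : RSpace k) δ, (𝓝[Y] (g u)).NeBot := fun u hu =>
    mem_closure_iff_nhdsWithin_neBot.1 (hcl (h.section_mem hu))
  have := hnebot u hu
  have hcpt : IsCompact (closedBall (0 : RSpace n) 1) := isCompact_closedBall _ _
  have hball : closedBall (0 : RSpace n) 1 ∈ map (collarDir P g) (𝓝[Y] (g u)) :=
    mem_map.2 (univ_mem' fun y => mem_closedBall_zero_iff.2 (norm_collarDir_le P g y))
  obtain ⟨θ₀, -, hθ₀⟩ := hcpt.exists_clusterPt (le_principal_iff.2 hball)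
  refine ⟨θ₀, hcpt.le_nhds_of_unique_clusterPt hball fun θ _ hθ => of_not_not fun hne => ?_⟩
  obtain ⟨hP, hnorm, hcone⟩ := h.mem_normalCone_of_mapClusterPt hXY hu hθ
  obtain ⟨hP₀, hnorm₀, hcone₀⟩ := h.mem_normalCone_of_mapClusterPt hXY hu hθ₀
  obtain ⟨N, N₀, hN, hN₀, hqN, hqN₀, hNN⟩ := t2_separation fun heq =>
    hne (h.unitVector_normalProj_injective hu hP hP₀ hnorm hnorm₀ (neg_injective heq))
  have hg : Tendsto g (𝓝 u) (𝓝[X] (g u)) := tendsto_nhdsWithin_iff.2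
    ⟨(h.contDiffAt hu).continuousAt, eventually_of_mem (Metric.isOpen_ball.mem_nhds hu)
      fun u hu => h.section_mem hu⟩
  obtain ⟨O, hOs, hO, huO⟩ := eventually_nhds_iff.1
    ((hg.eventually (hnpf.eventually_exists_mem_normalCone hcone hN hqN)).and
      ((hg.eventually (hnpf.eventually_exists_mem_normalCone hcone₀ hN₀ hqN₀)).and
        (Metric.isOpen_ball.mem_nhds hu)))
  obtain ⟨u', hu'O, θ', hθ'⟩ := hd O hO (fun x hx => (hOs x hx).2.2) ⟨u, huO⟩
  obtain ⟨⟨q, hqN', hq⟩, ⟨q₀, hqN₀', hq₀⟩, hu'⟩ := hOs u' hu'O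
  have := hnebot u' hu'
  have hdir := h.tendsto_direction_of_collarDir hXY hu' le_rfl hθ'
  rw [← hXY.symm.sdiff_eq_left, ← union_sdiff_right] at hdir
  have hqq₀ : q = q₀ := (eq_of_mem_normalCone hq hdir).trans (eq_of_mem_normalCone hq₀ hdir).symm
  exact hNN.le_bot ⟨hqN', hqq₀ ▸ hqN₀'⟩

end IsTube

end NormallyPseudoFlat

section OddExtension

variable {G E : Type*} [NormedAddCommGroup G] [NormedSpace ℝ G] [NormedAddCommGroup E]
  {κ : G × ℝ → E} {b : G × ℝ}

/-- The reflection `(v, t) ↦ (v, -t)`. -/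
noncomputable def flipLast (G : Type*) [NormedAddCommGroup G] [NormedSpace ℝ G] :
    G × ℝ →L[ℝ] G × ℝ :=
  (ContinuousLinearMap.id ℝ G).prodMap (-ContinuousLinearMap.id ℝ ℝ)

@[simp] lemma flipLast_apply (b : G × ℝ) : flipLast G b = (b.1, -b.2) := rfl

lemma flipLast_flipLast (b : G × ℝ) : flipLast G (flipLast G b) = b := by simp

lemma eventually_nhds_prod_zero {u : G} {p : G × ℝ → Prop}
    (hpos : ∀ᶠ b in 𝓝 u ×ˢ 𝓝[>] 0, p b) (hneg : ∀ᶠ b in 𝓝 u ×ˢ 𝓝[>] 0, p (flipLast G b))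
    (hzero : ∀ᶠ a in 𝓝 u, p (a, 0)) : ∀ᶠ b in 𝓝 (u, (0 : ℝ)), p b := by
  have hneg_zero : Tendsto (fun t : ℝ => -t) (𝓝[<] 0) (𝓝[>] 0) := by
    simpa using tendsto_neg_nhdsLT (a := (0 : ℝ))
  have hflip : Tendsto (flipLast G) (𝓝 u ×ˢ 𝓝[<] 0) (𝓝 u ×ˢ 𝓝[>] 0) :=
    tendsto_id.prodMap hneg_zero
  have hsplit : 𝓝 (0 : ℝ) = 𝓝[<] 0 ⊔ (pure 0 ⊔ 𝓝[>] 0) := by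
    rw [← nhdsLT_sup_nhdsGE, ← Ioi_insert, nhdsWithin_insert]
  rw [nhds_prod_eq, hsplit, prod_sup, prod_sup, eventually_sup, eventually_sup, prod_pure,
    eventually_map]
  refine ⟨(hflip.eventually hneg).mono fun b hb => ?_, hzero, hpos⟩
  rwa [flipLast_flipLast] at hb

lemma tendsto_of_tendsto_slice {U T Z : Type*} [TopologicalSpace Z] [RegularSpace Z]
    {l : Filter U} {l' : Filter T} [l'.NeBot] {f : U × T → Z} {L : U → Z} {z : Z}
    (hf : Tendsto f (l ×ˢ l') (𝓝 z))
    (hL : ∀ᶠ a in l, Tendsto (fun t => f (a, t)) l' (𝓝 (L a))) : Tendsto L l (𝓝 z) := by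
  refine (closed_nhds_basis z).tendsto_right_iff.2 fun s hs => ?_
  filter_upwards [(hf.eventually hs.1).curry, hL] with a hmem hlim
  exact hs.2.mem_of_tendsto hlim hmem

/-- The extension of `κ|_{t > 0}` to an odd function of the last coordinate `t`. -/
noncomputable def oddExtension (κ : G × ℝ → E) (b : G × ℝ) : E :=
  if 0 < b.2 then κ b else if b.2 < 0 then -κ (flipLast G b) else 0

lemma oddExtension_of_pos (hb : 0 < b.2) : oddExtension κ b = κ b := if_pos hb

@[simp] lemma oddExtension_zero (a : G) : oddExtension κ (a, 0) = 0 := by simp [oddExtension]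

lemma oddExtension_flipLast (b : G × ℝ) :
    oddExtension κ (flipLast G b) = -oddExtension κ b := by
  rcases lt_trichotomy b.2 0 with hb | hb | hb <;> simp [oddExtension, hb, hb.not_gt]

variable [NormedSpace ℝ E] {θ : G → E} {δ : ℝ} {u : G}

/-- The linear map `(v, t) ↦ t θ`. -/
noncomputable def lastMap (G : Type*) [NormedAddCommGroup G] [NormedSpace ℝ G] (θ : E) :
    G × ℝ →L[ℝ] E :=
  (ContinuousLinearMap.toSpanSingleton ℝ θ).comp (ContinuousLinearMap.snd ℝ G ℝ)

@[simp] lemma lastMap_apply (θ : E) (b : G × ℝ) : lastMap G θ b = b.2 • θ := rfl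

lemma neg_lastMap_comp_flipLast (θ : E) : -(lastMap G θ).comp (flipLast G) = lastMap G θ := by
  ext <;> simp

/-- The derivative of `oddExtension κ`, when `θ` is the derivative along `t = 0` in the last
coordinate. -/
noncomputable def oddExtensionDeriv (κ : G × ℝ → E) (θ : G → E) (b : G × ℝ) : G × ℝ →L[ℝ] E :=
  if 0 < b.2 then fderiv ℝ κ b else
    if b.2 < 0 then -(fderiv ℝ κ (flipLast G b)).comp (flipLast G) else lastMap G (θ b.1)

lemma oddExtensionDeriv_of_pos (hb : 0 < b.2) : oddExtensionDeriv κ θ b = fderiv ℝ κ b :=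
  if_pos hb

@[simp] lemma oddExtensionDeriv_zero (a : G) :
    oddExtensionDeriv κ θ (a, 0) = lastMap G (θ a) := by
  simp [oddExtensionDeriv]

lemma oddExtensionDeriv_eq_neg_comp_flipLast (b : G × ℝ) :
    oddExtensionDeriv κ θ b = -(oddExtensionDeriv κ θ (flipLast G b)).comp (flipLast G) := by
  obtain ⟨a, t⟩ := b
  rcases lt_trichotomy t 0 with ht | rfl | ht
  · simp [oddExtensionDeriv, ht, ht.not_gt]
  · simp [neg_lastMap_comp_flipLast]
  · ext <;> simp [oddExtensionDeriv, ht, ht.not_gt]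

lemma hasFDerivAt_oddExtension_of_pos (hb : 0 < b.2) (hκ : DifferentiableAt ℝ κ b) :
    HasFDerivAt (oddExtension κ) (oddExtensionDeriv κ θ b) b := by
  rw [oddExtensionDeriv_of_pos hb]
  refine hκ.hasFDerivAt.congr_of_eventuallyEq ?_
  filter_upwards [continuous_snd.continuousAt.eventually (lt_mem_nhds hb)] with c hc
  exact oddExtension_of_pos hc

lemma hasFDerivAt_oddExtension_of_neg (hb : b.2 < 0) (hκ : DifferentiableAt ℝ κ (flipLast G b)) :
    HasFDerivAt (oddExtension κ) (oddExtensionDeriv κ θ b) b := by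
  have hpos : HasFDerivAt (oddExtension κ) (oddExtensionDeriv κ θ (flipLast G b)) (flipLast G b) :=
    hasFDerivAt_oddExtension_of_pos (by simpa using hb) hκ
  have hodd : oddExtension κ = -(oddExtension κ ∘ flipLast G) :=
    funext fun c => by simp only [Pi.neg_apply, Function.comp, oddExtension_flipLast, neg_neg]
  rw [hodd, oddExtensionDeriv_eq_neg_comp_flipLast]
  exact (hpos.comp b (flipLast G).hasFDerivAt).neg

lemma hasFDerivAt_oddExtension_zero
    (hlim : Tendsto (fun b : G × ℝ => b.2⁻¹ • κ b) (𝓝 u ×ˢ 𝓝[>] 0) (𝓝 (θ u))) :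
    HasFDerivAt (oddExtension κ) (oddExtensionDeriv κ θ (u, 0)) (u, 0) := by
  rw [hasFDerivAt_iff_isLittleO, isLittleO_iff]
  intro ε hε
  have hpos : ∀ᶠ b in 𝓝 u ×ˢ 𝓝[>] (0 : ℝ), ‖oddExtension κ b - b.2 • θ u‖ ≤ ε * |b.2| := by
    filter_upwards [hlim.eventually (Metric.closedBall_mem_nhds _ hε),
      tendsto_snd.eventually self_mem_nhdsWithin] with b hbε (hb : 0 < b.2)
    rw [dist_eq_norm] at hbε
    rw [oddExtension_of_pos hb, ← smul_inv_smul₀ hb.ne' (κ b), ← smul_sub, norm_smul,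
      Real.norm_eq_abs, mul_comm]
    gcongr
  have hall : ∀ᶠ b in 𝓝 (u, (0 : ℝ)), ‖oddExtension κ b - b.2 • θ u‖ ≤ ε * |b.2| := by
    refine eventually_nhds_prod_zero hpos (hpos.mono fun b hb => ?_) (.of_forall fun a => by simp)
    rw [oddExtension_flipLast, ← norm_neg]
    simpa [add_comm, ← sub_eq_add_neg] using hb
  filter_upwards [hall] with b hb
  have hsnd : |b.2| ≤ ‖b - (u, 0)‖ := by
    have := norm_snd_le (b - (u, 0))
    simpa using this
  rw [oddExtension_zero, oddExtensionDeriv_zero]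
  simpa using hb.trans (by gcongr)

lemma continuousAt_oddExtensionDeriv_of_pos (hb : 0 < b.2) (hκ : ContinuousAt (fderiv ℝ κ) b) :
    ContinuousAt (oddExtensionDeriv κ θ) b := by
  refine hκ.congr ?_
  filter_upwards [continuous_snd.continuousAt.eventually (lt_mem_nhds hb)] with c hc
  exact (oddExtensionDeriv_of_pos hc).symm

lemma continuousAt_oddExtensionDeriv_of_neg (hb : b.2 < 0)
    (hκ : ContinuousAt (fderiv ℝ κ) (flipLast G b)) :
    ContinuousAt (oddExtensionDeriv κ θ) b := by
  have hpos : ContinuousAt (oddExtensionDeriv κ θ) (flipLast G b) :=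
    continuousAt_oddExtensionDeriv_of_pos (by simpa using hb) hκ
  rw [funext oddExtensionDeriv_eq_neg_comp_flipLast]
  exact ((hpos.comp (flipLast G).continuous.continuousAt).clm_comp continuousAt_const).neg

lemma continuousAt_oddExtensionDeriv_zero
    (hlim : ∀ᶠ a in 𝓝 u, Tendsto (fderiv ℝ κ) (𝓝 a ×ˢ 𝓝[>] 0) (𝓝 (lastMap G (θ a)))) :
    ContinuousAt (oddExtensionDeriv κ θ) (u, 0) := by
  have hpos : Tendsto (oddExtensionDeriv κ θ) (𝓝 u ×ˢ 𝓝[>] 0) (𝓝 (lastMap G (θ u))) := by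
    refine hlim.self_of_nhds.congr' ?_
    filter_upwards [tendsto_snd.eventually self_mem_nhdsWithin] with b hb
    exact (oddExtensionDeriv_of_pos hb).symm
  have hneg : Tendsto (fun b => oddExtensionDeriv κ θ (flipLast G b)) (𝓝 u ×ˢ 𝓝[>] 0)
      (𝓝 (lastMap G (θ u))) := by
    rw [← neg_lastMap_comp_flipLast]
    simp only [oddExtensionDeriv_eq_neg_comp_flipLast (flipLast G _), flipLast_flipLast]
    exact ((continuous_id.clm_comp continuous_const).neg.tendsto (lastMap G (θ u))).comp hpos
  have hzero : Tendsto (fun a => lastMap G (θ a)) (𝓝 u) (𝓝 (lastMap G (θ u))) :=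
    tendsto_of_tendsto_slice hlim.self_of_nhds <| hlim.mono fun a ha =>
      ha.comp (tendsto_const_nhds.prodMk tendsto_id)
  rw [ContinuousAt, oddExtensionDeriv_zero]
  intro O hO
  exact eventually_nhds_prod_zero (hpos.eventually hO) (hneg.eventually hO)
    ((hzero.eventually hO).mono fun a ha => by rw [oddExtensionDeriv_zero]; exact ha)

lemma contDiffAt_oddExtension (hδ : 0 < δ) (hκ : ContDiffOn ℝ 1 κ (ball 0 δ ×ˢ Ioo 0 δ))
    (hval : ∀ u ∈ ball (0 : G) δ,
      Tendsto (fun b : G × ℝ => b.2⁻¹ • κ b) (𝓝 u ×ˢ 𝓝[>] 0) (𝓝 (θ u)))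
    (hderiv : ∀ u ∈ ball (0 : G) δ,
      Tendsto (fderiv ℝ κ) (𝓝 u ×ˢ 𝓝[>] 0) (𝓝 (lastMap G (θ u)))) :
    ContDiffAt ℝ 1 (oddExtension κ) (0, 0) := by
  have hsmooth : ∀ b ∈ ball (0 : G) δ ×ˢ Ioo (0 : ℝ) δ, ContDiffAt ℝ 1 κ b := fun b hb =>
    hκ.contDiffAt ((Metric.isOpen_ball.prod isOpen_Ioo).mem_nhds hb)
  have hflip : ∀ b ∈ ball (0 : G) δ ×ˢ Ioo (-δ) δ, b.2 < 0 → ContDiffAt ℝ 1 κ (flipLast G b) :=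
    fun b hb hneg => hsmooth _ ⟨hb.1, neg_pos.2 hneg, neg_lt.1 hb.2.1⟩
  refine contDiffAt_one_iff.2 ⟨oddExtensionDeriv κ θ, ball (0 : G) δ ×ˢ Ioo (-δ) δ,
    (Metric.isOpen_ball.prod isOpen_Ioo).mem_nhds ⟨by simpa, by simpa, hδ⟩, fun b hb => ?_,
    fun b hb => ?_⟩
  · refine ContinuousAt.continuousWithinAt ?_
    rcases lt_trichotomy b.2 0 with hneg | hzero | hpos
    · exact continuousAt_oddExtensionDeriv_of_neg hneg
        ((hflip b hb hneg).continuousAt_fderiv one_ne_zero)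
    · rw [show b = (b.1, 0) from Prod.ext rfl hzero]
      exact continuousAt_oddExtensionDeriv_zero
        ((Metric.isOpen_ball.eventually_mem hb.1).mono hderiv)
    · exact continuousAt_oddExtensionDeriv_of_pos hpos
        ((hsmooth b ⟨hb.1, hpos, hb.2.2⟩).continuousAt_fderiv one_ne_zero)
  · rcases lt_trichotomy b.2 0 with hneg | hzero | hpos
    · exact hasFDerivAt_oddExtension_of_neg hneg
        ((hflip b hb hneg).differentiableAt one_ne_zero)
    · rw [show b = (b.1, 0) from Prod.ext rfl hzero]
      exact hasFDerivAt_oddExtension_zero (hval b.1 hb.1)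
    · exact hasFDerivAt_oddExtension_of_pos hpos
        ((hsmooth b ⟨hb.1, hpos, hb.2.2⟩).differentiableAt one_ne_zero)

end OddExtension

section Straightening

lemma exists_openPartialHomeomorph_extending {E Z W : Type*} [NormedAddCommGroup E]
    [NormedSpace ℝ E] [FiniteDimensional ℝ E] [NormedAddCommGroup Z] [NormedSpace ℝ Z]
    [FiniteDimensional ℝ Z] [NormedAddCommGroup W] [NormedSpace ℝ W] [FiniteDimensional ℝ W]
    (hdim : Module.finrank ℝ Z + Module.finrank ℝ W = Module.finrank ℝ E) {σ : Z → E} {z : Z}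
    (hσ : ContDiffAt ℝ 1 σ z) (hinj : Function.Injective (fderiv ℝ σ z)) :
    ∃ e : OpenPartialHomeomorph (Z × W) E, (z, 0) ∈ e.source ∧ (∀ a, e (a, 0) = σ a) ∧
      ContDiffOn ℝ 1 e e.source ∧ ContDiffOn ℝ 1 e.symm e.target := by
  obtain ⟨S, hS⟩ := Submodule.exists_isCompl (fderiv ℝ σ z).range
  have hWS : Module.finrank ℝ W = Module.finrank ℝ S := by
    have hsum := Submodule.finrank_add_eq_of_isCompl hS
    rw [LinearMap.finrank_range_of_inj hinj] at hsum
    omega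
  let L := LinearEquiv.ofFinrankEq W S hWS
  let Λ : W →L[ℝ] E := LinearMap.toContinuousLinearMap (S.subtype ∘ₗ L.toLinearMap)
  let h : Z × W → E := fun b => σ b.1 + Λ b.2
  have hh : ContDiffAt ℝ 1 h (z, 0) :=
    (hσ.comp (z, (0 : W)) contDiffAt_fst).add (Λ.contDiff.contDiffAt.comp _ contDiffAt_snd)
  have hh' : HasFDerivAt h ((fderiv ℝ σ z).coprod Λ) (z, 0) := by
    have hd : HasFDerivAt σ (fderiv ℝ σ z) z := (hσ.differentiableAt one_ne_zero).hasFDerivAt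
    exact (hd.comp (z, (0 : W)) hasFDerivAt_fst).add
      (Λ.hasFDerivAt.comp (z, (0 : W)) hasFDerivAt_snd)
  have hh_inj : Function.Injective (fderiv ℝ h (z, 0)) := by
    rw [hh'.fderiv]
    refine (injective_iff_map_eq_zero _).2 fun b hb => ?_
    have hmem : Λ b.2 ∈ (fderiv ℝ σ z).range :=
      ⟨-b.1, by rw [map_neg]; exact neg_eq_of_add_eq_zero_right hb⟩
    have hΛ : Λ b.2 = 0 := Submodule.disjoint_def.1 hS.disjoint _ hmem (L b.2).2
    have hsnd : b.2 = 0 := L.map_eq_zero_iff.1 (Subtype.ext hΛ)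
    have hfst : b.1 = 0 := (injective_iff_map_eq_zero _).1 hinj _ (by simpa [hΛ] using hb)
    exact Prod.ext hfst hsnd
  obtain ⟨e, hze, he, he1, he2⟩ :=
    exists_openPartialHomeomorph_of_injective_fderiv (by simpa using hdim) hh hh_inj
  exact ⟨e, hze, fun a => by simp [he, h], he1, he2⟩

variable {n k : ℕ} {M : Set (RSpace n)}

/-- The first `k + 1` coordinates of `ℝ^n`, as an element of `ℝ^k × ℝ`. -/
noncomputable def splitCoords (n k : ℕ) (h : k + 1 ≤ n) : RSpace n →L[ℝ] RSpace k × ℝ :=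
  ((EuclideanSpace.equiv (Fin k) ℝ).symm.toContinuousLinearMap ∘L
    .pi fun i => EuclideanSpace.proj (Fin.castLE (by omega) i)).prod
    (EuclideanSpace.proj (⟨k, h⟩ : Fin n))

lemma mem_halfModel_iff (h : k + 1 ≤ n) {w : RSpace n} :
    w ∈ halfModel n (k + 1) ↔ lastCoords n (k + 1) w = 0 ∧ 0 ≤ (splitCoords n k h w).2 := by
  refine and_congr mem_linearModel_iff ⟨fun hw => hw ⟨k, h⟩ rfl, fun hw i hi => ?_⟩
  rwa [show i = ⟨k, h⟩ from Fin.ext (by simpa using hi)]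

lemma exists_equiv_mem_halfModel_iff (h : k + 1 ≤ n) :
    ∃ A : RSpace n ≃L[ℝ] (RSpace k × ℝ) × ({i : Fin n // k + 1 ≤ (i : ℕ)} → ℝ),
      ∀ w, w ∈ halfModel n (k + 1) ↔ (A w).2 = 0 ∧ 0 ≤ (A w).1.2 := by
  have hdim : Module.finrank ℝ (RSpace n) =
      Module.finrank ℝ ((RSpace k × ℝ) × ({i : Fin n // k + 1 ≤ (i : ℕ)} → ℝ)) := by
    simp only [Module.finrank_prod, finrank_euclideanSpace_fin, Module.finrank_self,
      Module.finrank_pi, card_subtype_le_val]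
    omega
  have hinj : Function.Injective ((splitCoords n k h).prod (lastCoords n (k + 1))) := by
    refine (injective_iff_map_eq_zero _).2 fun w hw => ?_
    have hsplit : splitCoords n k h w = 0 := congrArg Prod.fst hw
    have hlast : lastCoords n (k + 1) w = 0 := congrArg Prod.snd hw
    ext i
    rcases lt_trichotomy (i : ℕ) k with hi | hi | hi
    · exact congrArg (fun z : RSpace k × ℝ => z.1 ⟨i, hi⟩) hsplit
    · rw [show i = ⟨k, h⟩ from Fin.ext hi]
      exact congrArg Prod.snd hsplit
    · exact congrFun hlast ⟨i, hi⟩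
  obtain ⟨A, hA⟩ := exists_continuousLinearEquiv_coe_eq hdim hinj
  refine ⟨A, fun w => ?_⟩
  rw [← A.coe_coe, hA]
  exact mem_halfModel_iff h

lemma mem_iff_of_extending {E Z W : Type*} [TopologicalSpace E] [TopologicalSpace Z]
    [TopologicalSpace W] [Zero W] {e : OpenPartialHomeomorph (Z × W) E} {σ : Z → E} {S : Set Z}
    {M : Set E} (he : ∀ a, e (a, 0) = σ a) {y : E} (hy : y ∈ e.target)
    (hσM : (e.symm y).1 ∈ S → σ (e.symm y).1 ∈ M) {a : Z} (ha : (a, 0) ∈ e.source)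
    (haM : y ∈ M → a ∈ S ∧ σ a = y) : y ∈ M ↔ (e.symm y).2 = 0 ∧ (e.symm y).1 ∈ S := by
  constructor
  · intro hyM
    obtain ⟨haS, hσa⟩ := haM hyM
    have hsymm : e.symm y = (a, 0) := by rw [← e.left_inv ha, he, hσa]
    simpa [hsymm] using haS
  · rintro ⟨hzero, hS⟩
    have hσy : σ (e.symm y).1 = y := by rw [← he, ← hzero, e.right_inv hy]
    exact hσy ▸ hσM hS

lemma exists_isStraightening_halfModel (hkn : k + 1 ≤ n) {σ : RSpace k × ℝ → RSpace n}
    (hσ : ContDiffAt ℝ 1 σ 0) (hσ0 : σ 0 = 0) (hinj : Function.Injective (fderiv ℝ σ 0))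
    (hσM : ∀ᶠ b in 𝓝 (0 : RSpace k × ℝ), 0 ≤ b.2 → σ b ∈ M)
    {F : RSpace n → RSpace k × ℝ} {N : Set (RSpace n)} (hN : IsOpen N) (h0N : 0 ∈ N)
    (hF : ContinuousOn F N) (hF0 : F 0 = 0)
    (hFM : ∀ y ∈ N, y ∈ M → 0 ≤ (F y).2 ∧ σ (F y) = y) :
    ∃ Φ : OpenPartialHomeomorph (RSpace n) (RSpace n), (0 : RSpace n) ∈ Φ.source ∧
      Φ.source ⊆ N ∧ ∀ y ∈ Φ.source, IsStraightening 1 M (halfModel n (k + 1)) y Φ := by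
  obtain ⟨A, hA⟩ := exists_equiv_mem_halfModel_iff hkn
  obtain ⟨e, h0e, heσ, he, he'⟩ := exists_openPartialHomeomorph_extending
    (W := {i : Fin n // k + 1 ≤ (i : ℕ)} → ℝ)
    (by simpa using A.toLinearEquiv.finrank_eq.symm) hσ hinj
  have he0 : e (0, 0) = 0 := (heσ 0).trans hσ0
  obtain ⟨B, hBM, hB, h0B⟩ := eventually_nhds_iff.1 hσM
  let O₁ := e.target ∩ e.symm ⁻¹' (Prod.fst ⁻¹' B)
  have hO₁ : IsOpen O₁ := e.isOpen_inter_preimage_symm (hB.preimage continuous_fst)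
  let O₂ := N ∩ (fun y => (F y, 0)) ⁻¹' e.source
  have hO₂ : IsOpen O₂ := (hF.prodMk continuousOn_const).isOpen_inter_preimage hN e.open_source
  have h0O : (0 : RSpace n) ∈ O₁ ∩ O₂ := by
    have h0t : (0 : RSpace n) ∈ e.target := he0 ▸ e.map_source h0e
    have hsymm : e.symm 0 = (0, 0) := by rw [← he0, e.left_inv h0e]
    exact ⟨⟨h0t, by simpa [hsymm] using h0B⟩, h0N, by simpa [hF0] using h0e⟩
  have hmem : ∀ y ∈ O₁ ∩ O₂, y ∈ M ↔ A.symm (e.symm y) ∈ halfModel n (k + 1) := by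
    rintro y ⟨⟨hye, hyB⟩, hyN, hyF⟩
    rw [hA, A.apply_symm_apply]
    exact mem_iff_of_extending (S := {b : RSpace k × ℝ | 0 ≤ b.2}) heσ hye (hBM _ hyB) hyF
      (hFM y hyN)
  refine ⟨(e.symm.transHomeomorph A.symm.toHomeomorph).restrOpen _ (hO₁.inter hO₂), ⟨h0O.1.1, h0O⟩,
    fun y hy => hy.2.2.1, fun y hy => ⟨hy, ?_, ?_, fun y hy => hmem y hy.2⟩⟩
  · exact A.symm.contDiff.comp_contDiffOn (he'.mono fun y hy => hy.1)
  · exact he.comp A.contDiff.contDiffOn fun w hw => hw.1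

end Straightening

section Straighten

variable {n k : ℕ} {X Y : Set (RSpace n)} {P : RSpace n →L[ℝ] RSpace k} {g : RSpace k → RSpace n}
  {δ : ℝ} {s : RSpace k × ℝ → RSpace n} {u : RSpace k} {y : RSpace n}

/-- The parametrization of a collar extended across the boundary, oddly with respect to the section
`g`: `(u, -t) ↦ 2 g(u) - s(u, t)`. -/
noncomputable def collarExtension (g : RSpace k → RSpace n) (s : RSpace k × ℝ → RSpace n)
    (b : RSpace k × ℝ) : RSpace n :=
  g b.1 + oddExtension (fun b => s b - g b.1) b

lemma collarExtension_of_pos {b : RSpace k × ℝ} (hb : 0 < b.2) : collarExtension g s b = s b := by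
  rw [collarExtension, oddExtension_of_pos hb, add_sub_cancel]

lemma collarExtension_zero (u : RSpace k) : collarExtension g s (u, 0) = g u := by
  rw [collarExtension, oddExtension_zero, add_zero]

lemma continuous_lastMap {G E : Type*} [NormedAddCommGroup G] [NormedSpace ℝ G]
    [NormedAddCommGroup E] [NormedSpace ℝ E] : Continuous (lastMap G : E → G × ℝ →L[ℝ] E) :=
  (ContinuousLinearMap.toSpanSingletonCLE (𝕜 := ℝ) (E := E)).continuous.clm_comp continuous_const

lemma frameMap_eq (u : RSpace k) (θ : RSpace n) :
    frameMap g u θ = fderiv ℝ g u ∘L .fst ℝ (RSpace k) ℝ + lastMap (RSpace k) θ := rfl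

lemma IsTube.hasFDerivAt_comp_fst (h : IsTube X P g δ) {b : RSpace k × ℝ}
    (hb : b.1 ∈ ball (0 : RSpace k) δ) :
    HasFDerivAt (fun b : RSpace k × ℝ => g b.1) (fderiv ℝ g b.1 ∘L .fst ℝ (RSpace k) ℝ) b :=
  (h.hasStrictFDerivAt hb).hasFDerivAt.comp b hasFDerivAt_fst

namespace IsCollarParam

lemma eventually_mem_collarBase (hδ : 0 < δ) (hu : u ∈ ball (0 : RSpace k) δ) :
    ∀ᶠ b in 𝓝 u ×ˢ 𝓝[>] (0 : ℝ), b ∈ collarBase k δ :=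
  prod_mem_prod (Metric.isOpen_ball.mem_nhds hu) (Ioo_mem_nhdsGT hδ)

protected lemma tendsto (h : IsTube X P g δ) (hs : IsCollarParam P g δ Y s)
    (hu : u ∈ ball (0 : RSpace k) δ) : Tendsto s (𝓝 u ×ˢ 𝓝[>] 0) (𝓝[Y] (g u)) := by
  have hbase := eventually_mem_collarBase h.pos hu
  refine tendsto_nhdsWithin_iff.2 ⟨?_, hbase.mono fun b hb => (hs.mapsTo hb).1⟩
  have hsection : Tendsto (fun b : RSpace k × ℝ => g b.1) (𝓝 u ×ˢ 𝓝[>] 0) (𝓝 (g u)) :=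
    (h.contDiffAt hu).continuousAt.tendsto.comp tendsto_fst
  have hsnd : Tendsto (fun b : RSpace k × ℝ => b.2) (𝓝 u ×ˢ 𝓝[>] 0) (𝓝 0) :=
    tendsto_nhds_of_tendsto_nhdsWithin tendsto_snd
  have hnormal : Tendsto (fun b => s b - g b.1) (𝓝 u ×ˢ 𝓝[>] 0) (𝓝 0) :=
    tendsto_zero_iff_norm_tendsto_zero.2
      (hsnd.congr' (hbase.mono fun b hb => (hs.norm_sub hb).symm))
  simpa using hnormal.add hsection

lemma tendsto_inv_smul_sub (h : IsTube X P g δ) (hs : IsCollarParam P g δ Y s)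
    (hu : u ∈ ball (0 : RSpace k) δ) {θ : RSpace n}
    (hθ : Tendsto (collarDir P g) (𝓝[Y] (g u)) (𝓝 θ)) :
    Tendsto (fun b : RSpace k × ℝ => b.2⁻¹ • (s b - g b.1)) (𝓝 u ×ˢ 𝓝[>] 0) (𝓝 θ) :=
  (hθ.comp (hs.tendsto h hu)).congr'
    ((eventually_mem_collarBase h.pos hu).mono fun _ hb => hs.collarDir_eq hb)

lemma tendsto_fderiv_sub_frameMap (h : IsTube X P g δ) (hs : IsCollarParam P g δ Y s)
    (hY : IsSubmanifold 1 (k + 1) Y) (hXY : Disjoint X Y) (hb : WhitneyB X Y)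
    (hu : u ∈ ball (0 : RSpace k) δ) :
    Tendsto (fun b => fderiv ℝ s b - frameMap g b.1 (collarDir P g (s b)))
      (𝓝 u ×ˢ 𝓝[>] 0) (𝓝 0) := by
  obtain ⟨hα, hβ⟩ := hb _ (h.section_mem hu)
  refine Metric.nhds_basis_closedBall.tendsto_right_iff.2 fun η hη => ?_
  filter_upwards [(hs.tendsto h hu).eventually (h.eventually_frame hY hXY hu hα hβ hη),
    eventually_mem_collarBase h.pos hu] with b hframe hbB
  rw [mem_closedBall_zero_iff, ← hs.proj hbB]
  exact hframe.2 _ (hs.fderiv_mem_tangentVectors hbB) (hs.fderiv_collarMap_fderiv h hbB)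

lemma tendsto_fderiv_sub (h : IsTube X P g δ) (hs : IsCollarParam P g δ Y s)
    (hY : IsSubmanifold 1 (k + 1) Y) (hXY : Disjoint X Y) (hb : WhitneyB X Y)
    (hu : u ∈ ball (0 : RSpace k) δ) {θ : RSpace n}
    (hθ : Tendsto (collarDir P g) (𝓝[Y] (g u)) (𝓝 θ)) :
    Tendsto (fderiv ℝ fun b => s b - g b.1) (𝓝 u ×ˢ 𝓝[>] 0) (𝓝 (lastMap (RSpace k) θ)) := by
  have hlast := (continuous_lastMap (G := RSpace k)).continuousAt.tendsto.comp
    (hθ.comp (hs.tendsto h hu))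
  have hsum := (hs.tendsto_fderiv_sub_frameMap h hY hXY hb hu).add hlast
  rw [zero_add] at hsum
  refine hsum.congr' ?_
  filter_upwards [eventually_mem_collarBase h.pos hu] with b hbB
  rw [((hs.hasFDerivAt hbB).fun_sub (h.hasFDerivAt_comp_fst hbB.1)).fderiv, frameMap_eq,
    ← sub_sub, Function.comp_apply, Function.comp_apply, sub_add_cancel]

lemma exists_tendsto_slice {L : FirstOrder.Language.{u, v}} [L.Structure ℝ]
    (hL : IsOMinimalExpansionOfRealField L) (hYdef : IsDefinableSet L Y) (h : IsTube X P g δ)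
    (hs : IsCollarParam P g δ Y s) (hu : u ∈ ball (0 : RSpace k) δ) :
    ∃ θ, Tendsto (fun r => r⁻¹ • (s (u, r) - g u)) (𝓝[>] 0) (𝓝 θ) := by
  refine hL.exists_tendsto_slice hYdef P (g u) u (s := fun r => s (u, r)) h.pos
    fun r hr hrδ y => ⟨?_, ?_⟩
  · rintro ⟨hyY, hyu, hyr⟩
    have hy : collarMap P g y = (u, r) := Prod.ext hyu (by rw [← hyr, ← hyu]; rfl)
    have hyt : y ∈ tubeSet P g δ := mem_tubeSet_of_collarMap (by rw [hy]; exact ⟨hu, hr, hrδ⟩)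
    rw [← hy, hs.invOn.1 ⟨hyY, hyt⟩]
  · rintro rfl
    have hb : (u, r) ∈ collarBase k δ := ⟨hu, hr, hrδ⟩
    exact ⟨(hs.mapsTo hb).1, hs.proj hb, hs.norm_sub hb⟩

variable {θ : RSpace k → RSpace n}

lemma contDiffAt_collarExtension (h : IsTube X P g δ) (hs : IsCollarParam P g δ Y s)
    (hY : IsSubmanifold 1 (k + 1) Y) (hXY : Disjoint X Y) (hb : WhitneyB X Y)
    (hθ : ∀ u ∈ ball (0 : RSpace k) δ, Tendsto (collarDir P g) (𝓝[Y] (g u)) (𝓝 (θ u))) :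
    ContDiffAt ℝ 1 (collarExtension g s) 0 := by
  refine ContDiffAt.add (ContDiffAt.comp (g := g) (f := Prod.fst) (0 : RSpace k × ℝ)
    (h.contDiffAt h.zero_mem_ball) contDiffAt_fst) (contDiffAt_oddExtension h.pos ?_
      (fun u hu => hs.tendsto_inv_smul_sub h hu (hθ u hu))
      fun u hu => hs.tendsto_fderiv_sub h hY hXY hb hu (hθ u hu))
  exact hs.contDiffOn.sub (h.smooth.comp contDiff_fst.contDiffOn fun b hb => hb.1)

lemma fderiv_collarExtension_zero (h : IsTube X P g δ) (hs : IsCollarParam P g δ Y s)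
    {θ : RSpace n} (hθ : Tendsto (collarDir P g) (𝓝[Y] (g 0)) (𝓝 θ)) :
    fderiv ℝ (collarExtension g s) 0 = frameMap g 0 θ := by
  have hodd : HasFDerivAt (oddExtension fun b => s b - g b.1) (lastMap (RSpace k) θ) 0 := by
    rw [← oddExtensionDeriv_zero (θ := fun _ => θ) 0]
    exact hasFDerivAt_oddExtension_zero (hs.tendsto_inv_smul_sub h h.zero_mem_ball hθ)
  exact ((h.hasFDerivAt_comp_fst (b := 0) h.zero_mem_ball).add hodd).fderiv

end IsCollarParam

namespace IsTube

lemma injective_frameMap (h : IsTube X P g δ) (hu : u ∈ ball (0 : RSpace k) δ) {θ : RSpace n}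
    (hPθ : P θ = 0) (hθ : θ ≠ 0) : Function.Injective (frameMap g u θ) := by
  refine (injective_iff_map_eq_zero _).2 fun z hz => ?_
  rw [frameMap_apply] at hz
  have hfst : z.1 = 0 := by
    simpa [h.proj_fderiv hu, hPθ] using congrArg P hz
  rw [hfst, map_zero, zero_add] at hz
  exact Prod.ext hfst ((smul_eq_zero.1 hz).resolve_right hθ)

lemma collarExtension_collarMap (h : IsTube X P g δ) (hXY : Disjoint X Y)
    (hs : IsCollarParam P g δ Y s) (hyt : y ∈ tubeSet P g δ) (hy : y ∈ Y ∪ X) :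
    collarExtension g s (collarMap P g y) = y := by
  rcases hy with hy | hy
  · rw [collarExtension_of_pos (h.collarMap_mem hyt (hXY.notMem_of_mem_right hy)).2.1]
    exact hs.invOn.1 ⟨hy, hyt⟩
  · have hgy : g (P y) = y := ((h.mem_iff y hyt).1 hy).symm
    have hcollar : collarMap P g y = (P y, 0) :=
      Prod.ext rfl (by change ‖y - g (P y)‖ = 0; rw [hgy, sub_self, norm_zero])
    rw [hcollar, collarExtension_zero, hgy]

lemma collarExtension_mem (h : IsTube X P g δ) (hs : IsCollarParam P g δ Y s)
    {b : RSpace k × ℝ} (hb : b.1 ∈ ball (0 : RSpace k) δ) (hb0 : 0 ≤ b.2) (hbδ : b.2 < δ) :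
    collarExtension g s b ∈ Y ∪ X := by
  obtain ⟨u, t⟩ := b
  rcases hb0.eq_or_lt with rfl | ht
  · rw [collarExtension_zero]
    exact Or.inr (h.section_mem hb)
  · rw [collarExtension_of_pos ht]
    exact Or.inl (hs.mapsTo ⟨hb, ht, hbδ⟩).1

theorem exists_isStraightening (h : IsTube X P g δ) (hs : IsCollarParam P g δ Y s)
    (hY : IsSubmanifold 1 (k + 1) Y) (hXY : Disjoint X Y) (hcl : X ⊆ closure Y)
    (hb : WhitneyB X Y)
    (hlim : ∀ u ∈ ball (0 : RSpace k) δ, ∃ θ, Tendsto (collarDir P g) (𝓝[Y] (g u)) (𝓝 θ)) :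
    ∃ Φ : OpenPartialHomeomorph (RSpace n) (RSpace n), (0 : RSpace n) ∈ Φ.source ∧
      Φ.source ⊆ tubeSet P g δ ∧
      ∀ y ∈ Φ.source, IsStraightening 1 (Y ∪ X) (halfModel n (k + 1)) y Φ := by
  choose! θ hθ using hlim
  have h0 := h.zero_mem_ball
  have : (𝓝[Y] (g 0)).NeBot := mem_closure_iff_nhdsWithin_neBot.1 (hcl (h.section_mem h0))
  have hPθ : P (θ 0) = 0 := h.proj_eq_zero_of_tendsto_collarDir h0 nhdsWithin_le_nhds (hθ 0 h0)
  have hθ0 : θ 0 ≠ 0 :=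
    norm_ne_zero_iff.1 (h.norm_eq_one_of_tendsto_collarDir hXY h0 le_rfl (hθ 0 h0) ▸ one_ne_zero)
  refine exists_isStraightening_halfModel hY.1 (hs.contDiffAt_collarExtension h hY hXY hb hθ)
    ((collarExtension_zero 0).trans h.zero) ?_ ?_ (F := collarMap P g) h.isOpen_tubeSet ?_
    (h.continuousOn_collarMap.mono fun y hy => proj_mem_ball_of_mem_tubeSet hy) ?_
    fun y hyt hy => ⟨norm_nonneg _, h.collarExtension_collarMap hXY hs hyt hy⟩
  · rw [hs.fderiv_collarExtension_zero h (hθ 0 h0)]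
    exact h.injective_frameMap h0 hPθ hθ0
  · filter_upwards [(Metric.isOpen_ball.prod isOpen_Iio).mem_nhds ⟨h0, h.pos⟩] with b hb hb0
      using h.collarExtension_mem hs hb.1 hb0 hb.2
  · exact h.zero ▸ h.section_mem_tubeSet h0
  · simp [collarMap, h.zero]

end IsTube

lemma exists_isTube_isCollarParam (hX : IsSubmanifold 1 k X) (hY : IsSubmanifold 1 (k + 1) Y)
    (hXY : Disjoint X Y) (hlc : IsLocallyClosed (X ∪ Y)) (h0 : (0 : RSpace n) ∈ X)
    (hconn : ∀ᶠ ε in 𝓝[>] 0, IsConnected (Y ∩ ball 0 ε)) (hb : WhitneyB X Y)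
    {N : Set (RSpace n)} (hN : N ∈ 𝓝 0) :
    ∃ (P : RSpace n →L[ℝ] RSpace k) (g : RSpace k → RSpace n) (δ : ℝ)
      (s : RSpace k × ℝ → RSpace n),
      IsTube X P g δ ∧ tubeSet P g δ ⊆ N ∧ IsCollarParam P g δ Y s := by
  obtain ⟨P, g, δ₀, htube₀⟩ := exists_isTube hX h0
  obtain ⟨V, C, hV, hC, hVC⟩ := hlc
  have h0V : (0 : RSpace n) ∈ V := (hVC.subset (Or.inl h0)).1
  have hu0 := htube₀.zero_mem_ball
  obtain ⟨hα, hβ⟩ := hb _ (htube₀.section_mem hu0)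
  have hframe := htube₀.eventually_frame hY hXY hu0 hα hβ one_pos
  rw [htube₀.zero, eventually_nhdsWithin_iff] at hframe
  obtain ⟨δ, hδ, hδ₀, hδN⟩ :=
    htube₀.exists_tubeSet_subset (inter_mem (inter_mem hframe hN) (hV.mem_nhds h0V))
  have htube := htube₀.mono hδ hδ₀
  have hinj : ∀ y ∈ Y ∩ tubeSet P g δ, ∀ v ∈ tangentVectors Y y,
      fderiv ℝ (collarMap P g) y v = 0 → v = 0 := fun y hy => ((hδN hy.2).1.1 hy.1).1
  have hCS : ∀ y ∈ tubeSet P g δ, y ∈ C ↔ y ∈ X ∪ Y := fun y hy => by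
    rw [hVC]
    exact (and_iff_right (hδN hy).2).symm
  have hsmall : ∀ᶠ ε in 𝓝[>] (0 : ℝ), ball (0 : RSpace n) ε ⊆ tubeSet P g δ := by
    obtain ⟨ε, hε, hεt⟩ :=
      Metric.mem_nhds_iff.1 (htube.zero ▸ htube.tubeSet_mem_nhds htube.zero_mem_ball)
    filter_upwards [Ioo_mem_nhdsGT hε] with r hr using (Metric.ball_subset_ball hr.2.le).trans hεt
  obtain ⟨ε, hε, hεt, hεconn⟩ :=
    (eventually_mem_nhdsWithin.and (hsmall.and hconn)).exists
  obtain ⟨s, hs⟩ := htube.exists_isCollarParam hY hXY hinj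
    (htube.bijOn_collarMap hY hXY hC hCS hinj hε hεt hεconn)
  exact ⟨P, g, δ, s, htube, fun y hy => (hδN hy).1.2, hs⟩

theorem exists_isSubmanifoldWithBoundary
    {L : FirstOrder.Language.{u, v}} [L.Structure ℝ] (hL : IsOMinimalExpansionOfRealField L)
    (hYdef : IsDefinableSet L Y) (hX : IsSubmanifold 1 k X) (hY : IsSubmanifold 1 (k + 1) Y)
    (hXY : Disjoint X Y) (hcl : X ⊆ closure Y) (hlc : IsLocallyClosed (X ∪ Y))
    (h0 : (0 : RSpace n) ∈ X) (hconn : ∀ᶠ ε in 𝓝[>] 0, IsConnected (Y ∩ ball 0 ε))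
    {U : Set (RSpace n)} (hU : IsOpen U) (h0U : 0 ∈ U) (hb : WhitneyB (X ∩ U) (Y ∩ U))
    (hnpf : NormallyPseudoFlat (X ∩ U) ((Y ∪ X) ∩ U)) :
    ∃ U' : Set (RSpace n), IsOpen U' ∧ 0 ∈ U' ∧
      IsSubmanifoldWithBoundary 1 (k + 1) ((Y ∪ X) ∩ U') := by
  have hYU := hY.inter_isOpen hU
  have hXYU : Disjoint (X ∩ U) (Y ∩ U) := hXY.mono inter_subset_left inter_subset_left
  have hclU : X ∩ U ⊆ closure (Y ∩ U) := fun x hx =>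
    inter_comm U Y ▸ hU.inter_closure ⟨hx.2, hcl hx.1⟩
  have hlcU : IsLocallyClosed (X ∩ U ∪ Y ∩ U) :=
    union_inter_distrib_right X Y U ▸ hlc.inter hU.isLocallyClosed
  have hconnU : ∀ᶠ ε in 𝓝[>] 0, IsConnected (Y ∩ U ∩ ball 0 ε) := by
    obtain ⟨r, hr, hrU⟩ := Metric.isOpen_iff.1 hU 0 h0U
    filter_upwards [hconn, Ioo_mem_nhdsGT hr] with ε hε hεr
    rwa [inter_assoc, inter_eq_right.2 ((Metric.ball_subset_ball hεr.2.le).trans hrU)]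
  obtain ⟨P, g, δ, s, htube, htU, hs⟩ := exists_isTube_isCollarParam (hX.inter_isOpen hU) hYU hXYU
    hlcU ⟨h0, h0U⟩ hconnU hb (hU.mem_nhds h0U)
  have hsY : IsCollarParam P g δ Y s := by
    have hYt : Y ∩ U ∩ tubeSet P g δ = Y ∩ tubeSet P g δ := by
      rw [inter_assoc, inter_eq_right.2 htU]
    exact ⟨hs.contDiffOn, hYt ▸ hs.mapsTo, hYt ▸ hs.invOn⟩
  have hlim : ∀ u ∈ ball (0 : RSpace k) δ, ∃ θ, Tendsto (collarDir P g) (𝓝[Y ∩ U] (g u)) (𝓝 θ) :=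
    fun u hu => htube.tendsto_collarDir_of_normallyPseudoFlat hXYU hclU
      (union_inter_distrib_right Y X U ▸ hnpf) (fun O hO hOδ hne =>
        htube.exists_tendsto_collarDir hXYU hs
          (fun u hu => hsY.exists_tendsto_slice hL hYdef htube hu) hO hOδ hne) hu
  obtain ⟨Φ, h0Φ, hΦt, hΦ⟩ := htube.exists_isStraightening hs hYU hXYU hclU hb hlim
  refine ⟨Φ.source, Φ.open_source, h0Φ, hY.1, fun p hp => ⟨Φ, ?_⟩⟩
  obtain ⟨hpΦ, hΦsmooth, hΦsymm, hmem⟩ := hΦ p hp.2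
  refine ⟨hpΦ, hΦsmooth, hΦsymm, fun q hq => ?_⟩
  rw [← hmem q hq, ← union_inter_distrib_right]
  exact and_congr_right fun _ => iff_of_true hq (htU (hΦt hq))

end Straighten

section HalfSpace

variable {G : Type*} [NormedAddCommGroup G] {Z : G × ℝ → ℝ}

lemma eventually_eq_zero_of_neg (hZ : ∀ᶠ b in 𝓝 (0 : G × ℝ), ContinuousAt Z b)
    (hneg : ∀ᶠ b in 𝓝 (0 : G × ℝ), b.2 < 0 → Z b < 0)
    (hnonneg : ∀ᶠ b in 𝓝 (0 : G × ℝ), b.2 = 0 → 0 ≤ Z b) :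
    ∀ᶠ b in 𝓝 (0 : G × ℝ), b.2 = 0 → Z b = 0 := by
  filter_upwards [hZ, hneg.eventually_nhds, hnonneg]
  rintro ⟨v, _⟩ hZv hneg hnonneg rfl
  have hbelow : Tendsto (fun t : ℝ => (v, t)) (𝓝[<] 0) (𝓝 (v, 0)) :=
    (tendsto_const_nhds.prodMk_nhds tendsto_id).mono_left nhdsWithin_le_nhds
  refine le_antisymm (le_of_tendsto (hZv.tendsto.comp hbelow) ?_) (hnonneg rfl)
  filter_upwards [hbelow.eventually hneg, self_mem_nhdsWithin] with t ht ht0 using (ht ht0).le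

variable [NormedSpace ℝ G]

lemma fderiv_prodMk_zero (hZ : DifferentiableAt ℝ Z 0)
    (hzero : ∀ᶠ b in 𝓝 (0 : G × ℝ), b.2 = 0 → Z b = 0) (v : G) : fderiv ℝ Z 0 (v, 0) = 0 := by
  have hline : HasDerivAt (fun t : ℝ => t • ((v, 0) : G × ℝ)) (v, 0) 0 := by
    simpa using (hasDerivAt_id (0 : ℝ)).smul_const ((v, 0) : G × ℝ)
  have hZd : HasFDerivAt Z (fderiv ℝ Z 0) ((0 : ℝ) • ((v, 0) : G × ℝ)) := by
    rw [zero_smul]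
    exact hZ.hasFDerivAt
  refine (hZd.comp_hasDerivAt 0 hline).unique
    ((hasDerivAt_const 0 (0 : ℝ)).congr_of_eventuallyEq ?_)
  have hlim : Tendsto (fun t : ℝ => t • ((v, 0) : G × ℝ)) (𝓝 0) (𝓝 0) := by
    simpa only [ContinuousAt, zero_smul] using hline.continuousAt
  filter_upwards [hlim.eventually hzero] with t ht
  exact ht (smul_zero t)

lemma fderiv_zero_one_pos (hZ : DifferentiableAt ℝ Z 0)
    (hneg : ∀ᶠ b in 𝓝 (0 : G × ℝ), b.2 < 0 → Z b < 0)
    (hzero : ∀ᶠ b in 𝓝 (0 : G × ℝ), b.2 = 0 → Z b = 0) (hd : fderiv ℝ Z 0 ≠ 0) :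
    0 < fderiv ℝ Z 0 (0, 1) := by
  have hline : HasDerivAt (fun t : ℝ => ((0 : G), t)) (0, 1) 0 :=
    (hasDerivAt_const 0 (0 : G)).prodMk (hasDerivAt_id 0)
  have hder : HasDerivAt (fun t : ℝ => Z (0, t)) (fderiv ℝ Z 0 (0, 1)) 0 :=
    HasFDerivAt.comp_hasDerivAt (l := Z) (0 : ℝ) hZ.hasFDerivAt hline
  have h00 : Z (0, 0) = 0 := hzero.self_of_nhds rfl
  have hnonneg : 0 ≤ fderiv ℝ Z 0 (0, 1) := by
    refine ge_of_tendsto ((hasDerivAt_iff_tendsto_slope.1 hder).mono_left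
      (nhdsWithin_mono 0 fun t (ht : t < 0) => ht.ne : 𝓝[<] (0 : ℝ) ≤ 𝓝[≠] 0)) ?_
    have hlim : Tendsto (fun t : ℝ => ((0 : G), t)) (𝓝[<] 0) (𝓝 0) :=
      hline.continuousAt.tendsto.mono_left nhdsWithin_le_nhds
    filter_upwards [hlim.eventually hneg, self_mem_nhdsWithin] with t ht ht0
    rw [slope_def_field, h00, sub_zero, sub_zero]
    exact div_nonneg_of_nonpos (ht ht0).le (le_of_lt ht0)
  refine hnonneg.lt_of_ne' fun h1 => hd (ContinuousLinearMap.ext fun b => ?_)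
  have hb : b = (b.1, 0) + b.2 • ((0 : G), (1 : ℝ)) := by simp
  rw [hb, map_add, map_smul, fderiv_prodMk_zero hZ hzero, h1]
  simp

lemma eventually_pos_of_neg (hZ : ContDiffAt ℝ 1 Z 0)
    (hneg : ∀ᶠ b in 𝓝 (0 : G × ℝ), b.2 < 0 → Z b < 0)
    (hzero : ∀ᶠ b in 𝓝 (0 : G × ℝ), b.2 = 0 → Z b = 0) (hd : fderiv ℝ Z 0 ≠ 0) :
    ∀ᶠ b in 𝓝 (0 : G × ℝ), 0 < b.2 → 0 < Z b := by
  set c := fderiv ℝ Z 0 (0, 1) with hc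
  have hcpos : 0 < c := fderiv_zero_one_pos (hZ.differentiableAt one_ne_zero) hneg hzero hd
  have hproj : Tendsto (fun b : G × ℝ => (b.1, (0 : ℝ))) (𝓝 0) (𝓝 0) :=
    Continuous.tendsto' (by fun_prop) _ _ rfl
  have hlim : Tendsto (fun b : G × ℝ => (b, (b.1, (0 : ℝ)))) (𝓝 0) (𝓝 (0, 0)) :=
    tendsto_id.prodMk_nhds hproj
  filter_upwards [((hZ.hasStrictFDerivAt one_ne_zero).isLittleO.comp_tendsto hlim).def
    (half_pos hcpos), hproj.eventually hzero] with b hb hb0 hpos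
  have hsub : b - (b.1, 0) = b.2 • ((0 : G), (1 : ℝ)) := by ext <;> simp
  have hnorm : ‖b.2 • ((0 : G), (1 : ℝ))‖ = b.2 := by
    simp [abs_of_pos hpos, hpos.le]
  simp only [Function.comp_apply, hb0, sub_zero, hsub, map_smul, ← hc, smul_eq_mul, hnorm] at hb
  have hlow := (abs_le.1 hb).1
  nlinarith

end HalfSpace

section Height

variable {n k : ℕ} {X Y M : Set (RSpace n)} {P : RSpace n →L[ℝ] RSpace k}
  {g : RSpace k → RSpace n} {δ : ℝ} {φ : RSpace n →L[ℝ] ℝ}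

/-- The coordinates given by a projection to `X` and a linear height over `X`. -/
def heightMap (P : RSpace n →L[ℝ] RSpace k) (g : RSpace k → RSpace n) (φ : RSpace n →L[ℝ] ℝ)
    (y : RSpace n) : RSpace k × ℝ :=
  (P y, φ (y - g (P y)))

/-- Near `0`, the map `s` is the `C^1` parametrization of `M` by its height coordinates. -/
structure IsHeightParam (M : Set (RSpace n)) (P : RSpace n →L[ℝ] RSpace k)
    (g : RSpace k → RSpace n) (φ : RSpace n →L[ℝ] ℝ) (s : RSpace k × ℝ → RSpace n) : Prop where
  zero : s 0 = 0
  contDiffAt : ContDiffAt ℝ 1 s 0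
  eventually_mem : ∀ᶠ b in 𝓝 0, s b ∈ M
  right_inv : ∀ᶠ b in 𝓝 0, heightMap P g φ (s b) = b
  left_inv : ∀ᶠ y in 𝓝 0, y ∈ M → s (heightMap P g φ y) = y

/-- `Y` is a collar of `X`: it is parametrized by `X` and the height `φ > 0` over `X`, by a map `s`
that is `C^1` up to `X`. -/
structure IsCollar (X Y : Set (RSpace n)) (P : RSpace n →L[ℝ] RSpace k) (g : RSpace k → RSpace n)
    (δ : ℝ) (φ : RSpace n →L[ℝ] ℝ) (s : RSpace k × ℝ → RSpace n) (B : Set (RSpace k × ℝ)) :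
    Prop where
  tube : IsTube X P g δ
  subset : X ⊆ tubeSet P g δ
  isOpen : IsOpen B
  smooth : ContDiffOn ℝ 1 s B
  section_zero : ∀ u ∈ ball (0 : RSpace k) δ, (u, 0) ∈ B ∧ s (u, 0) = g u
  mem : ∀ b ∈ B, 0 < b.2 → s b ∈ Y
  inv : ∀ y ∈ Y, 0 < (heightMap P g φ y).2 ∧ heightMap P g φ y ∈ B ∧ s (heightMap P g φ y) = y

lemma exists_functional_injOn_ker {E F : Type*} [NormedAddCommGroup E] [InnerProductSpace ℝ E]
    [FiniteDimensional ℝ E] [NormedAddCommGroup F] [NormedSpace ℝ F] {S : Submodule ℝ E}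
    (hS : Module.finrank ℝ S = Module.finrank ℝ F + 1) {P : E →L[ℝ] F}
    (hP : ∀ w, ∃ v ∈ S, P v = w) :
    ∃ φ : E →L[ℝ] ℝ, ∀ v ∈ S, P v = 0 → φ v = 0 → v = 0 := by
  let T : S →ₗ[ℝ] F := P.toLinearMap.domRestrict S
  have hT : Function.Surjective T := fun w =>
    let ⟨v, hv, hw⟩ := hP w
    ⟨⟨v, hv⟩, hw⟩
  have hker : Module.finrank ℝ T.ker = 1 := by
    have hrank := T.finrank_range_add_finrank_ker
    rw [LinearMap.range_eq_top.2 hT, finrank_top, hS] at hrank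
    omega
  obtain ⟨e, -, he⟩ := finrank_eq_one_iff'.1 hker
  refine ⟨innerSL ℝ ((e : S) : E), fun v hv hPv hφ => ?_⟩
  obtain ⟨c, hc⟩ := he ⟨⟨v, hv⟩, hPv⟩
  obtain rfl : c • ((e : S) : E) = v := congrArg (fun z : T.ker => ((z : S) : E)) hc
  rw [innerSL_apply_apply, inner_smul_right, real_inner_self_eq_norm_sq] at hφ
  rcases mul_eq_zero.1 hφ with hc0 | he0
  · rw [hc0, zero_smul]
  · rw [norm_eq_zero.1 (pow_eq_zero_iff two_ne_zero |>.1 he0), smul_zero]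

namespace IsTube

lemma zero_mem (h : IsTube X P g δ) : (0 : RSpace n) ∈ X :=
  h.zero ▸ h.section_mem h.zero_mem_ball

lemma tubeSet_mem_nhds_zero (h : IsTube X P g δ) : tubeSet P g δ ∈ 𝓝 (0 : RSpace n) :=
  h.zero ▸ h.tubeSet_mem_nhds h.zero_mem_ball

lemma tendsto_section_zero (h : IsTube X P g δ) : Tendsto g (𝓝 0) (𝓝 0) := by
  simpa only [ContinuousAt, h.zero] using (h.contDiffAt h.zero_mem_ball).continuousAt

lemma contDiffAt_heightMap (h : IsTube X P g δ) {y : RSpace n} (hy : y ∈ tubeSet P g δ) :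
    ContDiffAt ℝ 1 (heightMap P g φ) y :=
  P.contDiff.contDiffAt.prodMk (φ.contDiff.contDiffAt.comp y (h.contDiffAt_sub hy))

lemma heightMap_section (h : IsTube X P g δ) {u : RSpace k} (hu : u ∈ ball (0 : RSpace k) δ) :
    heightMap P g φ (g u) = (u, 0) := by
  simp [heightMap, h.proj u hu]

lemma heightMap_zero (h : IsTube X P g δ) : heightMap P g φ 0 = 0 := by
  simp [heightMap, h.zero]

lemma tendsto_heightMap_zero (h : IsTube X P g δ) : Tendsto (heightMap P g φ) (𝓝 0) (𝓝 0) := by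
  simpa only [ContinuousAt, h.heightMap_zero] using
    (h.contDiffAt_heightMap (mem_of_mem_nhds h.tubeSet_mem_nhds_zero)).continuousAt

lemma fderiv_heightMap (h : IsTube X P g δ) {y : RSpace n} (hy : y ∈ tubeSet P g δ)
    (v : RSpace n) :
    fderiv ℝ (heightMap P g φ) y v = (P v, φ (v - fderiv ℝ g (P y) (P v))) := by
  have hsec := (h.hasStrictFDerivAt (proj_mem_ball_of_mem_tubeSet hy)).hasFDerivAt.comp y
    P.hasFDerivAt
  have hd : HasFDerivAt (heightMap P g φ) _ y :=
    P.hasFDerivAt.prodMk (φ.hasFDerivAt.comp y ((hasFDerivAt_id y).sub hsec))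
  rw [hd.fderiv]
  simp

lemma exists_isHeightParam (h : IsTube X P g δ)
    {Φ : OpenPartialHomeomorph (RSpace n) (RSpace n)}
    (hΦ : IsStraightening 1 M (linearModel n (k + 1)) 0 Φ) (hkn : k + 1 ≤ n)
    (h0 : (0 : RSpace n) ∈ M) (hφ : ∀ v ∈ tangentVectors M 0, P v = 0 → φ v = 0 → v = 0) :
    ∃ s, IsHeightParam M P g φ s := by
  have h0t := mem_of_mem_nhds h.tubeSet_mem_nhds_zero
  have hinj : ∀ v ∈ tangentVectors M 0, fderiv ℝ (heightMap P g φ) 0 v = 0 → v = 0 := by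
    intro v hv hv0
    rw [h.fderiv_heightMap h0t, Prod.mk_eq_zero] at hv0
    refine hφ v hv hv0.1 ?_
    simpa [hv0.1] using hv0.2
  obtain ⟨O, O', s, hO, h0O, hO', hs, hfO, hsO, hinv⟩ :=
    hΦ.exists_local_param h0 hkn (G := RSpace k × ℝ) (by simp) (h.contDiffAt_heightMap h0t) hinj
  have hO'0 : O' ∈ 𝓝 (0 : RSpace k × ℝ) := hO'.mem_nhds (h.heightMap_zero ▸ hfO ⟨h0, h0O⟩)
  refine ⟨s, h.heightMap_zero ▸ hinv.1 ⟨h0, h0O⟩, hs.contDiffAt hO'0, ?_, ?_, ?_⟩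
  · filter_upwards [hO'0] with b hb using (hsO hb).1
  · filter_upwards [hO'0] with b hb using hinv.2 hb
  · filter_upwards [hO.mem_nhds h0O] with y hyO hyM using hinv.1 ⟨hyM, hyO⟩

lemma exists_height_pos (h : IsTube X P g δ)
    (hconn : ∀ᶠ ε in 𝓝[>] (0 : ℝ), IsConnected (Y ∩ ball 0 ε))
    (hφ : ∀ᶠ y in 𝓝 0, y ∈ Y → (heightMap P g φ y).2 ≠ 0) :
    ∃ φ', (φ' = φ ∨ φ' = -φ) ∧ ∀ᶠ y in 𝓝 0, y ∈ Y → 0 < (heightMap P g φ' y).2 := by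
  obtain ⟨ε₁, hε₁, hne⟩ := Metric.eventually_nhds_iff_ball.1 (hφ.and h.tubeSet_mem_nhds_zero)
  obtain ⟨ε, hεconn, hε, hεlt⟩ := (hconn.and (Ioo_mem_nhdsGT hε₁)).exists
  replace hne := fun y hy => hne y (Metric.ball_subset_ball hεlt.le hy)
  have hcont : ContinuousOn (fun y => (heightMap P g φ y).2) (Y ∩ ball 0 ε) := fun y hy =>
    (h.contDiffAt_heightMap (hne y hy.2).2).continuousAt.snd.continuousWithinAt
  by_cases hneg : ∃ y ∈ Y ∩ ball 0 ε, (heightMap P g φ y).2 < 0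
  · obtain ⟨y₀, hy₀, hneg⟩ := hneg
    refine ⟨-φ, Or.inr rfl, ?_⟩
    filter_upwards [Metric.ball_mem_nhds (0 : RSpace n) hε] with y hyε hy
    by_contra hle
    have hnonneg : 0 ≤ (heightMap P g φ y).2 := by simpa [heightMap] using hle
    obtain ⟨y', hy', hzero⟩ :=
      hεconn.isPreconnected.intermediate_value hy₀ ⟨hy, hyε⟩ hcont ⟨hneg.le, hnonneg⟩
    exact (hne y' hy'.2).1 hy'.1 hzero
  · push Not at hneg
    refine ⟨φ, Or.inl rfl, ?_⟩
    filter_upwards [Metric.ball_mem_nhds (0 : RSpace n) hε] with y hyε hy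
    exact (hneg y ⟨hy, hyε⟩).lt_of_ne' ((hne y hyε).1 hy)

end IsTube

namespace IsHeightParam

variable {s : RSpace k × ℝ → RSpace n} {F : RSpace n → ℝ}

lemma tendsto (hs : IsHeightParam M P g φ s) : Tendsto s (𝓝 0) (𝓝 0) := by
  simpa only [ContinuousAt, hs.zero] using hs.contDiffAt.continuousAt

lemma eventually_section_eq (hs : IsHeightParam M P g φ s) (h : IsTube X P g δ)
    (hXM : ∀ᶠ x in 𝓝 0, x ∈ X → x ∈ M) : ∀ᶠ u in 𝓝 0, s (u, 0) = g u := by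
  filter_upwards [h.tendsto_section_zero.eventually (hXM.and hs.left_inv),
    Metric.ball_mem_nhds 0 h.pos] with u ⟨hM, hinv⟩ hu
  rw [← h.heightMap_section (φ := φ) hu, hinv (hM (h.section_mem hu))]

lemma eventually_mem_of_heightMap_eq_zero (hs : IsHeightParam M P g φ s) (h : IsTube X P g δ)
    (hXM : ∀ᶠ x in 𝓝 0, x ∈ X → x ∈ M) :
    ∀ᶠ y in 𝓝 0, y ∈ M → (heightMap P g φ y).2 = 0 → y ∈ X := by
  have hP : Tendsto P (𝓝 0) (𝓝 0) := P.continuous.tendsto' 0 0 (map_zero P)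
  filter_upwards [hs.left_inv, hP.eventually (hs.eventually_section_eq h hXM),
    hP.eventually (Metric.ball_mem_nhds 0 h.pos)] with y hinv hsec hPy hyM hy0
  have hy : heightMap P g φ y = (P y, 0) := Prod.ext rfl hy0
  rw [← hinv hyM, hy, hsec]
  exact h.section_mem hPy

lemma eventually_comp_neg (hs : IsHeightParam M P g φ s) (h : IsTube X P g δ)
    (hF : ∀ᶠ q in 𝓝 0, q ∈ Y ∪ X ↔ q ∈ M ∧ 0 ≤ F q)
    (hpos : ∀ᶠ y in 𝓝 0, y ∈ Y → 0 < (heightMap P g φ y).2) :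
    ∀ᶠ b in 𝓝 0, b.2 < 0 → F (s b) < 0 := by
  filter_upwards [hs.eventually_mem, hs.right_inv, hs.tendsto.eventually hF,
    hs.tendsto.eventually hpos, hs.tendsto.eventually h.tubeSet_mem_nhds_zero]
    with b hM hinv hF hpos hb hb2
  by_contra! hle
  rcases hF.2 ⟨hM, hle⟩ with hY | hX
  · have hb2' := hpos hY
    rw [hinv] at hb2'
    exact hb2'.not_gt hb2
  · have hb0 : (heightMap P g φ (s b)).2 = 0 := by
      simp only [heightMap]
      rw [← (h.mem_iff _ hb).1 hX, sub_self, map_zero]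
    rw [hinv] at hb0
    exact hb2.ne hb0

lemma eventually_comp_nonneg (hs : IsHeightParam M P g φ s) (h : IsTube X P g δ)
    (hF : ∀ᶠ q in 𝓝 0, q ∈ Y ∪ X ↔ q ∈ M ∧ 0 ≤ F q) : ∀ᶠ b in 𝓝 0, b.2 = 0 → 0 ≤ F (s b) := by
  have hXM : ∀ᶠ x in 𝓝 0, x ∈ X → x ∈ M := hF.mono fun x hx hX => (hx.1 (Or.inr hX)).1
  have hfst : Tendsto Prod.fst (𝓝 (0 : RSpace k × ℝ)) (𝓝 0) := continuous_fst.tendsto _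
  filter_upwards [hs.tendsto.eventually hF, hfst.eventually (hs.eventually_section_eq h hXM),
    hfst.eventually (Metric.ball_mem_nhds 0 h.pos)]
  rintro ⟨u, _⟩ hFs hsec hu rfl
  exact (hFs.1 (Or.inr (hsec ▸ h.section_mem hu))).2

lemma fderiv_comp_ne_zero (hs : IsHeightParam M P g φ s) (h : IsTube X P g δ)
    (hF : DifferentiableAt ℝ F 0) {v : RSpace n} (hv : v ∈ tangentVectors M 0)
    (hFv : fderiv ℝ F 0 v ≠ 0) : fderiv ℝ (F ∘ s) 0 ≠ 0 := by
  intro hzero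
  obtain ⟨γ, hγ0, hγ, hγd⟩ := hv
  have hγlim : Tendsto γ (𝓝 0) (𝓝 0) := by simpa only [ContinuousAt, hγ0] using hγd.continuousAt
  have hheight : DifferentiableAt ℝ (heightMap P g φ) (γ 0) := by
    rw [hγ0]
    exact (h.contDiffAt_heightMap
      (mem_of_mem_nhds h.tubeSet_mem_nhds_zero)).differentiableAt one_ne_zero
  have hFs : HasFDerivAt (F ∘ s) (0 : RSpace k × ℝ →L[ℝ] ℝ) (heightMap P g φ (γ 0)) := by
    have hFs0 : DifferentiableAt ℝ F (s 0) := by rwa [hs.zero]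
    rw [hγ0, h.heightMap_zero, ← hzero]
    exact (hFs0.comp 0 (hs.contDiffAt.differentiableAt one_ne_zero)).hasFDerivAt
  have hconst : HasDerivAt (F ∘ γ) 0 0 := by
    refine (hFs.comp_hasDerivAt 0 (hheight.hasFDerivAt.comp_hasDerivAt 0 hγd)).congr_of_eventuallyEq
      ?_
    filter_upwards [hγ, hγlim.eventually hs.left_inv] with t hM hinv
    simp only [Function.comp_apply, hinv hM]
  refine hFv ((HasFDerivAt.comp_hasDerivAt (0 : ℝ) ?_ hγd).unique hconst)
  rw [hγ0]
  exact hF.hasFDerivAt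

end IsHeightParam

namespace IsTube

variable {s : RSpace k × ℝ → RSpace n}

lemma exists_isCollar_of_eventually (h : IsTube X P g δ) {N : Set (RSpace n)} (hN : N ∈ 𝓝 0)
    (hs : ContDiffAt ℝ 1 s 0) (hmem : ∀ᶠ b in 𝓝 0, 0 < b.2 → s b ∈ Y)
    (hsec : ∀ᶠ u in 𝓝 0, s (u, 0) = g u)
    (hinv : ∀ᶠ y in 𝓝 0, y ∈ Y → 0 < (heightMap P g φ y).2 ∧ s (heightMap P g φ y) = y) :
    ∃ δ' B, tubeSet P g δ' ⊆ N ∧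
      IsCollar (X ∩ tubeSet P g δ') (Y ∩ tubeSet P g δ') P g δ' φ s B := by
  obtain ⟨r, hr, hrb⟩ := Metric.eventually_nhds_iff_ball.1 ((hs.eventually (by simp)).and hmem)
  have hP : Tendsto P (𝓝 0) (𝓝 0) := P.continuous.tendsto' 0 0 (map_zero P)
  obtain ⟨δ', hδ', hδ'δ, hδ'N⟩ := h.exists_tubeSet_subset (inter_mem hN (inter_mem hinv
    (inter_mem (hP.eventually hsec)
      (h.tendsto_heightMap_zero (φ := φ) (Metric.ball_mem_nhds 0 hr)))))
  have hT := h.mono hδ' hδ'δ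
  have hsmooth : ContDiffOn ℝ 1 s (ball 0 r) := fun b hb => (hrb b hb).1.contDiffWithinAt
  have hgraph : ∀ u ∈ ball (0 : RSpace k) δ', (u, 0) ∈ ball (0 : RSpace k × ℝ) r ∧
      s (u, 0) = g u := by
    intro u hu
    obtain ⟨-, -, hsecu, hur⟩ := hδ'N (hT.section_mem_tubeSet hu)
    rw [mem_preimage, hT.heightMap_section hu] at hur
    exact ⟨hur, by simpa only [mem_ofPred_eq, hT.proj u hu] using hsecu⟩
  refine ⟨δ', ball 0 r ∩ s ⁻¹' tubeSet P g δ', fun q hq => (hδ'N hq).1,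
    hT.congr fun y hy => and_iff_left hy, inter_subset_right,
    hsmooth.continuousOn.isOpen_inter_preimage Metric.isOpen_ball hT.isOpen_tubeSet,
    hsmooth.mono inter_subset_left, fun u hu => ?_, fun b hb hb2 => ⟨(hrb b hb.1).2 hb2, hb.2⟩,
    fun y hy => ?_⟩
  · obtain ⟨hur, hsu⟩ := hgraph u hu
    refine ⟨⟨hur, ?_⟩, hsu⟩
    rw [mem_preimage, hsu]
    exact hT.section_mem_tubeSet hu
  · obtain ⟨-, hinvy, -, hyr⟩ := hδ'N hy.2
    obtain ⟨hpos, hsy⟩ := hinvy hy.1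
    refine ⟨hpos, ⟨hyr, ?_⟩, hsy⟩
    rw [mem_preimage, hsy]
    exact hy.2

lemma exists_isCollar_of_isHeightParam (h : IsTube X P g δ)
    (hs : IsHeightParam M P g φ s) {F : RSpace n → ℝ} (hFc : ContDiffAt ℝ 1 F 0)
    (hF : ∀ᶠ q in 𝓝 0, q ∈ Y ∪ X ↔ q ∈ M ∧ 0 ≤ F q) {v : RSpace n}
    (hv : v ∈ tangentVectors M 0) (hFv : fderiv ℝ F 0 v ≠ 0)
    (hpos : ∀ᶠ y in 𝓝 0, y ∈ Y → 0 < (heightMap P g φ y).2) {N : Set (RSpace n)}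
    (hN : N ∈ 𝓝 0) :
    ∃ δ' B, tubeSet P g δ' ⊆ N ∩ {x | x ∈ X → F x = 0} ∧
      IsCollar (X ∩ tubeSet P g δ') (Y ∩ tubeSet P g δ') P g δ' φ s B := by
  have hFs : ContDiffAt ℝ 1 (F ∘ s) 0 :=
    ContDiffAt.comp 0 (by rwa [hs.zero]) hs.contDiffAt
  have hXM : ∀ᶠ x in 𝓝 0, x ∈ X → x ∈ M := hF.mono fun x hx hX => (hx.1 (Or.inr hX)).1
  have hsec := hs.eventually_section_eq h hXM
  have hneg : ∀ᶠ b in 𝓝 0, b.2 < 0 → (F ∘ s) b < 0 := hs.eventually_comp_neg h hF hpos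
  have hzero : ∀ᶠ b in 𝓝 0, b.2 = 0 → (F ∘ s) b = 0 :=
    eventually_eq_zero_of_neg ((hFs.eventually (by simp)).mono fun b hb => hb.continuousAt) hneg
      (hs.eventually_comp_nonneg h hF)
  have hFpos := eventually_pos_of_neg hFs hneg hzero
    (hs.fderiv_comp_ne_zero h (hFc.differentiableAt one_ne_zero) hv hFv)
  have hP : Tendsto (fun x => (P x, (0 : ℝ))) (𝓝 0) (𝓝 0) :=
    Continuous.tendsto' (by fun_prop) _ _ (by simp)
  have hFX : ∀ᶠ x in 𝓝 0, x ∈ X → F x = 0 := by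
    filter_upwards [hP.eventually hzero, h.tubeSet_mem_nhds_zero,
      (continuous_fst.tendsto _).comp hP |>.eventually hsec] with x hx hxt hsx hX
    have hFx := hx rfl
    rwa [Function.comp_apply, show s (P x, 0) = g (P x) from hsx, ← (h.mem_iff x hxt).1 hX] at hFx
  refine h.exists_isCollar_of_eventually (inter_mem hN hFX) hs.contDiffAt ?_ hsec ?_
  · filter_upwards [hs.eventually_mem, hs.tendsto.eventually hF, hFpos,
      hs.tendsto.eventually hFX] with b hM hF hFpos hFX hb
    exact (hF.2 ⟨hM, (hFpos hb).le⟩).resolve_right fun hX => (hFpos hb).ne' (hFX hX)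
  · filter_upwards [hF, hpos, hs.left_inv] with y hy hpos hinv hyY
    exact ⟨hpos hyY, hinv (hy.1 (Or.inl hyY)).1⟩

end IsTube

lemma IsStraightening.exists_mem_tangentVectors_fderiv_ne_zero {d : ℕ} {p : RSpace n}
    {Φ : OpenPartialHomeomorph (RSpace n) (RSpace n)}
    (h : IsStraightening 1 M (linearModel n d) p Φ) (hp : p ∈ M) {i : Fin n} (hi : (i : ℕ) < d) :
    ∃ v ∈ tangentVectors M p, fderiv ℝ (fun q => Φ q i) p v ≠ 0 := by
  obtain ⟨B, hB, -⟩ := h.exists_hasFDerivAt_equiv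
  have hBi : HasFDerivAt (fun q => Φ q i)
      ((EuclideanSpace.proj (𝕜 := ℝ) i).comp (B : RSpace n →L[ℝ] RSpace n)) p :=
    (EuclideanSpace.proj (𝕜 := ℝ) i).hasFDerivAt.comp p hB
  refine ⟨B.symm (EuclideanSpace.single i 1), ?_, by simp [hBi.fderiv]⟩
  rw [h.mem_tangentVectors_iff hp, hB.fderiv]
  intro j hj
  have hji : j ≠ i := by
    rintro rfl
    omega
  simp [hji]

lemma mem_halfModel_succ_iff {i : Fin n} (hi : (i : ℕ) = k) {q : RSpace n} :
    q ∈ halfModel n (k + 1) ↔ q ∈ linearModel n (k + 1) ∧ 0 ≤ q i := by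
  refine ⟨fun hq => ⟨hq.1, hq.2 i (by omega)⟩, fun hq => ⟨hq.1, fun j hj => ?_⟩⟩
  obtain rfl : j = i := Fin.ext (by omega)
  exact hq.2

namespace IsTube

variable {Φ : OpenPartialHomeomorph (RSpace n) (RSpace n)}

lemma exists_height_functional (h : IsTube X P g δ)
    (hΦ : IsStraightening 1 M (linearModel n (k + 1)) 0 Φ) (hkn : k + 1 ≤ n)
    (hXM : ∀ᶠ x in 𝓝 0, x ∈ X → x ∈ M) :
    ∃ φ : RSpace n →L[ℝ] ℝ, ∀ v ∈ tangentVectors M 0, P v = 0 → φ v = 0 → v = 0 := by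
  obtain ⟨S, hS, hSd⟩ :=
    hΦ.exists_submodule_coe_eq_tangentVectors (hXM.self_of_nhds h.zero_mem) hkn
  have hSP : ∀ w, ∃ v ∈ S, P v = w := fun w => by
    refine ⟨fderiv ℝ g 0 w, ?_, h.proj_fderiv h.zero_mem_ball w⟩
    rw [← SetLike.mem_coe, hS]
    refine tangentVectors_subset_of_eventually hXM ?_
    rw [← h.zero, h.tangentVectors_eq h.zero_mem_ball]
    exact mem_range_self w
  simpa only [← hS, SetLike.mem_coe] using
    exists_functional_injOn_ker (by simpa using hSd) hSP

lemma exists_isCollar (h : IsTube X P g δ) (hXY : Disjoint X Y)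
    (hconn : ∀ᶠ ε in 𝓝[>] (0 : ℝ), IsConnected (Y ∩ ball 0 ε))
    (hΦ : IsStraightening 1 (Y ∪ X) (halfModel n (k + 1)) 0 Φ) {i : Fin n} (hi : (i : ℕ) = k) :
    ∃ δ' φ s B, tubeSet P g δ' ⊆ Φ.source ∩ {x | x ∈ X → Φ x i = 0} ∧
      IsCollar (X ∩ tubeSet P g δ') (Y ∩ tubeSet P g δ') P g δ' φ s B := by
  obtain ⟨h0Φ, hΦ₁, hΦ₂, hΦM⟩ := hΦ
  have hkn : k + 1 ≤ n := by have := i.2; omega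
  let M : Set (RSpace n) := {q | q ∈ Φ.source ∧ Φ q ∈ linearModel n (k + 1)}
  have hM : IsStraightening 1 M (linearModel n (k + 1)) 0 Φ :=
    ⟨h0Φ, hΦ₁, hΦ₂, fun q hq => and_iff_right hq⟩
  have hsource : Φ.source ∈ 𝓝 (0 : RSpace n) := Φ.open_source.mem_nhds h0Φ
  have hF : ∀ᶠ q in 𝓝 0, q ∈ Y ∪ X ↔ q ∈ M ∧ 0 ≤ Φ q i := by
    filter_upwards [hsource] with q hq
    rw [hΦM q hq, mem_halfModel_succ_iff hi]
    exact and_congr_left' (and_iff_right hq).symm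
  have hXM : ∀ᶠ x in 𝓝 0, x ∈ X → x ∈ M := hF.mono fun x hx hX => (hx.1 (Or.inr hX)).1
  have h0M := hXM.self_of_nhds h.zero_mem
  obtain ⟨φ₀, hφ₀⟩ := h.exists_height_functional hM hkn hXM
  obtain ⟨s₀, hs₀⟩ := h.exists_isHeightParam hM hkn h0M hφ₀
  obtain ⟨φ, hφφ₀, hpos⟩ := h.exists_height_pos (Y := Y) (φ := φ₀) hconn <| by
    filter_upwards [hs₀.eventually_mem_of_heightMap_eq_zero h hXM, hF] with y hyX hy hyY hy0
    exact hXY.le_bot ⟨hyX (hy.1 (Or.inl hyY)).1 hy0, hyY⟩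
  have hφ : ∀ v ∈ tangentVectors M 0, P v = 0 → φ v = 0 → v = 0 := by
    rcases hφφ₀ with rfl | rfl
    · exact hφ₀
    · simpa using hφ₀
  obtain ⟨s, hs⟩ := h.exists_isHeightParam hM hkn h0M hφ
  obtain ⟨v, hv, hFv⟩ := hM.exists_mem_tangentVectors_fderiv_ne_zero h0M (i := i) (by omega)
  have hFc : ContDiffAt ℝ 1 (fun q => Φ q i) 0 :=
    (EuclideanSpace.proj (𝕜 := ℝ) i).contDiff.contDiffAt.comp 0 (hΦ₁.contDiffAt hsource)
  obtain ⟨δ', B, hsub, hcollar⟩ :=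
    h.exists_isCollar_of_isHeightParam hs hFc hF hv hFv hpos hsource
  exact ⟨δ', φ, s, B, hsub, hcollar⟩

end IsTube

end Height

section Collar

variable {n k : ℕ} {X Y : Set (RSpace n)} {P : RSpace n →L[ℝ] RSpace k}
  {g : RSpace k → RSpace n} {δ : ℝ} {φ : RSpace n →L[ℝ] ℝ} {s : RSpace k × ℝ → RSpace n}
  {B : Set (RSpace k × ℝ)}

lemma normallyPseudoFlat_of_tendsto {S : Set (RSpace n)} (hcl : X ⊆ closure (S \ X))
    (h : ∀ x ∈ X, ∃ q, Tendsto (fun y => unitVector (nearestPoint X y - y)) (𝓝[S \ X] x) (𝓝 q)) :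
    NormallyPseudoFlat X S := by
  set f : RSpace n → RSpace n := fun y => unitVector (nearestPoint X y - y)
  have hcont : ContinuousOn (extendFrom (S \ X) f) X := continuousOn_extendFrom hcl h
  have hlim : ∀ x ∈ X, Tendsto f (𝓝[S \ X] x) (𝓝 (extendFrom (S \ X) f x)) := fun x hx =>
    tendsto_extendFrom (h x hx)
  have hmem : ∀ x ∈ X, (x, extendFrom (S \ X) f x) ∈ normalCone X S := fun x hx =>
    haveI := mem_closure_iff_nhdsWithin_neBot.1 (hcl hx)
    mem_normalCone_of_tendsto hx le_rfl (hlim x hx)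
  refine IsOpenMap.of_sections fun z => ⟨fun x => ⟨(x, extendFrom (S \ X) f x), hmem x x.2⟩,
    ?_, ?_, fun x => rfl⟩
  · exact (Continuous.subtype_mk (continuous_subtype_val.prodMk
      (continuousOn_iff_continuous_domRestrict.1 hcont)) _).continuousAt
  · exact Subtype.ext (Prod.ext rfl (eq_of_mem_normalCone z.2 (hlim _ z.2.1)).symm)

lemma isLittleO_sub_sub_fderiv {E F : Type*} [NormedAddCommGroup E] [NormedSpace ℝ E]
    [NormedAddCommGroup F] [NormedSpace ℝ F] {f : E → F} {x : E} (hf : ContDiffAt ℝ 1 f x) :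
    (fun p : E × E => f p.1 - f p.2 - fderiv ℝ f p.2 (p.1 - p.2)) =o[𝓝 (x, x)]
      fun p => p.1 - p.2 := by
  have hlim : Tendsto (fun p : E × E => ‖fderiv ℝ f x - fderiv ℝ f p.2‖) (𝓝 (x, x)) (𝓝 0) := by
    simpa using (((hf.continuousAt_fderiv one_ne_zero).tendsto.comp
      (continuous_snd.tendsto (x, x))).const_sub (fderiv ℝ f x)).norm
  have hderiv : (fun p : E × E => (fderiv ℝ f x - fderiv ℝ f p.2) (p.1 - p.2)) =o[𝓝 (x, x)]
      fun p => p.1 - p.2 :=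
    isLittleO_of_norm_le_mul hlim (.of_forall fun p => ContinuousLinearMap.le_opNorm _ _)
  refine ((hf.hasStrictFDerivAt one_ne_zero).isLittleO.add hderiv).congr_left fun p => ?_
  rw [sub_apply]
  abel

namespace IsCollar

lemma disjoint (h : IsCollar X Y P g δ φ s B) : Disjoint X Y := by
  refine Set.disjoint_left.2 fun x hx hy => (h.inv x hy).1.ne' ?_
  simp only [heightMap]
  rw [← (h.tube.mem_iff x (h.subset hx)).1 hx, sub_self, map_zero]

lemma exists_section_eq (h : IsCollar X Y P g δ φ s B) {x : RSpace n} (hx : x ∈ X) :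
    ∃ u ∈ ball (0 : RSpace k) δ, g u = x :=
  ⟨P x, proj_mem_ball_of_mem_tubeSet (h.subset hx), ((h.tube.mem_iff x (h.subset hx)).1 hx).symm⟩

lemma contDiffAt (h : IsCollar X Y P g δ φ s B) {b : RSpace k × ℝ} (hb : b ∈ B) :
    ContDiffAt ℝ 1 s b := h.smooth.contDiffAt (h.isOpen.mem_nhds hb)

lemma hasStrictFDerivAt (h : IsCollar X Y P g δ φ s B) {b : RSpace k × ℝ} (hb : b ∈ B) :
    HasStrictFDerivAt s (fderiv ℝ s b) b := (h.contDiffAt hb).hasStrictFDerivAt one_ne_zero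

lemma continuousAt_fderiv (h : IsCollar X Y P g δ φ s B) {b : RSpace k × ℝ} (hb : b ∈ B) :
    ContinuousAt (fderiv ℝ s) b := (h.contDiffAt hb).continuousAt_fderiv one_ne_zero

lemma fderiv_mem_tangentVectors (h : IsCollar X Y P g δ φ s B) {y : RSpace n} (hy : y ∈ Y)
    (w : RSpace k × ℝ) : fderiv ℝ s (heightMap P g φ y) w ∈ tangentVectors Y y := by
  obtain ⟨hpos, hB, hsy⟩ := h.inv y hy
  set b := heightMap P g φ y
  have hline : HasDerivAt (fun t : ℝ => b + t • w) w 0 := by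
    simpa using ((hasDerivAt_id (0 : ℝ)).smul_const w).const_add b
  have hlim : Tendsto (fun t : ℝ => b + t • w) (𝓝 0) (𝓝 b) := by
    simpa using hline.continuousAt.tendsto
  refine ⟨fun t => s (b + t • w), by simp [hsy], ?_, ?_⟩
  · filter_upwards [hlim.eventually (h.isOpen.mem_nhds hB),
      hlim.eventually ((isOpen_lt continuous_const continuous_snd).mem_nhds hpos)] with t ht ht'
      using h.mem _ ht ht'
  · have hs : HasFDerivAt s (fderiv ℝ s b) (b + (0 : ℝ) • w) := by
      simpa using (h.hasStrictFDerivAt hB).hasFDerivAt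
    exact hs.comp_hasDerivAt (0 : ℝ) hline

lemma fderiv_section (h : IsCollar X Y P g δ φ s B) {u : RSpace k}
    (hu : u ∈ ball (0 : RSpace k) δ) (v : RSpace k) :
    fderiv ℝ s (u, 0) (v, 0) = fderiv ℝ g u v := by
  have hsec : HasFDerivAt (fun u : RSpace k => s (u, 0))
      ((fderiv ℝ s (u, 0)).comp (ContinuousLinearMap.inl ℝ (RSpace k) ℝ)) u :=
    HasFDerivAt.comp u (h.hasStrictFDerivAt (h.section_zero u hu).1).hasFDerivAt
      (ContinuousLinearMap.inl ℝ (RSpace k) ℝ).hasFDerivAt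
  have hg : g =ᶠ[𝓝 u] fun u => s (u, 0) := by
    filter_upwards [Metric.isOpen_ball.mem_nhds hu] with w hw using (h.section_zero w hw).2.symm
  rw [(hsec.congr_of_eventuallyEq hg).fderiv]
  rfl

lemma tendsto_heightMap (h : IsCollar X Y P g δ φ s B) {u : RSpace k}
    (hu : u ∈ ball (0 : RSpace k) δ) : Tendsto (heightMap P g φ) (𝓝 (g u)) (𝓝 (u, 0)) := by
  rw [← h.tube.heightMap_section (φ := φ) hu]
  exact (h.tube.contDiffAt_heightMap (h.tube.section_mem_tubeSet hu)).continuousAt.tendsto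

lemma tendsto_heightMap_nearestPoint (h : IsCollar X Y P g δ φ s B) {u : RSpace k}
    (hu : u ∈ ball (0 : RSpace k) δ) :
    Tendsto (fun y => heightMap P g φ (nearestPoint X y)) (𝓝 (g u)) (𝓝 (u, 0)) :=
  (h.tendsto_heightMap hu).comp (h.tube.tendsto_nearestPoint hu)

lemma tendsto_fderiv_sub (h : IsCollar X Y P g δ φ s B) {u : RSpace k}
    (hu : u ∈ ball (0 : RSpace k) δ) :
    Tendsto (fun y => fderiv ℝ s (heightMap P g φ (nearestPoint X y)) -
      fderiv ℝ s (heightMap P g φ y)) (𝓝 (g u)) (𝓝 0) := by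
  have hcont := (h.continuousAt_fderiv (h.section_zero u hu).1).tendsto
  simpa using (hcont.comp (h.tendsto_heightMap_nearestPoint hu)).sub
    (hcont.comp (h.tendsto_heightMap hu))

lemma eventually_heightMap_nearestPoint (h : IsCollar X Y P g δ φ s B) {u : RSpace k}
    (hu : u ∈ ball (0 : RSpace k) δ) :
    ∀ᶠ y in 𝓝 (g u), heightMap P g φ (nearestPoint X y) = (P (nearestPoint X y), 0) ∧
      s (heightMap P g φ (nearestPoint X y)) = nearestPoint X y := by
  filter_upwards [h.tube.eventually_nearestPoint_eq hu,
    (h.tube.tendsto_proj_nearestPoint hu).eventually (Metric.isOpen_ball.mem_nhds hu)] with y hy hP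
  have hheight := h.tube.heightMap_section (φ := φ) hP
  rw [← hy] at hheight
  exact ⟨hheight, by rw [hheight, (h.section_zero _ hP).2, ← hy]⟩

lemma normalProj_fderiv (h : IsCollar X Y P g δ φ s B) {y : RSpace n} (hy : y ∈ Y)
    (A : RSpace k × ℝ →L[ℝ] RSpace n) (w : RSpace k × ℝ) :
    normalProj Y y (A w) = normalProj Y y ((A - fderiv ℝ s (heightMap P g φ y)) w) := by
  rw [sub_apply, map_sub, normalProj_eq_zero (h.fderiv_mem_tangentVectors hy w), sub_zero]

lemma tendsto_whitneyAlpha (h : IsCollar X Y P g δ φ s B) {u : RSpace k}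
    (hu : u ∈ ball (0 : RSpace k) δ) : Tendsto (whitneyAlpha X Y) (𝓝[Y] (g u)) (𝓝 0) := by
  have hbound : Tendsto (fun y => ‖fderiv ℝ s (heightMap P g φ (nearestPoint X y)) -
      fderiv ℝ s (heightMap P g φ y)‖ * ‖P‖) (𝓝[Y] (g u)) (𝓝 0) := by
    simpa using ((h.tendsto_fderiv_sub hu).mono_left nhdsWithin_le_nhds).norm.mul_const ‖P‖
  refine squeeze_zero' (Eventually.of_forall fun y => whitneyAlpha_nonneg X Y y) ?_ hbound
  filter_upwards [self_mem_nhdsWithin,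
    nhdsWithin_le_nhds (h.eventually_heightMap_nearestPoint hu),
    nhdsWithin_le_nhds (h.tube.eventually_nearestPoint_eq hu),
    nhdsWithin_le_nhds ((h.tube.tendsto_proj_nearestPoint hu).eventually
      (Metric.isOpen_ball.mem_nhds hu))] with y hy hheight hπ hP
  refine whitneyAlpha_le (by positivity) fun b hb => ?_
  rw [hπ, h.tube.tangentVectors_eq hP] at hb
  obtain ⟨v, rfl⟩ := hb
  have hv : ‖((v, 0) : RSpace k × ℝ)‖ ≤ ‖P‖ * ‖fderiv ℝ g (P (nearestPoint X y)) v‖ := by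
    simpa [h.tube.proj_fderiv hP] using P.le_opNorm (fderiv ℝ g (P (nearestPoint X y)) v)
  rw [← h.fderiv_section hP] at hv ⊢
  rw [hheight.1, h.normalProj_fderiv hy]
  calc _ ≤ _ := norm_normalProj_le _ _ _
    _ ≤ _ := ContinuousLinearMap.le_opNorm _ _
    _ ≤ _ := mul_le_mul_of_nonneg_left hv (norm_nonneg _)
    _ = _ := (mul_assoc _ _ _).symm

lemma isBigO_heightMap_sub (h : IsCollar X Y P g δ φ s B) {u : RSpace k}
    (hu : u ∈ ball (0 : RSpace k) δ) :
    (fun y => heightMap P g φ (nearestPoint X y) - heightMap P g φ y) =O[𝓝 (g u)]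
      fun y => nearestPoint X y - y := by
  have hstrict := (h.tube.contDiffAt_heightMap (φ := φ)
    (h.tube.section_mem_tubeSet hu)).hasStrictFDerivAt one_ne_zero
  exact hstrict.isBigO_sub.comp_tendsto ((h.tube.tendsto_nearestPoint hu).prodMk_nhds tendsto_id)

lemma isLittleO_normalProj (h : IsCollar X Y P g δ φ s B) {u : RSpace k}
    (hu : u ∈ ball (0 : RSpace k) δ) :
    (fun y => normalProj Y y (nearestPoint X y - y)) =o[𝓝[Y] (g u)]
      fun y => nearestPoint X y - y := by
  have hsecant := (isLittleO_sub_sub_fderiv (h.contDiffAt (h.section_zero u hu).1)).comp_tendsto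
    ((h.tendsto_heightMap_nearestPoint hu).prodMk_nhds (h.tendsto_heightMap hu))
  refine IsBigO.trans_isLittleO (.of_bound 1 ?_)
    ((hsecant.trans_isBigO (h.isBigO_heightMap_sub hu)).mono nhdsWithin_le_nhds)
  filter_upwards [self_mem_nhdsWithin,
    nhdsWithin_le_nhds (h.eventually_heightMap_nearestPoint hu)] with y hy hπ
  set b := heightMap P g φ y with hb
  set w := heightMap P g φ (nearestPoint X y) - b
  have hsy : s b = y := (h.inv y hy).2.2
  have htangent : normalProj Y y (fderiv ℝ s b w) = 0 :=
    normalProj_eq_zero (h.fderiv_mem_tangentVectors hy w)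
  calc ‖normalProj Y y (nearestPoint X y - y)‖
      = ‖normalProj Y y (nearestPoint X y - y - fderiv ℝ s b w)‖ := by
        rw [map_sub _ (nearestPoint X y - y), htangent, sub_zero]
    _ ≤ ‖nearestPoint X y - y - fderiv ℝ s b w‖ := norm_normalProj_le _ _ _
    _ = 1 * _ := by simp only [Function.comp_apply, ← hb, hπ.2, hsy, one_mul, w]

lemma tendsto_whitneyBeta (h : IsCollar X Y P g δ φ s B) {u : RSpace k}
    (hu : u ∈ ball (0 : RSpace k) δ) : Tendsto (whitneyBeta X Y) (𝓝[Y] (g u)) (𝓝 0) := by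
  rw [Metric.tendsto_nhds]
  intro ε hε
  filter_upwards [(h.isLittleO_normalProj hu).def (half_pos hε)] with y hy
  rw [Real.dist_0_eq_abs, abs_of_nonneg (whitneyBeta_nonneg X Y y)]
  exact (whitneyBeta_le (half_pos hε).le hy).trans_lt (half_lt_self hε)

theorem whitneyB (h : IsCollar X Y P g δ φ s B) : WhitneyB X Y := by
  intro x hx
  obtain ⟨u, hu, rfl⟩ := h.exists_section_eq hx
  exact ⟨h.tendsto_whitneyAlpha hu, h.tendsto_whitneyBeta hu⟩

lemma subset_closure (h : IsCollar X Y P g δ φ s B) : X ⊆ closure Y := by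
  intro x hx
  obtain ⟨u, hu, rfl⟩ := h.exists_section_eq hx
  obtain ⟨hB, hs⟩ := h.section_zero u hu
  have hline : Tendsto (fun t : ℝ => (u, t)) (𝓝[>] 0) (𝓝 (u, 0)) :=
    tendsto_const_nhds.prodMk_nhds (tendsto_id.mono_left nhdsWithin_le_nhds)
  have hlim := (h.contDiffAt hB).continuousAt.tendsto.comp hline
  rw [hs] at hlim
  refine mem_closure_of_tendsto hlim ?_
  filter_upwards [hline.eventually (h.isOpen.mem_nhds hB), self_mem_nhdsWithin] with t ht ht0
    using h.mem _ ht ht0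

lemma neBot (h : IsCollar X Y P g δ φ s B) {u : RSpace k} (hu : u ∈ ball (0 : RSpace k) δ) :
    (𝓝[Y] (g u)).NeBot :=
  mem_closure_iff_nhdsWithin_neBot.1 (h.subset_closure (h.tube.section_mem hu))

lemma tendsto_inv_height_smul (h : IsCollar X Y P g δ φ s B) {u : RSpace k}
    (hu : u ∈ ball (0 : RSpace k) δ) :
    Tendsto (fun y => (heightMap P g φ y).2⁻¹ • (y - g (P y))) (𝓝[Y] (g u))
      (𝓝 (fderiv ℝ s (u, 0) (0, 1))) := by
  rw [Metric.tendsto_nhds]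
  intro ε hε
  have hfoot : Tendsto (fun y => (P y, (0 : ℝ))) (𝓝 (g u)) (𝓝 (u, 0)) :=
    (h.tube.tendsto_proj hu).prodMk_nhds tendsto_const_nhds
  have hs := ((h.hasStrictFDerivAt (h.section_zero u hu).1).isLittleO.comp_tendsto
    ((h.tendsto_heightMap hu).prodMk_nhds hfoot)).def (half_pos hε)
  filter_upwards [self_mem_nhdsWithin, nhdsWithin_le_nhds hs, nhdsWithin_le_nhds
    ((h.tube.tendsto_proj hu).eventually (Metric.isOpen_ball.mem_nhds hu))] with y hy hsy hPy
  obtain ⟨hpos, -, hinv⟩ := h.inv y hy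
  simp only [Function.comp_apply, hinv, (h.section_zero _ hPy).2] at hsy
  set t := (heightMap P g φ y).2
  have hvert : heightMap P g φ y - (P y, 0) = t • ((0 : RSpace k), (1 : ℝ)) :=
    Prod.ext (by simp [heightMap]) (by simp [t])
  have hnorm : ‖t • ((0 : RSpace k), (1 : ℝ))‖ = t := by simp [abs_of_pos hpos, hpos.le]
  rw [hvert, hnorm, map_smul] at hsy
  rw [dist_eq_norm]
  calc ‖t⁻¹ • (y - g (P y)) - fderiv ℝ s (u, 0) (0, 1)‖
      = t⁻¹ * ‖y - g (P y) - t • fderiv ℝ s (u, 0) (0, 1)‖ := by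
        rw [← norm_smul_of_nonneg (inv_nonneg.2 hpos.le), smul_sub _ (y - g (P y)),
          inv_smul_smul₀ hpos.ne']
    _ ≤ t⁻¹ * (ε / 2 * t) := by gcongr
    _ = ε / 2 := by field_simp
    _ < ε := half_lt_self hε

lemma apply_fderiv_zero_one (h : IsCollar X Y P g δ φ s B) {u : RSpace k}
    (hu : u ∈ ball (0 : RSpace k) δ) : φ (fderiv ℝ s (u, 0) (0, 1)) = 1 := by
  have := h.neBot hu
  refine tendsto_nhds_unique ((φ.continuous.tendsto _).comp (h.tendsto_inv_height_smul hu))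
    (tendsto_const_nhds.congr' ?_)
  filter_upwards [self_mem_nhdsWithin] with y hy
  rw [Function.comp_apply, map_smul, smul_eq_mul]
  exact (inv_mul_cancel₀ (h.inv y hy).1.ne').symm

lemma tendsto_collarDir (h : IsCollar X Y P g δ φ s B) {u : RSpace k}
    (hu : u ∈ ball (0 : RSpace k) δ) :
    Tendsto (collarDir P g) (𝓝[Y] (g u)) (𝓝 (unitVector (fderiv ℝ s (u, 0) (0, 1)))) := by
  have hne : fderiv ℝ s (u, 0) (0, 1) ≠ 0 := fun hzero => by
    simpa [hzero] using h.apply_fderiv_zero_one hu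
  refine ((continuousAt_unitVector hne).tendsto.comp (h.tendsto_inv_height_smul hu)).congr' ?_
  filter_upwards [self_mem_nhdsWithin] with y hy
  exact unitVector_smul (inv_pos.2 (h.inv y hy).1) _

theorem normallyPseudoFlat (h : IsCollar X Y P g δ φ s B) : NormallyPseudoFlat X (Y ∪ X) := by
  have hY : (Y ∪ X) \ X = Y := by rw [union_sdiff_right, h.disjoint.symm.sdiff_eq_left]
  refine normallyPseudoFlat_of_tendsto (by rw [hY]; exact h.subset_closure) fun x hx => ?_
  obtain ⟨u, hu, rfl⟩ := h.exists_section_eq hx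
  have := h.neBot hu
  rw [hY]
  exact ⟨_, h.tube.tendsto_direction_of_collarDir h.disjoint hu le_rfl (h.tendsto_collarDir hu)⟩

end IsCollar

theorem exists_whitneyB_of_isSubmanifoldWithBoundary (hX : IsSubmanifold 1 k X)
    (hY : IsSubmanifold 1 (k + 1) Y) (hXY : Disjoint X Y) (h0 : (0 : RSpace n) ∈ X)
    (hconn : ∀ᶠ ε in 𝓝[>] (0 : ℝ), IsConnected (Y ∩ ball 0 ε))
    {U : Set (RSpace n)} (hU : IsOpen U) (h0U : (0 : RSpace n) ∈ U)
    (hM : IsSubmanifoldWithBoundary 1 (k + 1) ((Y ∪ X) ∩ U)) :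
    ∃ V : Set (RSpace n), IsOpen V ∧ 0 ∈ V ∧ V ⊆ U ∧ WhitneyB (X ∩ V) (Y ∩ V) ∧
      NormallyPseudoFlat (X ∩ V) ((Y ∪ X) ∩ V) ∧
      submanifoldBoundary 1 (k + 1) ((Y ∪ X) ∩ V) = X ∩ V := by
  obtain ⟨P, g, δ, hT⟩ := exists_isTube hX h0
  obtain ⟨Φ, hΦ⟩ := hM.2 0 ⟨Or.inr h0, h0U⟩
  replace hΦ : IsStraightening 1 (Y ∪ X) (halfModel n (k + 1)) 0 (Φ.restrOpen U hU) :=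
    hΦ.restrOpen hU h0U fun q hq => (and_iff_left hq).symm
  obtain ⟨δ', φ, s, B, hsub, hcollar⟩ := hT.exists_isCollar hXY hconn hΦ (i := ⟨k, hY.1⟩) rfl
  have hV := hcollar.tube.isOpen_tubeSet
  refine ⟨tubeSet P g δ', hV, mem_of_mem_nhds hcollar.tube.tubeSet_mem_nhds_zero,
    fun q hq => (hsub hq).1.2, hcollar.whitneyB, ?_, Subset.antisymm ?_ ?_⟩
  · rw [union_inter_distrib_right]
    exact hcollar.normallyPseudoFlat
  · rintro p ⟨⟨hp, hpV⟩, Ψ, hΨ, i, hi, hpi⟩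
    refine ⟨hp.resolve_left fun hpY => hΨ.apply_ne_zero_of_isSubmanifold hY hpY ?_
      (Nat.succ_injective hi) hpi, hpV⟩
    filter_upwards [hV.mem_nhds hpV] with q hq hqY using ⟨Or.inl hqY, hq⟩
  · rintro p ⟨hp, hpV⟩
    have hΦp : IsStraightening 1 (Y ∪ X) (halfModel n (k + 1)) p (Φ.restrOpen U hU) :=
      ⟨(hsub hpV).1, hΦ.2⟩
    exact ⟨⟨Or.inr hp, hpV⟩, _, hΦp.restrOpen hV hpV fun q hq => and_iff_left hq,
      ⟨k, hY.1⟩, rfl, (hsub hpV).2 hp⟩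

end Collar

/-- `nearestPoint` may be any choice of a nearest point: for `C^1` strata it need not be unique. -/
theorem proposition3p9_general
    (L : FirstOrder.Language.{u, v}) [L.Structure ℝ] (hL : IsOMinimalExpansionOfRealField L)
    {n k : ℕ} (X Y : Set (RSpace n)) (hYdef : IsDefinableSet L Y)
    (hX : IsSubmanifold 1 k X) (hY : IsSubmanifold 1 (k + 1) Y)
    (hdisj : Disjoint X Y) (hfrontier : X ⊆ closure Y)
    (hclosed : IsLocallyClosed (X ∪ Y)) (h0 : (0 : RSpace n) ∈ X)
    (hconn : ∃ ε₀ > 0, ∀ ε, 0 < ε → ε < ε₀ → IsConnected (Y ∩ Metric.ball 0 ε)) :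
    ((∃ U : Set (RSpace n), IsOpen U ∧ 0 ∈ U ∧
        WhitneyB (X ∩ U) (Y ∩ U) ∧ NormallyPseudoFlat (X ∩ U) ((Y ∪ X) ∩ U)) ↔
      ∃ U : Set (RSpace n), IsOpen U ∧ 0 ∈ U ∧
        IsSubmanifoldWithBoundary 1 (k + 1) ((Y ∪ X) ∩ U)) ∧
    ∀ U : Set (RSpace n), IsOpen U → 0 ∈ U →
      IsSubmanifoldWithBoundary 1 (k + 1) ((Y ∪ X) ∩ U) →
        ∃ V : Set (RSpace n), IsOpen V ∧ 0 ∈ V ∧ V ⊆ U ∧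
          submanifoldBoundary 1 (k + 1) ((Y ∪ X) ∩ V) = X ∩ V := by
  have hconn' : ∀ᶠ ε in 𝓝[>] (0 : ℝ), IsConnected (Y ∩ ball 0 ε) := by
    obtain ⟨ε₀, hε₀, hconn⟩ := hconn
    filter_upwards [Ioo_mem_nhdsGT hε₀] with ε hε using hconn ε hε.1 hε.2
  refine ⟨⟨fun ⟨U, hU, h0U, hb, hnpf⟩ => exists_isSubmanifoldWithBoundary hL hYdef hX hY hdisj
    hfrontier hclosed h0 hconn' hU h0U hb hnpf, fun ⟨U, hU, h0U, hM⟩ => ?_⟩, fun U hU h0U hM => ?_⟩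
  · obtain ⟨V, hV, h0V, -, hb, hnpf, -⟩ :=
      exists_whitneyB_of_isSubmanifoldWithBoundary hX hY hdisj h0 hconn' hU h0U hM
    exact ⟨V, hV, h0V, hb, hnpf⟩
  · obtain ⟨V, hV, h0V, hVU, -, -, hbd⟩ :=
      exists_whitneyB_of_isSubmanifoldWithBoundary hX hY hdisj h0 hconn' hU h0U hM
    exact ⟨V, hV, h0V, hVU, hbd⟩

theorem proposition3p9
    (L : FirstOrder.Language.{u, v}) [L.Structure ℝ] (hL : IsOMinimalExpansionOfRealField L)
    {n k : ℕ} (X Y : Set (RSpace n))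
    (hXdef : IsDefinableSet L X) (hYdef : IsDefinableSet L Y)
    (hX : IsSubmanifold 2 k X) (hY : IsSubmanifold 2 (k + 1) Y)
    (hdisj : Disjoint X Y) (hfrontier : X ⊆ closure Y)
    (hclosed : IsLocallyClosed (X ∪ Y)) (h0 : (0 : RSpace n) ∈ X)
    (hconn : ∃ ε₀ > 0, ∀ ε, 0 < ε → ε < ε₀ → IsConnected (Y ∩ Metric.ball 0 ε)) :
    ((∃ U : Set (RSpace n), IsOpen U ∧ 0 ∈ U ∧
        WhitneyB (X ∩ U) (Y ∩ U) ∧ NormallyPseudoFlat (X ∩ U) ((Y ∪ X) ∩ U)) ↔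
      ∃ U : Set (RSpace n), IsOpen U ∧ 0 ∈ U ∧
        IsSubmanifoldWithBoundary 1 (k + 1) ((Y ∪ X) ∩ U)) ∧
    ∀ U : Set (RSpace n), IsOpen U → 0 ∈ U →
      IsSubmanifoldWithBoundary 1 (k + 1) ((Y ∪ X) ∩ U) →
        ∃ V : Set (RSpace n), IsOpen V ∧ 0 ∈ V ∧ V ⊆ U ∧
          submanifoldBoundary 1 (k + 1) ((Y ∪ X) ∩ V) = X ∩ V := by
  exact proposition3p9_general L hL X Y hYdef (hX.of_le one_le_two) (hY.of_le one_le_two) hdisj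
    hfrontier hclosed h0 hconn
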